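/- Let $\mathbb{D}$ be the Poincaré disc with its hyperbolic distance $d$ (curvature $-1$). For an orientation-preserving isometry $g$ of $\mathbb{D}$ with $g(0)\neq 0$ let $D(g)=\{z\in\mathbb{D}: d(z,g(0))\le d(z,0)\}$. Let $h$ be a hyperbolic and $p$ a parabolic orientation-preserving isometry of $\mathbb{D}$ such that $\overline{D(h)\cup D(h^{-1})}\cap\overline{D(p)\cup D(p^{-1})}=\emptyset$ (closures in the closed disc), let $\Gamma=\langle h,p\rangle$ be the Schottky group they generate, and let $\Sigma=\Gamma\backslash\mathbb{D}$, with projection $\pi:\mathbb{D}\to\Sigma$. A point $\xi\in\partial\mathbb{D}$ is called a limit point if it is in the closure of $\Gamma\cdot 0$; it is called a parabolic limit point if it is fixed by a parabolic element of $\Gamma$; and it is called diverging on average if it is a limit point and, for every geodesic ray $\tilde\sigma:[0,\infty)\to\mathbb{D}$ parametrized by arc length and ending at $\xi$ and every compact $W\subset\Sigma$, $$\lim_{T\to+\infty}\frac1T\int_0^T\chi_W(\pi(\tilde\sigma(t)))\,dt=0 .$$ For an integer $N\ge 1$, an $N$-block is an element $\omega=h^{j_1}p^{l_1}h^{j_2}p^{l_2}\cdots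 p^{l_{s-1}}h^{j_s}$ of $\Gamma$ with $s\ge 1$, all $j_k\in\mathbb{Z}\setminus\{0\}$, and $0<|l_k|<N$. A coding of $\xi$ at level $N$, $$\xi=\omega_0\,p^{r_1}\,\omega_1\,p^{r_2}\,\omega_2\,p^{r_3}\cdots ,$$ consists of integers $r_i$ with $|r_i|\ge N$ ($i\ge 1$), $N$-blocks $\omega_i$ ($i\ge1$), and an initial term $\omega_0$ which is either the identity or of the form $p^{l}\omega$ with $|l|<N$ and $\omega$ an $N$-block, such that $\omega_0p^{r_1}\omega_1p^{r_2}\cdots\omega_{q-1}p^{r_q}(0)\to\xi$ as $q\to\infty$. Theorem. A point $\xi\in\partial\mathbb{D}$ is diverging on average if and only if either $\xi$ is a parabolic limit point, or for every integer $N\ge 1$ there is a coding of $\xi$ at level $N$ such that $\sum_{i=1}^{q}2\ln|r_i|>0$ for all large $q$ and $$\lim_{q\to+\infty}\frac{\sum_{i=0}^{q}d(0,\omega_i(0))}{\sum_{i=1}^{q}2\ln|r_i|}=0 .$$ -/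

import Mathlib

namespace SchottkyDisc

open Complex Filter Topology
open scoped ComplexConjugate Complex.UnitDisc

/-! ### The Poincare disc, its orientation preserving isometries and its geodesic rays -/

/-- The hyperbolic distance (curvature `-1`) of the Poincare disc. -/
noncomputable def hypDist (z w : 𝔻) : ℝ :=
  2 * Real.arsinh (‖(z : ℂ) - w‖ / √((1 - ‖(z : ℂ)‖ ^ 2) * (1 - ‖(w : ℂ)‖ ^ 2)))

/-- The group `SU(1,1)` of complex matrices `(a, b; conj b, conj a)` of determinant one. Acting by
Moebius maps, it is the group of orientation preserving isometries of the disc (up to sign). -/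
def SU11 : Subgroup (Matrix.SpecialLinearGroup (Fin 2) ℂ) where
  carrier := {g | g 1 1 = conj (g 0 0) ∧ g 1 0 = conj (g 0 1)}
  one_mem' := by simp
  mul_mem' := by
    rintro g k ⟨hg1, hg2⟩ ⟨hk1, hk2⟩
    simp only [Set.mem_ofPred_eq, Matrix.SpecialLinearGroup.coe_mul, Matrix.mul_apply,
      Fin.sum_univ_two, hg1, hg2, hk1, hk2, map_add, map_mul, Complex.conj_conj]
    constructor <;> ring
  inv_mem' := by
    rintro g ⟨hg1, hg2⟩
    change g⁻¹.1 1 1 = conj (g⁻¹.1 0 0) ∧ g⁻¹.1 1 0 = conj (g⁻¹.1 0 1)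
    rw [Matrix.SpecialLinearGroup.SL2_inv_expl]
    simp [hg1, hg2]

/-- The Moebius map `z ↦ (a z + b) / (c z + d)` of a matrix, used on the closed unit disc. -/
noncomputable def moebius (g : SU11) (z : ℂ) : ℂ :=
  (g.1 0 0 * z + g.1 0 1) / (g.1 1 0 * z + g.1 1 1)

theorem normSq_denom_sub (g : SU11) (z : ℂ) :
    normSq (g.1 1 0 * z + g.1 1 1) - normSq (g.1 0 0 * z + g.1 0 1) = 1 - normSq z := by
  have hdet := g.1.det_coe
  rw [Matrix.det_fin_two, g.2.1, g.2.2, Complex.mul_conj, Complex.mul_conj] at hdet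
  have hdet' : normSq (g.1 0 0) - normSq (g.1 0 1) = 1 := by exact_mod_cast hdet
  rw [g.2.1, g.2.2]
  simp only [normSq_apply, add_re, add_im, mul_re, mul_im, conj_re, conj_im] at hdet' ⊢
  linear_combination (1 - z.re * z.re - z.im * z.im) * hdet'

theorem normSq_denom_pos (g : SU11) (z : 𝔻) :
    0 < normSq (g.1 1 0 * (z : ℂ) + g.1 1 1) := by
  have h1 := normSq_denom_sub g z
  have h2 := z.normSq_lt_one
  have h3 := normSq_nonneg (g.1 0 0 * (z : ℂ) + g.1 0 1)
  linarith

theorem norm_moebius_lt_one (g : SU11) (z : 𝔻) : ‖moebius g z‖ < 1 := by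
  have h0 := normSq_denom_pos g z
  have h1 := normSq_denom_sub g z
  have h2 := z.normSq_lt_one
  have h3 : normSq (moebius g z) < 1 := by
    rw [moebius, normSq_div, div_lt_one h0]
    linarith
  rw [Complex.normSq_eq_norm_sq] at h3
  exact (sq_lt_one_iff₀ (norm_nonneg _)).1 h3

/-- The action of `SU(1,1)` on the disc by Moebius maps. -/
noncomputable instance instMulAction : MulAction SU11 𝔻 where
  smul g z := UnitDisc.mk (moebius g z) (norm_moebius_lt_one g z)
  one_smul z := by
    apply UnitDisc.coe_injective
    change moebius 1 z = z
    simp [moebius]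
  mul_smul g k z := by
    apply UnitDisc.coe_injective
    change moebius (g * k) z = moebius g (moebius k z)
    have hk : k.1 1 0 * (z : ℂ) + k.1 1 1 ≠ 0 := normSq_pos.1 (normSq_denom_pos k z)
    have hg : g.1 1 0 * moebius k z + g.1 1 1 ≠ 0 :=
      normSq_pos.1 (normSq_denom_pos g (UnitDisc.mk (moebius k z) (norm_moebius_lt_one k z)))
    have hgk : (g * k).1 1 0 * (z : ℂ) + (g * k).1 1 1 ≠ 0 :=
      normSq_pos.1 (normSq_denom_pos (g * k) z)
    rw [moebius, moebius, div_eq_div_iff hgk hg]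
    simp only [moebius, Subgroup.coe_mul, Matrix.SpecialLinearGroup.coe_mul, Matrix.mul_apply,
      Fin.sum_univ_two]
    field_simp
    ring

@[simp] theorem coe_smul (g : SU11) (z : 𝔻) : ((g • z : 𝔻) : ℂ) = moebius g z := rfl

/-- Hyperbolic elements; the trace of an element of `SU(1,1)` is real. -/
def IsHyperbolic (g : SU11) : Prop := 2 < |(g.1.1.trace).re|

/-- Parabolic elements. -/
def IsParabolic (g : SU11) : Prop := |(g.1.1.trace).re| = 2 ∧ g.1 ≠ 1 ∧ g.1 ≠ -1

/-- A geodesic ray of the disc, parametrized by arc length (`σ` matters only on `[0, ∞)`). -/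
def IsGeodesicRay (σ : ℝ → 𝔻) : Prop :=
  ∀ s t : ℝ, 0 ≤ s → 0 ≤ t → hypDist (σ s) (σ t) = |s - t|

/-- The point `ξ` of the circle is the endpoint of `σ`. -/
def EndsAt (σ : ℝ → 𝔻) (ξ : Circle) : Prop :=
  Tendsto (fun t : ℝ => (σ t : ℂ)) atTop (𝓝 (ξ : ℂ))

/-! ### Limit points -/

/-- `ξ` is a limit point: it is an accumulation point of the orbit of the centre. -/
def IsLimitPoint (Γ : Subgroup SU11) (ξ : Circle) : Prop :=
  (ξ : ℂ) ∈ closure {z : ℂ | ∃ γ ∈ Γ, ((γ • (0 : 𝔻) : 𝔻) : ℂ) = z}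

/-- `ξ` is a parabolic limit point: it is the fixed point of a parabolic element of `Γ`. -/
def IsParabolicPoint (Γ : Subgroup SU11) (ξ : Circle) : Prop :=
  ∃ γ ∈ Γ, IsParabolic γ ∧ moebius γ ξ = ξ

/-- The quotient surface `Γ \ 𝔻`, with its quotient topology. -/
abbrev Surface (Γ : Subgroup SU11) : Type := MulAction.orbitRel.Quotient Γ 𝔻

/-- The projection of the disc onto the quotient surface. -/
noncomputable def proj (Γ : Subgroup SU11) (z : 𝔻) : Surface Γ := Quotient.mk _ z

/-- `ξ` is a limit point diverging on average: a limit point such that every geodesic ray of the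
surface with a lift ending at `ξ` spends an asymptotically negligible proportion of its time in
every compact subset of the surface. -/
def DivergesOnAverage (Γ : Subgroup SU11) (ξ : Circle) : Prop :=
  IsLimitPoint Γ ξ ∧
    ∀ σ : ℝ → 𝔻, IsGeodesicRay σ → EndsAt σ ξ →
      ∀ W : Set (Surface Γ), IsCompact W →
        Tendsto (fun T : ℝ => (1 / T) * ∫ t in (0 : ℝ)..T,
          W.indicator (fun _ => (1 : ℝ)) (proj Γ (σ t))) atTop (𝓝 0)

/-! ### Schottky pairs -/

/-- The closed half-plane containing `g(0)` bounded by the bisector of `[0, g(0)]`, as a subset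
of `ℂ`. -/
def halfPlane (g : SU11) : Set ℂ :=
  {z : ℂ | ∃ w : 𝔻, (w : ℂ) = z ∧ hypDist w (g • (0 : 𝔻)) ≤ hypDist w 0}

/-- `h` is hyperbolic, `p` is parabolic and they are in Schottky position with respect to `0`.
The closures are taken in `ℂ`, hence in the closed disc. -/
structure IsSchottkyPair (h p : SU11) : Prop where
  hyperbolic : IsHyperbolic h
  parabolic : IsParabolic p
  disjoint : Disjoint (closure (halfPlane h ∪ halfPlane h⁻¹)) (closure (halfPlane p ∪ halfPlane p⁻¹))

/-! ### Codings -/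

/-- `IsBlock h p N ω` : `ω = h ^ j₁ * p ^ l₁ * h ^ j₂ * ⋯ * p ^ lₛ₋₁ * h ^ jₛ` with `s ≥ 1`, all
exponents nonzero (the word is reduced), and `|lₖ| < N`. -/
inductive IsBlock (h p : SU11) (N : ℕ) : SU11 → Prop
  | single (j : ℤ) : j ≠ 0 → IsBlock h p N (h ^ j)
  | cons (j l : ℤ) (ω : SU11) : j ≠ 0 → l ≠ 0 → |l| < (N : ℤ) → IsBlock h p N ω →
      IsBlock h p N (h ^ j * p ^ l * ω)

/-- Initial blocks: empty, or a block possibly preceded by a power `p ^ l` with `|l| < N`. -/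
def IsInitialBlock (h p : SU11) (N : ℕ) (ω : SU11) : Prop :=
  ω = 1 ∨ ∃ (l : ℤ) (ω' : SU11), |l| < (N : ℤ) ∧ IsBlock h p N ω' ∧ ω = p ^ l * ω'

/-- The prefix `ω₀ * p ^ r₁ * ω₁ * p ^ r₂ * ⋯ * ω_{q-1} * p ^ r_q`. -/
def codePrefix (p : SU11) (ω : ℕ → SU11) (r : ℕ → ℤ) : ℕ → SU11
  | 0 => 1
  | q + 1 => codePrefix p ω r q * (ω q * p ^ r (q + 1))

/-- `ξ = ω₀ p ^ r₁ ω₁ p ^ r₂ ω₂ ⋯` is a coding of `ξ` at level `N` (`r 0` is not used). -/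
structure IsCoding (h p : SU11) (N : ℕ) (ω : ℕ → SU11) (r : ℕ → ℤ) (ξ : Circle) : Prop where
  initial : IsInitialBlock h p N (ω 0)
  block : ∀ i, 1 ≤ i → IsBlock h p N (ω i)
  le_power : ∀ i, 1 ≤ i → (N : ℤ) ≤ |r i|
  tendsto : Tendsto (fun q : ℕ => ((codePrefix p ω r q • (0 : 𝔻) : 𝔻) : ℂ)) atTop (𝓝 (ξ : ℂ))

end SchottkyDisc

/-! The proof follows the geodesic ray from the centre to ξ. By `divergesOnAverage_iff` only the
time which this ray spends in the R-neighbourhoods of the orbit Γ·0, the thick part, has to be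
measured.

Suppose that ξ is read as an infinite reduced word, an alternation of powers h^j and p^r (an
`Itinerary`). Seen from the orbit point at the end of any syllable, the past of the word points to
the region of one generator and its future to that of the other. The Schottky hypothesis keeps these
apart by a fixed Euclidean distance δ. Hence the ray passes at bounded distance from that orbit
point (`hypDist_orbit_stdRay_le`), and lengths of syllables add up with a bounded error per syllable
(`Itinerary.exists_time_bounds`). Along a power of h the same separation holds at every intermediate
orbit point, so the ray stays in the thick part (`PingPong.mem_orbitNhd_of_pow`). Along p^r the ray
makes an excursion of length 2 ln|r| + O(1) into the cusp, and it meets a given thick part only near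
the two ends (`PingPong.exists_excursion_bound`). Therefore the thick time is comparable to the sum
of the block lengths, and the total time to that sum plus the sum of 2 ln|r_i|. All errors are
O(number of syllables). They are harmless because each power of h has length at least 2 ln(1 + κ),
so the number of syllables is itself bounded by a multiple of the block sum. The time average
vanishes exactly when block sum / excursion sum tends to 0.

This is the theorem at level N = 1, which suffices for one implication. For the other, a point
diverging on average has such a reading unless it is parabolic: an infinite final power of h would
keep the ray in the thick part forever, and an infinite final power of p makes ξ parabolic
(`PingPong.exists_itinerary`). Passing to level N absorbs the powers of p with exponent below N into
the blocks, which again costs O(1) per syllable (`Itinerary.exists_isCoding`). At a parabolic point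
the displacement of the parabolic element tends to 0 along the ray, so the ray leaves every thick
part for good. -/

namespace SchottkyDisc

open Complex Filter Topology
open scoped ComplexConjugate Complex.UnitDisc

/-! ### The automorphy factor -/

/-- The automorphy factor (denominator) of a Moebius map. -/
noncomputable def den (g : SU11) (z : ℂ) : ℂ := g.1 1 0 * z + g.1 1 1

theorem norm_den_sq_sub (g : SU11) (z : ℂ) :
    ‖den g z‖ ^ 2 - ‖g.1 0 0 * z + g.1 0 1‖ ^ 2 = 1 - ‖z‖ ^ 2 := by
  have := normSq_denom_sub g z
  simpa only [Complex.normSq_eq_norm_sq, den] using this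

theorem norm_entry_sq (g : SU11) : ‖g.1 1 1‖ ^ 2 = 1 + ‖g.1 1 0‖ ^ 2 := by
  have := norm_den_sq_sub g 0
  have h2 := congrArg norm g.2.2
  rw [norm_conj] at h2
  simp only [den, mul_zero, zero_add, norm_zero] at this
  rw [h2]; linarith

theorem norm_entry_lt (g : SU11) : ‖g.1 1 0‖ < ‖g.1 1 1‖ := by
  have := norm_entry_sq g
  nlinarith [norm_nonneg (g.1 1 0), norm_nonneg (g.1 1 1)]

theorem den_ne_zero (g : SU11) {z : ℂ} (hz : ‖z‖ ≤ 1) : den g z ≠ 0 := by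
  intro h
  have h1 : g.1 1 1 = -(g.1 1 0 * z) := by rw [den] at h; linear_combination h
  have h2 := congrArg norm h1
  rw [norm_neg, norm_mul] at h2
  have h3 := norm_entry_lt g
  nlinarith [norm_nonneg (g.1 1 0)]

theorem norm_den_pos (g : SU11) {z : ℂ} (hz : ‖z‖ ≤ 1) : 0 < ‖den g z‖ :=
  norm_pos_iff.2 (den_ne_zero g hz)

@[simp] theorem den_one (z : ℂ) : den 1 z = 1 := by simp [den]

@[simp] theorem moebius_one (z : ℂ) : moebius 1 z = z := by simp [moebius]

theorem moebius_eq (g : SU11) (z : ℂ) : moebius g z = (g.1 0 0 * z + g.1 0 1) / den g z := rfl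

theorem den_mul (g k : SU11) {z : ℂ} (hz : ‖z‖ ≤ 1) :
    den (g * k) z = den g (moebius k z) * den k z := by
  have hk := den_ne_zero k hz
  have : moebius k z * den k z = k.1 0 0 * z + k.1 0 1 := by
    rw [moebius_eq, div_mul_cancel₀ _ hk]
  have e : den g (moebius k z) * den k z =
      g.1 1 0 * (moebius k z * den k z) + g.1 1 1 * den k z := by simp only [den]; ring
  rw [e, this]
  simp only [den, Subgroup.coe_mul, Matrix.SpecialLinearGroup.coe_mul, Matrix.mul_apply,
    Fin.sum_univ_two]
  ring

theorem one_sub_norm_moebius_sq (g : SU11) {z : ℂ} (hz : ‖z‖ ≤ 1) :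
    1 - ‖moebius g z‖ ^ 2 = (1 - ‖z‖ ^ 2) / ‖den g z‖ ^ 2 := by
  have h := norm_den_pos g hz
  rw [moebius_eq, norm_div, ← norm_den_sq_sub g z]
  field_simp

theorem norm_moebius_le_one (g : SU11) {z : ℂ} (hz : ‖z‖ ≤ 1) : ‖moebius g z‖ ≤ 1 := by
  have h := one_sub_norm_moebius_sq g hz
  have h2 : 0 ≤ (1 - ‖z‖ ^ 2) / ‖den g z‖ ^ 2 :=
    div_nonneg (by nlinarith [norm_nonneg z]) (by positivity)
  nlinarith [norm_nonneg (moebius g z)]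

theorem norm_moebius_eq_one (g : SU11) {z : ℂ} (hz : ‖z‖ = 1) : ‖moebius g z‖ = 1 := by
  have h := one_sub_norm_moebius_sq g hz.le
  rw [hz] at h
  have : ‖moebius g z‖ ^ 2 = 1 := by simp at h; linarith
  nlinarith [norm_nonneg (moebius g z)]

theorem det_eq (g : SU11) : g.1 0 0 * g.1 1 1 - g.1 0 1 * g.1 1 0 = 1 := by
  have hdet := g.1.det_coe
  rwa [Matrix.det_fin_two] at hdet

theorem moebius_sub (g : SU11) {z w : ℂ} (hz : ‖z‖ ≤ 1) (hw : ‖w‖ ≤ 1) :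
    moebius g z - moebius g w = (z - w) / (den g z * den g w) := by
  have h1 := den_ne_zero g hz
  have h2 := den_ne_zero g hw
  rw [moebius_eq, moebius_eq, div_sub_div _ _ h1 h2]
  congr 1
  simp only [den]
  linear_combination (z - w) * det_eq g

theorem norm_moebius_sub (g : SU11) {z w : ℂ} (hz : ‖z‖ ≤ 1) (hw : ‖w‖ ≤ 1) :
    ‖moebius g z - moebius g w‖ = ‖z - w‖ / (‖den g z‖ * ‖den g w‖) := by
  rw [moebius_sub g hz hw, norm_div, norm_mul]

theorem moebius_mul (g k : SU11) {z : ℂ} (hz : ‖z‖ ≤ 1) :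
    moebius (g * k) z = moebius g (moebius k z) := by
  have h1 := den_ne_zero k hz
  have h2 := den_ne_zero g (norm_moebius_le_one k hz)
  rw [moebius_eq (g * k), den_mul g k hz, moebius_eq g, div_eq_div_iff (mul_ne_zero h2 h1) h2]
  have : moebius k z * den k z = k.1 0 0 * z + k.1 0 1 := by
    rw [moebius_eq, div_mul_cancel₀ _ h1]
  have e : (g.1 0 0 * moebius k z + g.1 0 1) * (den g (moebius k z) * den k z) =
    (g.1 0 0 * (moebius k z * den k z) + g.1 0 1 * den k z) * den g (moebius k z) := by ring
  rw [e, this]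
  simp only [den, Subgroup.coe_mul, Matrix.SpecialLinearGroup.coe_mul, Matrix.mul_apply,
    Fin.sum_univ_two]
  ring

theorem moebius_inv_moebius (g : SU11) {z : ℂ} (hz : ‖z‖ ≤ 1) :
    moebius g⁻¹ (moebius g z) = z := by
  rw [← moebius_mul _ _ hz, inv_mul_cancel, moebius_one]

theorem moebius_moebius_inv (g : SU11) {z : ℂ} (hz : ‖z‖ ≤ 1) :
    moebius g (moebius g⁻¹ z) = z := by
  rw [← moebius_mul _ _ hz, mul_inv_cancel, moebius_one]

theorem den_inv_mul_den (g : SU11) {z : ℂ} (hz : ‖z‖ ≤ 1) :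
    den g⁻¹ (moebius g z) * den g z = 1 := by
  rw [← den_mul _ _ hz, inv_mul_cancel, den_one]

theorem continuous_den (g : SU11) : Continuous (den g) := by
  unfold den; fun_prop

theorem continuousAt_moebius (g : SU11) {z : ℂ} (hz : ‖z‖ ≤ 1) : ContinuousAt (moebius g) z := by
  have h := den_ne_zero g hz
  have : moebius g = fun z => (g.1 0 0 * z + g.1 0 1) / den g z := rfl
  rw [this]
  exact ContinuousAt.div (by fun_prop) (continuous_den g).continuousAt h

theorem trace_eq (g : SU11) : g.1 0 0 + g.1 1 1 = ((g.1.1.trace.re : ℝ) : ℂ) := by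
  rw [Matrix.trace_fin_two]
  change g.1 0 0 + g.1 1 1 = (((g.1 0 0 + g.1 1 1).re : ℝ) : ℂ)
  rw [g.2.1, Complex.add_conj]
  simp

theorem inv_entries (g : SU11) : g⁻¹.1 0 0 = g.1 1 1 ∧ g⁻¹.1 0 1 = -g.1 0 1 ∧
    g⁻¹.1 1 0 = -g.1 1 0 ∧ g⁻¹.1 1 1 = g.1 0 0 := by
  have e : (g⁻¹).1 = (g.1)⁻¹ := rfl
  rw [e, Matrix.SpecialLinearGroup.SL2_inv_expl]
  simp

/-- Cayley–Hamilton, g + g⁻¹ = tr(g)·1, read on the bottom row. It yields a linear recursion for the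
automorphy factors of the powers of g. -/
theorem den_mul_add_den_inv_mul (g k : SU11) (z : ℂ) :
    den (g * k) z + den (g⁻¹ * k) z = (g.1.1.trace.re : ℝ) * den k z := by
  rw [← trace_eq]
  obtain ⟨h1, h2, h3, h4⟩ := inv_entries g
  simp only [den, Subgroup.coe_mul, Matrix.SpecialLinearGroup.coe_mul, Matrix.mul_apply,
    Fin.sum_univ_two, h3, h4]
  ring

theorem trace_inv (g : SU11) : g⁻¹.1.1.trace = g.1.1.trace := by
  obtain ⟨h1, h2, h3, h4⟩ := inv_entries g
  rw [Matrix.trace_fin_two, Matrix.trace_fin_two]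
  change g⁻¹.1 0 0 + g⁻¹.1 1 1 = g.1 0 0 + g.1 1 1
  rw [h1, h4]; ring

/-- When |tr g| ≥ 2 this says that the norms of the automorphy factors along the powers of g form a
convex sequence. The ping-pong argument rests on it, for hyperbolic and parabolic elements alike. -/
theorem norm_den_zpow_add (g : SU11) (j : ℤ) (z : ℂ) :
    |g.1.1.trace.re| * ‖den (g ^ j) z‖ ≤ ‖den (g ^ (j + 1)) z‖ + ‖den (g ^ (j - 1)) z‖ := by
  have h := den_mul_add_den_inv_mul g (g ^ j) z
  rw [show g * g ^ j = g ^ (j + 1) by rw [add_comm, zpow_add, zpow_one],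
    show g⁻¹ * g ^ j = g ^ (j - 1) by rw [sub_eq_neg_add, zpow_add, zpow_neg_one]] at h
  have h2 := norm_add_le (den (g ^ (j + 1)) z) (den (g ^ (j - 1)) z)
  rw [h, norm_mul] at h2
  simpa using h2

theorem norm_den_inv_zero (g : SU11) : ‖den g⁻¹ 0‖ = ‖den g 0‖ := by
  obtain ⟨h1, h2, h3, h4⟩ := inv_entries g
  simp only [den, mul_zero, zero_add, h4]
  rw [g.2.1, norm_conj]

/-! ### The hyperbolic distance -/

/-- The square root of `1 - |z| ^ 2`. -/
noncomputable def wt (z : 𝔻) : ℝ := √(1 - ‖(z : ℂ)‖ ^ 2)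

theorem wt_pos (z : 𝔻) : 0 < wt z := Real.sqrt_pos.2 (by linarith [z.sq_norm_lt_one])

theorem wt_sq (z : 𝔻) : wt z ^ 2 = 1 - ‖(z : ℂ)‖ ^ 2 :=
  Real.sq_sqrt (by linarith [z.sq_norm_lt_one])

theorem wt_le_one (z : 𝔻) : wt z ≤ 1 := by
  have := wt_sq z
  nlinarith [wt_pos z, norm_nonneg (z : ℂ)]

@[simp] theorem wt_zero : wt 0 = 1 := by simp [wt]

theorem sinh_half_hypDist (z w : 𝔻) :
    Real.sinh (hypDist z w / 2) = ‖(z : ℂ) - w‖ / (wt z * wt w) := by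
  rw [hypDist, mul_div_cancel_left₀ _ two_ne_zero, Real.sinh_arsinh, Real.sqrt_mul, wt, wt]
  linarith [z.sq_norm_lt_one]

theorem sinh_half_mul (z w : 𝔻) :
    Real.sinh (hypDist z w / 2) * (wt z * wt w) = ‖(z : ℂ) - w‖ := by
  rw [sinh_half_hypDist, div_mul_cancel₀]
  exact (mul_pos (wt_pos z) (wt_pos w)).ne'

theorem hypDist_nonneg (z w : 𝔻) : 0 ≤ hypDist z w := by
  have : 0 ≤ Real.sinh (hypDist z w / 2) := by
    rw [sinh_half_hypDist]
    have := wt_pos z; have := wt_pos w; positivity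
  rw [Real.sinh_nonneg_iff] at this
  linarith

theorem hypDist_comm (z w : 𝔻) : hypDist z w = hypDist w z := by
  rw [hypDist, hypDist, norm_sub_rev, mul_comm (1 - ‖(z : ℂ)‖ ^ 2)]

@[simp] theorem hypDist_self (z : 𝔻) : hypDist z z = 0 := by simp [hypDist]

theorem hypDist_eq_of_sinh {z w : 𝔻} {t : ℝ} (h : Real.sinh (hypDist z w / 2) = Real.sinh (t / 2)) :
    hypDist z w = t := by
  have := Real.sinh_injective h; linarith

theorem wt_smul (g : SU11) (z : 𝔻) : wt (g • z) = wt z / ‖den g z‖ := by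
  have h := norm_den_pos g z.norm_lt_one.le
  have h1 := wt_pos z
  have h2 := wt_pos (g • z)
  have h3 : wt (g • z) ^ 2 = (wt z / ‖den g z‖) ^ 2 := by
    rw [wt_sq, div_pow, wt_sq, coe_smul, one_sub_norm_moebius_sq g z.norm_lt_one.le]
  exact (pow_left_inj₀ h2.le (by positivity) two_ne_zero).1 h3

theorem hypDist_smul (g : SU11) (z w : 𝔻) : hypDist (g • z) (g • w) = hypDist z w := by
  apply hypDist_eq_of_sinh
  rw [sinh_half_hypDist, sinh_half_hypDist, wt_smul, wt_smul, coe_smul, coe_smul,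
    norm_moebius_sub g z.norm_lt_one.le w.norm_lt_one.le]
  have h := norm_den_pos g z.norm_lt_one.le
  have h' := norm_den_pos g w.norm_lt_one.le
  have h1 := wt_pos z
  have h2 := wt_pos w
  field_simp

theorem cosh_half_hypDist_zero (z : 𝔻) : Real.cosh (hypDist 0 z / 2) = 1 / wt z := by
  have h := sinh_half_hypDist 0 z
  have h1 := wt_pos z
  have h2 := Real.cosh_sq (hypDist 0 z / 2)
  rw [h] at h2
  have h3 := wt_sq z
  have h4 : Real.cosh (hypDist 0 z / 2) ^ 2 = (1 / wt z) ^ 2 := by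
    rw [h2]; simp; field_simp; linarith
  exact (pow_left_inj₀ (Real.cosh_pos _).le (by positivity) two_ne_zero).1 h4

theorem exists_smul_eq_zero (z : 𝔻) : ∃ g : SU11, g • z = 0 := by
  have h1 := wt_pos z
  have h2 := wt_sq z
  let M : Matrix (Fin 2) (Fin 2) ℂ :=
    !![1 / (wt z : ℂ), -(z : ℂ) / wt z; -conj (z : ℂ) / wt z, 1 / (wt z : ℂ)]
  have hw : (wt z : ℂ) ≠ 0 := by exact_mod_cast h1.ne'
  have hM : M.det = 1 := by
    rw [Matrix.det_fin_two_of]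
    have e : (z : ℂ) * conj (z : ℂ) = 1 - (wt z : ℂ) ^ 2 := by
      rw [Complex.mul_conj, Complex.normSq_eq_norm_sq]
      have h3 : (wt z : ℂ) ^ 2 = 1 - (‖(z : ℂ)‖ : ℂ) ^ 2 := by exact_mod_cast h2
      push_cast
      linear_combination h3
    field_simp
    linear_combination -e
  refine ⟨⟨⟨M, hM⟩, ?_, ?_⟩, ?_⟩
  · change M 1 1 = conj (M 0 0)
    simp [M]
  · change M 1 0 = conj (M 0 1)
    simp [M]
  · apply UnitDisc.coe_injective
    rw [coe_smul, moebius]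
    change (M 0 0 * z + M 0 1) / _ = 0
    simp only [M, Matrix.of_apply, Matrix.cons_val_zero, Matrix.cons_val_one,
      Matrix.cons_val', Matrix.cons_val_fin_one]
    rw [show 1 / (wt z : ℂ) * z + -z / wt z = 0 by ring, zero_div]

/-- With the middle point at the centre, the addition formula for sinh turns the claim into |z - w|
≤ |z| + |w|. The general case follows by transitivity of the action. -/
theorem hypDist_triangle_zero (z w : 𝔻) : hypDist z w ≤ hypDist z 0 + hypDist 0 w := by
  have h : Real.sinh (hypDist z w / 2) ≤ Real.sinh ((hypDist z 0 + hypDist 0 w) / 2) := by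
    rw [add_div, Real.sinh_add, hypDist_comm z 0, cosh_half_hypDist_zero, cosh_half_hypDist_zero,
      sinh_half_hypDist, sinh_half_hypDist, sinh_half_hypDist]
    have h1 := wt_pos z
    have h2 := wt_pos w
    have := norm_sub_le (z : ℂ) w
    simp
    field_simp
    exact this
  rw [Real.sinh_le_sinh] at h
  linarith

theorem hypDist_triangle (x y z : 𝔻) : hypDist x z ≤ hypDist x y + hypDist y z := by
  obtain ⟨g, hg⟩ := exists_smul_eq_zero y
  have := hypDist_triangle_zero (g • x) (g • z)
  rwa [← hg, hypDist_smul, hypDist_smul, hypDist_smul] at this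

/-- The automorphy factor is exactly the change of the distance to the centre, on the scale of
cosh(d/2). Half-planes and word lengths are handled through this dictionary. -/
theorem cosh_half_hypDist_zero_smul (g : SU11) (z : 𝔻) :
    Real.cosh (hypDist 0 (g • z) / 2) = ‖den g z‖ * Real.cosh (hypDist 0 z / 2) := by
  rw [cosh_half_hypDist_zero, cosh_half_hypDist_zero, wt_smul]
  have h := norm_den_pos g z.norm_lt_one.le
  have h1 := wt_pos z
  field_simp

theorem cosh_half_orbit (g : SU11) : Real.cosh (hypDist 0 (g • (0 : 𝔻)) / 2) = ‖g.1 1 1‖ := by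
  rw [cosh_half_hypDist_zero_smul]; simp [den]

theorem sinh_half_orbit (g : SU11) : Real.sinh (hypDist 0 (g • (0 : 𝔻)) / 2) = ‖g.1 1 0‖ := by
  have h := Real.cosh_sq (hypDist 0 (g • (0 : 𝔻)) / 2)
  rw [cosh_half_orbit, norm_entry_sq] at h
  have h2 : Real.sinh (hypDist 0 (g • (0 : 𝔻)) / 2) ^ 2 = ‖g.1 1 0‖ ^ 2 := by linarith
  refine (pow_left_inj₀ ?_ (norm_nonneg _) two_ne_zero).1 h2
  rw [Real.sinh_nonneg_iff]
  linarith [hypDist_nonneg 0 (g • (0 : 𝔻))]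

theorem hypDist_zero_inv_smul (g : SU11) :
    hypDist 0 (g⁻¹ • (0 : 𝔻)) = hypDist 0 (g • (0 : 𝔻)) := by
  rw [← hypDist_smul g, smul_inv_smul, hypDist_comm]

theorem hypDist_smul_left (g : SU11) (z w : 𝔻) : hypDist (g • z) w = hypDist z (g⁻¹ • w) := by
  rw [← hypDist_smul g⁻¹, inv_smul_smul]

theorem continuous_hypDist : Continuous fun x : 𝔻 × 𝔻 => hypDist x.1 x.2 := by
  unfold hypDist
  have := UnitDisc.continuous_coe
  refine continuous_const.mul (Real.continuous_arsinh.comp (Continuous.div ?_ ?_ ?_))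
  · fun_prop
  · fun_prop
  · intro x
    refine (Real.sqrt_pos.2 (mul_pos ?_ ?_)).ne'
    · linarith [x.1.sq_norm_lt_one]
    · linarith [x.2.sq_norm_lt_one]

theorem continuous_smul (g : SU11) : Continuous fun z : 𝔻 => g • z := by
  rw [UnitDisc.isEmbedding_coe.continuous_iff]
  rw [continuous_iff_continuousAt]
  intro z
  exact (continuousAt_moebius g z.norm_lt_one.le).comp UnitDisc.continuous_coe.continuousAt

/-! ### Half-planes and ping-pong -/

/-- The bisector of the centre and g(0) is the isometric circle of g⁻¹: being closer to g(0) means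
that g⁻¹ does not increase the distance to the centre. -/
theorem mem_halfPlane_iff (g : SU11) (z : 𝔻) : (z : ℂ) ∈ halfPlane g ↔ ‖den g⁻¹ z‖ ≤ 1 := by
  have h1 : (z : ℂ) ∈ halfPlane g ↔ hypDist 0 (g⁻¹ • z) ≤ hypDist 0 z := by
    constructor
    · rintro ⟨w, hw, h⟩
      have := UnitDisc.coe_injective hw
      subst this
      rwa [hypDist_comm, hypDist_smul_left, hypDist_comm w] at h
    · intro h
      refine ⟨z, rfl, ?_⟩
      rwa [hypDist_comm, hypDist_smul_left, hypDist_comm z]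
  rw [h1]
  have h2 : hypDist 0 (g⁻¹ • z) ≤ hypDist 0 z ↔
      Real.cosh (hypDist 0 (g⁻¹ • z) / 2) ≤ Real.cosh (hypDist 0 z / 2) := by
    have e1 := hypDist_nonneg 0 (g⁻¹ • z)
    have e2 := hypDist_nonneg 0 z
    rw [Real.cosh_le_cosh, abs_of_nonneg (by linarith), abs_of_nonneg (by linarith)]
    constructor <;> intro h <;> linarith
  rw [h2, cosh_half_hypDist_zero_smul]
  have := Real.cosh_pos (hypDist 0 z / 2)
  constructor
  · intro h
    by_contra! h3
    nlinarith
  · intro h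
    nlinarith

theorem norm_lt_one_of_mem_halfPlane {g : SU11} {z : ℂ} (hz : z ∈ halfPlane g) : ‖z‖ < 1 := by
  obtain ⟨w, rfl, -⟩ := hz
  exact w.norm_lt_one

/-- The union of the half-planes of `g` and `g⁻¹`. -/
def region (g : SU11) : Set ℂ := halfPlane g ∪ halfPlane g⁻¹

theorem region_inv (g : SU11) : region g⁻¹ = region g := by
  rw [region, region, inv_inv, Set.union_comm]

theorem notMem_region_iff (g : SU11) (z : 𝔻) :
    (z : ℂ) ∉ region g ↔ 1 < ‖den g z‖ ∧ 1 < ‖den g⁻¹ z‖ := by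
  rw [region, Set.mem_union, mem_halfPlane_iff, mem_halfPlane_iff, inv_inv]
  push Not
  exact and_comm

/-- The increments of a convex sequence do not decrease, and the first one is at least κ. -/
theorem norm_den_pow_add_le {g : SU11} (htr : 2 ≤ |g.1.1.trace.re|) {z : ℂ} {κ : ℝ}
    (h : 1 + κ ≤ ‖den g z‖) (n : ℕ) : ‖den (g ^ n) z‖ + κ ≤ ‖den (g ^ (n + 1)) z‖ := by
  induction n with
  | zero => simpa using h
  | succ n ih =>
    have h1 := norm_den_zpow_add g ((n : ℤ) + 1) z
    have e1 : g ^ ((n : ℤ) + 1 + 1) = g ^ (n + 1 + 1) := by exact_mod_cast zpow_natCast g (n + 1 + 1)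
    have e2 : g ^ ((n : ℤ) + 1) = g ^ (n + 1) := by exact_mod_cast zpow_natCast g (n + 1)
    have e3 : g ^ ((n : ℤ) + 1 - 1) = g ^ n := by rw [add_sub_cancel_right, zpow_natCast]
    rw [e1, e2, e3] at h1
    nlinarith [norm_nonneg (den (g ^ (n + 1)) z)]

theorem le_norm_den_pow {g : SU11} (htr : 2 ≤ |g.1.1.trace.re|) {z : ℂ} {κ : ℝ}
    (h : 1 + κ ≤ ‖den g z‖) (n : ℕ) : 1 + n * κ ≤ ‖den (g ^ n) z‖ := by
  induction n with
  | zero => simp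
  | succ n ih =>
    have := norm_den_pow_add_le htr h n
    push_cast
    linarith

/-- By the cocycle relation, the factor of g⁻¹ at g^(n+1) z is the quotient of the factors of g^n
and g^(n+1) at z, and these do not decrease with n. -/
theorem pow_smul_mem_halfPlane {g : SU11} (htr : 2 ≤ |g.1.1.trace.re|) {z : 𝔻}
    (h : 1 ≤ ‖den g z‖) (n : ℕ) : ((g ^ (n + 1) • z : 𝔻) : ℂ) ∈ halfPlane g := by
  rw [mem_halfPlane_iff]
  have h1 := norm_den_pow_add_le (κ := 0) htr (by simpa using h) n
  have h2 := den_mul g⁻¹ (g ^ (n + 1)) z.norm_lt_one.le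
  have h3 := norm_den_pos (g ^ (n + 1)) z.norm_lt_one.le
  rw [pow_succ', inv_mul_cancel_left, ← pow_succ'] at h2
  rw [h2, norm_mul] at h1
  rw [coe_smul]
  nlinarith

theorem zpow_smul_mem_region {g : SU11} (htr : 2 ≤ |g.1.1.trace.re|) {z : 𝔻}
    (h : (z : ℂ) ∉ region g) {j : ℤ} (hj : j ≠ 0) : ((g ^ j • z : 𝔻) : ℂ) ∈ region g := by
  rw [notMem_region_iff] at h
  rcases lt_or_gt_of_ne hj with h1 | h1
  · obtain ⟨n, rfl⟩ : ∃ n : ℕ, j = -((n : ℤ) + 1) := ⟨(-j - 1).toNat, by omega⟩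
    right
    have := pow_smul_mem_halfPlane (g := g⁻¹) (by rwa [trace_inv]) h.2.le n
    rw [zpow_neg, ← inv_zpow]
    exact_mod_cast this
  · obtain ⟨n, rfl⟩ : ∃ n : ℕ, j = (n : ℤ) + 1 := ⟨(j - 1).toNat, by omega⟩
    left
    have := pow_smul_mem_halfPlane htr h.1.le n
    exact_mod_cast this

theorem closure_halfPlane_subset (g : SU11) :
    closure (halfPlane g) ⊆ {z | ‖z‖ ≤ 1 ∧ ‖den g⁻¹ z‖ ≤ 1} := by
  refine closure_minimal ?_ ?_
  · intro z hz
    have h2 := norm_lt_one_of_mem_halfPlane hz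
    refine ⟨h2.le, ?_⟩
    lift z to 𝔻 using h2
    exact (mem_halfPlane_iff g z).1 hz
  · exact (isClosed_le continuous_norm continuous_const).inter
      (isClosed_le (continuous_den g⁻¹).norm continuous_const)

/-! ### Hyperbolic and parabolic elements -/

theorem trace_re (g : SU11) : g.1.1.trace.re = 2 * (g.1 1 1).re := by
  rw [Matrix.trace_fin_two]
  change (g.1 0 0 + g.1 1 1).re = _
  rw [g.2.1]; simp; ring

theorem IsHyperbolic.entry_ne_zero {g : SU11} (hg : IsHyperbolic g) : g.1 1 0 ≠ 0 := by
  intro h0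
  have h := norm_entry_sq g
  rw [h0] at h
  have h1 : ‖g.1 1 1‖ = 1 := by
    simp at h
    rcases h with h | h
    · exact h
    · linarith [norm_nonneg (g.1 1 1)]
  rw [IsHyperbolic, trace_re, abs_mul] at hg
  have := Complex.abs_re_le_norm (g.1 1 1)
  rw [h1] at this
  norm_num at hg
  linarith

/-- Otherwise g would be a rotation about the centre, and a rotation of trace ±2 is ±1. -/
theorem IsParabolic.entry_ne_zero {g : SU11} (hg : IsParabolic g) : g.1 1 0 ≠ 0 := by
  intro h0
  obtain ⟨h1, h2, h3⟩ := hg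
  have h := norm_entry_sq g
  rw [h0, ← Complex.normSq_eq_norm_sq, Complex.normSq_apply] at h
  rw [trace_re, abs_mul] at h1
  norm_num at h1
  have h4 : (g.1 1 1).re ^ 2 = 1 := by rw [← sq_abs, h1]; norm_num
  have him : (g.1 1 1).im = 0 := by
    simp at h
    nlinarith
  have h01 : g.1 0 1 = 0 := by
    have := g.2.2
    rw [h0] at this
    simpa using this.symm
  rcases abs_eq (by norm_num : (0 : ℝ) ≤ 1) |>.1 h1 with h5 | h5
  · have h11 : g.1 1 1 = 1 := Complex.ext h5 him
    have h00 : g.1 0 0 = 1 := by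
      have := g.2.1
      rw [h11] at this
      have := congrArg conj this
      simpa using this.symm
    apply h2
    ext i j
    fin_cases i <;> fin_cases j <;> simp [h0, h01, h11, h00]
  · have h11 : g.1 1 1 = -1 := Complex.ext (by simpa using h5) (by simpa using him)
    have h00 : g.1 0 0 = -1 := by
      have := g.2.1
      rw [h11] at this
      have := congrArg conj this
      simpa using this.symm
    apply h3
    ext i j
    fin_cases i <;> fin_cases j <;> simp [h0, h01, h11, h00]

theorem one_lt_norm_entry {g : SU11} (h : g.1 1 0 ≠ 0) : 1 < ‖g.1 1 1‖ := by
  have h1 := norm_entry_sq g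
  have h2 := norm_pos_iff.2 h
  nlinarith [norm_nonneg (g.1 1 1)]

theorem inv_entry_ne_zero {g : SU11} (h : g.1 1 0 ≠ 0) : g⁻¹.1 1 0 ≠ 0 := by
  rw [(inv_entries g).2.2.1]; simpa using h

/-- The affine function `den g⁻¹` has norm greater than 1 at the centre and at most 1 on the
half-plane. -/
theorem exists_le_norm_of_mem_halfPlane {g : SU11} (h : g.1 1 0 ≠ 0) :
    ∃ δ > 0, ∀ z ∈ halfPlane g, δ ≤ ‖z‖ := by
  have h' := inv_entry_ne_zero h
  have h1 := one_lt_norm_entry h'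
  have h2 := norm_pos_iff.2 h'
  refine ⟨(‖g⁻¹.1 1 1‖ - 1) / ‖g⁻¹.1 1 0‖, by apply div_pos <;> linarith, fun z hz => ?_⟩
  have h3 := (closure_halfPlane_subset g (subset_closure hz)).2
  rw [div_le_iff₀ h2]
  have h4 : ‖g⁻¹.1 1 1‖ ≤ ‖den g⁻¹ z‖ + ‖g⁻¹.1 1 0 * z‖ := by
    have : g⁻¹.1 1 1 = den g⁻¹ z - g⁻¹.1 1 0 * z := by rw [den]; ring
    calc ‖g⁻¹.1 1 1‖ = ‖den g⁻¹ z - g⁻¹.1 1 0 * z‖ := by rw [← this]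
      _ ≤ _ := norm_sub_le _ _
  rw [norm_mul] at h4
  linarith

/-- The trace equals den g⁻¹ z + den g w + c (z - w), with c the lower left entry of g. The first
two terms have norm at most 1, so |tr g| > 2 keeps z and w apart. For a parabolic element the two
half-planes would be tangent at infinity. -/
theorem IsHyperbolic.exists_separation {g : SU11} (hg : IsHyperbolic g) :
    ∃ δ > 0, ∀ z ∈ halfPlane g, ∀ w ∈ halfPlane g⁻¹, δ ≤ ‖z - w‖ := by
  have h := hg.entry_ne_zero
  have h2 := norm_pos_iff.2 h
  rw [IsHyperbolic] at hg
  refine ⟨(|g.1.1.trace.re| - 2) / ‖g.1 1 0‖, by apply div_pos <;> linarith, fun z hz w hw => ?_⟩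
  have h3 := (closure_halfPlane_subset g (subset_closure hz)).2
  have h4 := (closure_halfPlane_subset g⁻¹ (subset_closure hw)).2
  rw [inv_inv] at h4
  rw [div_le_iff₀ h2]
  obtain ⟨-, -, e3, e4⟩ := inv_entries g
  have e : ((g.1.1.trace.re : ℝ) : ℂ) = den g⁻¹ z + den g w + g.1 1 0 * (z - w) := by
    rw [← trace_eq, den, den, e3, e4]; ring
  have h5 := congrArg norm e
  rw [Complex.norm_real, Real.norm_eq_abs] at h5
  have h6 := norm_add₃_le (a := den g⁻¹ z) (b := den g w) (c := g.1 1 0 * (z - w))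
  rw [← h5, norm_mul] at h6
  linarith

/-- `den g` is affine and has norm 1 - ε < 1 at g⁻¹(0). If its norm at z were below 1 + κ, a short
step from z towards g⁻¹(0) would already enter the half-plane of g⁻¹, against the distance δ. -/
theorem exists_growth {g : SU11} (h : g.1 1 0 ≠ 0) {δ : ℝ} (hδ : 0 < δ) :
    ∃ κ > 0, ∀ z : 𝔻, (∀ y ∈ halfPlane g⁻¹, δ ≤ ‖(z : ℂ) - y‖) → 1 + κ ≤ ‖den g z‖ := by
  have h1 := one_lt_norm_entry h
  set ε := 1 - 1 / ‖g.1 1 1‖ with hε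
  have hε0 : 0 < ε := by
    rw [hε, sub_pos, div_lt_one (by linarith)]; exact h1
  refine ⟨δ * ε / 4, by positivity, fun z hz => ?_⟩
  by_contra! hlt
  set κ := δ * ε / 4
  have hκ : 0 < κ := by positivity
  set w : 𝔻 := g⁻¹ • 0
  have hw : ‖den g w‖ = 1 - ε := by
    have := den_inv_mul_den g⁻¹ (z := 0) (by simp)
    rw [inv_inv] at this
    have h2 := congrArg norm this
    rw [norm_mul, norm_den_inv_zero, norm_one] at h2
    have h3 : ‖den g 0‖ = ‖g.1 1 1‖ := by simp [den]
    rw [h3] at h2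
    rw [coe_smul, UnitDisc.coe_zero, hε]
    field_simp
    linarith
  -- Chosen so that (1 - t)(1 + κ) + t(1 - ε) = 1. The step has length at most 2t ≤ 2κ/ε = δ/2,
  -- which explains the value of κ.
  set t := κ / (κ + ε)
  have ht0 : 0 < t := by positivity
  have ht1 : t < 1 := by rw [div_lt_one (by positivity)]; linarith
  have ht : t * (κ + ε) = κ := div_mul_cancel₀ _ (by positivity)
  set y : ℂ := (1 - t : ℝ) * z + (t : ℝ) * w with hy
  have hy1 : ‖y‖ < 1 := by
    have e1 := z.norm_lt_one
    have e2 := w.norm_lt_one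
    have := norm_add_le ((1 - t : ℝ) * (z : ℂ)) ((t : ℝ) * (w : ℂ))
    rw [norm_mul, norm_mul, Complex.norm_real, Complex.norm_real, Real.norm_eq_abs,
      Real.norm_eq_abs, abs_of_pos ht0, abs_of_pos (by linarith : 0 < 1 - t), ← hy] at this
    nlinarith
  have hden : ‖den g y‖ ≤ 1 := by
    have e : den g y = (1 - t : ℝ) * den g z + (t : ℝ) * den g w := by
      rw [hy, den, den, den]; push_cast; ring
    have := norm_add_le ((1 - t : ℝ) * den g z) ((t : ℝ) * den g w)
    rw [norm_mul, norm_mul, Complex.norm_real, Complex.norm_real, Real.norm_eq_abs,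
      Real.norm_eq_abs, abs_of_pos ht0, abs_of_pos (by linarith : 0 < 1 - t), ← e, hw] at this
    nlinarith
  have hmem : y ∈ halfPlane g⁻¹ := by
    have := (mem_halfPlane_iff g⁻¹ (UnitDisc.mk y hy1)).2 (by simpa using hden)
    simpa using this
  have h3 := hz y hmem
  have h4 : (z : ℂ) - y = (t : ℝ) * (z - w) := by rw [hy]; push_cast; ring
  rw [h4, norm_mul, Complex.norm_real, Real.norm_eq_abs, abs_of_pos ht0] at h3
  have h5 : ‖(z : ℂ) - w‖ ≤ 2 := by
    have := norm_sub_le (z : ℂ) w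
    linarith [z.norm_lt_one, w.norm_lt_one]
  have h6 : δ ≤ t * 2 := h3.trans (by nlinarith)
  have h7 : t * ε ≤ κ := by nlinarith
  have : δ * ε ≤ 2 * κ := by nlinarith
  have h8 : 0 < δ * ε := by positivity
  have : 2 * κ = δ * ε / 2 := by simp only [κ]; ring
  linarith

/-- Quantitative ping-pong constants of a Schottky pair. -/
structure PingPong (h p : SU11) (δ κ : ℝ) : Prop where
  pos : 0 < δ
  growth_pos : 0 < κ
  separated : ∀ z ∈ region h, ∀ w ∈ region p, δ ≤ ‖z - w‖
  le_norm_left : ∀ z ∈ region h, δ ≤ ‖z‖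
  le_norm_right : ∀ z ∈ region p, δ ≤ ‖z‖
  separated_self : ∀ z ∈ halfPlane h, ∀ w ∈ halfPlane h⁻¹, δ ≤ ‖z - w‖
  trace_left : 2 ≤ |h.1.1.trace.re|
  parabolic : IsParabolic p
  -- A definite gain is recorded for h only: one gain per pair of syllables is enough, and for p
  -- monotonicity will do.
  growth : ∀ z : 𝔻, (z : ℂ) ∈ region p ∪ {0} → 1 + κ ≤ ‖den h z‖ ∧ 1 + κ ≤ ‖den h⁻¹ z‖

/-- This symmetry reduces negative powers of h to positive ones. -/
theorem PingPong.inv {h p : SU11} {δ κ : ℝ} (P : PingPong h p δ κ) : PingPong h⁻¹ p δ κ where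
  pos := P.pos
  growth_pos := P.growth_pos
  separated := by rw [region_inv]; exact P.separated
  le_norm_left := by rw [region_inv]; exact P.le_norm_left
  le_norm_right := P.le_norm_right
  separated_self z hz w hw := by
    rw [inv_inv] at hw
    rw [norm_sub_rev]
    exact P.separated_self w hw z hz
  trace_left := by rw [trace_inv]; exact P.trace_left
  parabolic := P.parabolic
  growth z hz := by rw [inv_inv]; exact (P.growth z hz).symm

theorem exists_separation_of_disjoint_closure {s t : Set ℂ} (hs : Bornology.IsBounded s)
    (h : Disjoint (closure s) (closure t)) : ∃ δ > 0, ∀ z ∈ s, ∀ w ∈ t, δ ≤ ‖z - w‖ := by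
  obtain ⟨r, hr, H⟩ := Metric.exists_pos_forall_lt_edist hs.isCompact_closure isClosed_closure h
  refine ⟨r, by exact_mod_cast hr, fun z hz w hw => ?_⟩
  have := H z (subset_closure hz) w (subset_closure hw)
  rw [edist_dist, ← ENNReal.ofReal_coe_nnreal] at this
  have := (ENNReal.ofReal_lt_ofReal_iff_of_nonneg r.2).1 this
  rw [← dist_eq_norm]
  exact this.le

theorem IsSchottkyPair.exists_pingPong {h p : SU11} (hS : IsSchottkyPair h p) :
    ∃ δ κ : ℝ, PingPong h p δ κ := by
  have hh := hS.hyperbolic.entry_ne_zero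
  have hp := hS.parabolic.entry_ne_zero
  have hb : Bornology.IsBounded (region h) := by
    refine (Metric.isBounded_closedBall (x := (0 : ℂ)) (r := 1)).subset ?_
    rintro z (hz | hz) <;> simpa using (norm_lt_one_of_mem_halfPlane hz).le
  obtain ⟨δ₁, h1, H1⟩ := exists_separation_of_disjoint_closure (s := region h) (t := region p) hb
    hS.disjoint
  obtain ⟨δ₂, h2, H2⟩ := exists_le_norm_of_mem_halfPlane hh
  obtain ⟨δ₃, h3, H3⟩ := exists_le_norm_of_mem_halfPlane (inv_entry_ne_zero hh)
  obtain ⟨δ₄, h4, H4⟩ := exists_le_norm_of_mem_halfPlane hp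
  obtain ⟨δ₅, h5, H5⟩ := exists_le_norm_of_mem_halfPlane (inv_entry_ne_zero hp)
  obtain ⟨δ₆, h6, H6⟩ := hS.hyperbolic.exists_separation
  obtain ⟨δ, hδ, hle⟩ : ∃ δ > 0, δ ≤ δ₁ ∧ δ ≤ δ₂ ∧ δ ≤ δ₃ ∧ δ ≤ δ₄ ∧ δ ≤ δ₅ ∧ δ ≤ δ₆ := by
    refine ⟨min δ₁ (min δ₂ (min δ₃ (min δ₄ (min δ₅ δ₆)))), by simp [*], ?_⟩
    simp
  obtain ⟨l1, l2, l3, l4, l5, l6⟩ := hle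
  obtain ⟨κ₁, hκ₁, K1⟩ := exists_growth hh hδ
  obtain ⟨κ₂, hκ₂, K2⟩ := exists_growth (inv_entry_ne_zero hh) hδ
  rw [inv_inv] at K2
  have hX : ∀ z ∈ region h, δ ≤ ‖z‖ := by
    rintro z (hz | hz)
    · exact l2.trans (H2 z hz)
    · exact l3.trans (H3 z hz)
  have hsep : ∀ z : 𝔻, (z : ℂ) ∈ region p ∪ {0} → ∀ y ∈ region h, δ ≤ ‖(z : ℂ) - y‖ := by
    rintro z (hz | hz) y hy
    · rw [norm_sub_rev]
      exact l1.trans (H1 y hy z hz)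
    · rw [Set.mem_singleton_iff] at hz
      rw [hz, zero_sub, norm_neg]
      exact hX y hy
  refine ⟨δ, min κ₁ κ₂, hδ, by simp [*], fun z hz w hw => l1.trans (H1 z hz w hw), hX, ?_,
    fun z hz w hw => l6.trans (H6 z hz w hw), hS.hyperbolic.le, hS.parabolic, fun z hz => ⟨?_, ?_⟩⟩
  · rintro z (hz | hz)
    · exact l4.trans (H4 z hz)
    · exact l5.trans (H5 z hz)
  · refine le_trans (by simp) (K1 z fun y hy => hsep z hz y (Or.inr hy))
  · refine le_trans (by simp) (K2 z fun y hy => hsep z hz y (Or.inl hy))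

/-! ### Parabolic elements -/

/-- Up to sign k is unipotent, so the entries of its powers are affine in n. The linear growth here
is the origin of the term 2 ln|r|. -/
theorem norm_pow_entry_of_abs_trace_eq_two {k : SU11} (hk : |k.1.1.trace.re| = 2) (n : ℕ) :
    ‖(k ^ n).1 1 0‖ = n * ‖k.1 1 0‖ := by
  obtain ⟨ε, hε, htr⟩ : ∃ ε : ℂ, ε * ε = 1 ∧ ((k.1.1.trace.re : ℝ) : ℂ) = 2 * ε := by
    rcases (abs_eq (by norm_num : (0 : ℝ) ≤ 2)).1 hk with h | h
    · exact ⟨1, by norm_num, by rw [h]; norm_num⟩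
    · exact ⟨-1, by norm_num, by rw [h]; norm_num⟩
  have hεn : ‖ε‖ = 1 := by
    have := congrArg norm hε
    rw [norm_mul, norm_one] at this
    nlinarith [norm_nonneg ε]
  have hrec : ∀ m : ℕ, (k ^ (m + 2)).1 1 0 + (k ^ m).1 1 0 = 2 * ε * (k ^ (m + 1)).1 1 0 := by
    intro m
    have e1 : ∀ z : ℂ, den (k ^ (m + 2)) z + den (k ^ m) z = 2 * ε * den (k ^ (m + 1)) z := by
      intro z
      have h := den_mul_add_den_inv_mul k (k ^ (m + 1)) z
      rwa [htr, ← pow_succ', pow_succ' k m, inv_mul_cancel_left, ← pow_succ'] at h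
    have h1 := e1 1
    have h0 := e1 0
    simp only [den] at h1 h0
    linear_combination h1 - h0
  -- Multiplying by ε avoids the exponent m - 1. Two consecutive terms are carried because the
  -- recursion has order two.
  have key : ∀ m : ℕ, (k ^ m).1 1 0 * ε = m * ε ^ m * k.1 1 0 ∧
      (k ^ (m + 1)).1 1 0 * ε = (m + 1) * ε ^ (m + 1) * k.1 1 0 := by
    intro m
    induction m with
    | zero => simp; ring
    | succ m ih =>
      obtain ⟨i1, i2⟩ := ih
      refine ⟨by push_cast; exact i2, ?_⟩
      have := hrec m
      have e : (k ^ (m + 1 + 1)).1 1 0 * ε = 2 * ε * ((k ^ (m + 1)).1 1 0 * ε) -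
        (k ^ m).1 1 0 * ε := by linear_combination ε * this
      refine e.trans ?_
      rw [i1, i2, Nat.cast_succ]
      linear_combination ((m : ℂ) * ε ^ m * k.1 1 0) * hε
  have := congrArg norm (key n).1
  simpa [hεn] using this

theorem IsParabolic.norm_zpow_entry {k : SU11} (hk : IsParabolic k) (n : ℤ) :
    ‖(k ^ n).1 1 0‖ = |(n : ℝ)| * ‖k.1 1 0‖ := by
  obtain ⟨m, rfl | rfl⟩ := n.eq_nat_or_neg
  · rw [zpow_natCast, norm_pow_entry_of_abs_trace_eq_two hk.1]; simp
  · rw [zpow_neg, (inv_entries _).2.2.1, norm_neg, zpow_natCast,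
      norm_pow_entry_of_abs_trace_eq_two hk.1]; simp

/-- The fixed point equation c z² + (d - a) z - b = 0 has discriminant tr² - 4 = 0, so its left side
is c times the square of z - ζ with ζ = (a - d)/(2c). That |ζ| = 1 is the parallelogram law for d
and its conjugate a. -/
theorem IsParabolic.exists_fixedPoint {k : SU11} (hk : IsParabolic k) :
    ∃ ζ : ℂ, ‖ζ‖ = 1 ∧ ‖den k ζ‖ = 1 ∧ ∀ z : ℂ, ‖z‖ ≤ 1 →
      ‖moebius k z - z‖ * ‖den k z‖ = ‖k.1 1 0‖ * ‖z - ζ‖ ^ 2 := by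
  have hc := hk.entry_ne_zero
  have htr : (k.1 0 0 + k.1 1 1) ^ 2 = 4 := by
    rw [trace_eq]
    have : k.1.1.trace.re ^ 2 = 4 := by rw [← sq_abs, hk.1]; norm_num
    exact_mod_cast this
  have hdet := det_eq k
  set a := k.1 0 0
  set b := k.1 0 1
  set c := k.1 1 0
  set d := k.1 1 1
  have hfix : ∀ z, ‖z‖ ≤ 1 → (moebius k z - z) * den k z = -(c * (z - (a - d) / (2 * c)) ^ 2) := by
    intro z hz
    have h1 := den_ne_zero k hz
    rw [sub_mul, moebius_eq, div_mul_cancel₀ _ h1]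
    change a * z + b - z * (c * z + d) = _
    field_simp
    linear_combination htr - 4 * hdet
  have hdsq : ‖a + d‖ = 2 := by
    have := congrArg norm htr
    rw [norm_pow] at this
    norm_num at this
    nlinarith [norm_nonneg (a + d)]
  refine ⟨(a - d) / (2 * c), ?_, ?_, fun z hz => ?_⟩
  · rw [norm_div, norm_mul]
    have e : k.1 0 0 = conj (k.1 1 1) := by rw [k.2.1]; simp
    have h1 : ‖a - d‖ ^ 2 = 4 * ‖c‖ ^ 2 := by
      have h2 := norm_entry_sq k
      change ‖d‖ ^ 2 = 1 + ‖c‖ ^ 2 at h2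
      have h3 : ‖a - d‖ ^ 2 + ‖a + d‖ ^ 2 = 4 * ‖d‖ ^ 2 := by
        change a = conj d at e
        rw [e, ← Complex.normSq_eq_norm_sq, ← Complex.normSq_eq_norm_sq,
          ← Complex.normSq_eq_norm_sq]
        simp only [Complex.normSq_apply, Complex.add_re, Complex.add_im, Complex.sub_re,
          Complex.sub_im, Complex.conj_re, Complex.conj_im]
        ring
      rw [hdsq] at h3
      linarith
    have h2 : ‖a - d‖ = 2 * ‖c‖ := by
      refine (pow_left_inj₀ (norm_nonneg _) (by positivity) two_ne_zero).1 ?_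
      rw [h1]; ring
    rw [h2]
    have := norm_pos_iff.2 hc
    rw [Complex.norm_ofNat]
    exact div_self (by positivity)
  · have : den k ((a - d) / (2 * c)) = (a + d) / 2 := by
      change c * ((a - d) / (2 * c)) + d = _
      field_simp; ring
    rw [this, norm_div, hdsq]; simp
  · rw [← norm_mul, hfix z hz, norm_neg, norm_mul, norm_pow]

/-! ### Geodesic rays from the centre -/

theorem exp_le_two_mul_cosh (t : ℝ) : Real.exp t ≤ 2 * Real.cosh t := by
  rw [Real.cosh_eq]; linarith [Real.exp_pos (-t)]

theorem cosh_le_exp_of_nonneg {t : ℝ} (ht : 0 ≤ t) : Real.cosh t ≤ Real.exp t := by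
  rw [Real.cosh_eq]
  have : Real.exp (-t) ≤ Real.exp t := Real.exp_le_exp.2 (by linarith)
  linarith

theorem two_mul_sinh_le_exp (t : ℝ) : 2 * Real.sinh t ≤ Real.exp t := by
  rw [Real.sinh_eq]; linarith [Real.exp_pos (-t)]

theorem exp_le_two_mul_sinh_add_one {t : ℝ} (ht : 0 ≤ t) :
    Real.exp t ≤ 2 * Real.sinh t + 1 := by
  rw [Real.sinh_eq]
  have : Real.exp (-t) ≤ 1 := by rw [Real.exp_le_one_iff]; linarith
  linarith

theorem norm_tanh_mul_lt_one (ξ : Circle) (t : ℝ) : ‖(Real.tanh (t / 2) : ℂ) * ξ‖ < 1 := by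
  rw [norm_mul, Circle.norm_coe, mul_one, Complex.norm_real, Real.norm_eq_abs]
  exact Real.abs_tanh_lt_one _

/-- The geodesic ray from the centre of the disc to `ξ`. -/
noncomputable def stdRay (ξ : Circle) (t : ℝ) : 𝔻 :=
  UnitDisc.mk ((Real.tanh (t / 2) : ℂ) * ξ) (norm_tanh_mul_lt_one ξ t)

theorem coe_stdRay (ξ : Circle) (t : ℝ) : (stdRay ξ t : ℂ) = (Real.tanh (t / 2) : ℂ) * ξ := rfl

theorem one_sub_tanh_sq (t : ℝ) : 1 - Real.tanh t ^ 2 = (1 / Real.cosh t) ^ 2 := by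
  rw [Real.tanh_eq_sinh_div_cosh]
  have := Real.cosh_pos t
  field_simp
  rw [Real.cosh_sq]; ring

theorem wt_stdRay (ξ : Circle) (t : ℝ) : wt (stdRay ξ t) = 1 / Real.cosh (t / 2) := by
  have h1 := wt_pos (stdRay ξ t)
  have h2 := Real.cosh_pos (t / 2)
  refine (pow_left_inj₀ h1.le (by positivity) two_ne_zero).1 ?_
  rw [wt_sq, ← one_sub_tanh_sq, coe_stdRay, norm_mul, Circle.norm_coe, mul_one, Complex.norm_real,
    Real.norm_eq_abs, sq_abs]

theorem norm_stdRay_sub (ξ : Circle) (s t : ℝ) :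
    ‖(stdRay ξ s : ℂ) - stdRay ξ t‖ = |Real.tanh (s / 2) - Real.tanh (t / 2)| := by
  rw [coe_stdRay, coe_stdRay, ← sub_mul, norm_mul, Circle.norm_coe, mul_one,
    ← Complex.ofReal_sub, Complex.norm_real, Real.norm_eq_abs]

theorem hypDist_stdRay (ξ : Circle) (s t : ℝ) : hypDist (stdRay ξ s) (stdRay ξ t) = |s - t| := by
  apply hypDist_eq_of_sinh
  have h1 := Real.cosh_pos (s / 2)
  have h2 := Real.cosh_pos (t / 2)
  have e : Real.tanh (s / 2) - Real.tanh (t / 2) =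
      Real.sinh ((s - t) / 2) / (Real.cosh (s / 2) * Real.cosh (t / 2)) := by
    rw [sub_div, Real.sinh_sub, Real.tanh_eq_sinh_div_cosh, Real.tanh_eq_sinh_div_cosh]
    field_simp
  rw [sinh_half_hypDist, norm_stdRay_sub, wt_stdRay, wt_stdRay, e, abs_div,
    abs_of_pos (mul_pos h1 h2)]
  field_simp
  rw [Real.abs_sinh, abs_div, abs_of_pos (by norm_num : (0 : ℝ) < 2)]

theorem isGeodesicRay_stdRay (ξ : Circle) : IsGeodesicRay (stdRay ξ) :=
  fun s t _ _ => hypDist_stdRay ξ s t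

@[simp] theorem stdRay_zero (ξ : Circle) : stdRay ξ 0 = 0 := by
  apply UnitDisc.coe_injective
  rw [coe_stdRay]; simp

theorem norm_circle_sub_stdRay (ξ : Circle) (t : ℝ) :
    ‖(ξ : ℂ) - stdRay ξ t‖ = 1 - Real.tanh (t / 2) := by
  rw [coe_stdRay, show (ξ : ℂ) - (Real.tanh (t / 2) : ℂ) * ξ = ((1 - Real.tanh (t / 2) : ℝ) : ℂ) * ξ
    by push_cast; ring, norm_mul, Circle.norm_coe, mul_one, Complex.norm_real, Real.norm_eq_abs,
    abs_of_pos]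
  linarith [Real.tanh_lt_one (t / 2)]

theorem one_sub_tanh_le {t : ℝ} (ht : 0 ≤ t) : 1 - Real.tanh t ≤ (1 / Real.cosh t) ^ 2 := by
  rw [← one_sub_tanh_sq]
  have h1 := Real.tanh_lt_one t
  have h2 : 0 ≤ Real.tanh t := by
    rw [Real.tanh_eq_sinh_div_cosh]
    exact div_nonneg (Real.sinh_nonneg_iff.2 ht) (Real.cosh_pos t).le
  nlinarith

theorem one_div_cosh_le (t : ℝ) : 1 / Real.cosh t ≤ 2 * Real.exp (-t) := by
  rw [Real.exp_neg, div_le_iff₀ (Real.cosh_pos t)]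
  have := exp_le_two_mul_cosh t
  have h := Real.exp_pos t
  field_simp
  linarith

theorem endsAt_stdRay (ξ : Circle) : EndsAt (stdRay ξ) ξ := by
  rw [EndsAt, tendsto_iff_norm_sub_tendsto_zero]
  have h : Tendsto (fun t : ℝ => (2 * Real.exp (-(t / 2))) ^ 2) atTop (𝓝 0) := by
    have h1 : Tendsto (fun t : ℝ => Real.exp (-(t / 2))) atTop (𝓝 0) :=
      Real.tendsto_exp_neg_atTop_nhds_zero.comp (tendsto_id.atTop_div_const two_pos)
    simpa using (h1.const_mul 2).pow 2
  refine squeeze_zero' (Eventually.of_forall fun t => norm_nonneg _) ?_ h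
  filter_upwards [eventually_ge_atTop 0] with t ht
  rw [norm_sub_rev, norm_circle_sub_stdRay]
  refine (one_sub_tanh_le (by linarith)).trans ?_
  have := Real.cosh_pos (t / 2)
  gcongr
  exact one_div_cosh_le _

/-- An orbit point seen from which the centre and `ξ` are separated is close to the ray. -/
theorem sinh_half_hypDist_orbit_stdRay_le {γ : SU11} {ξ : Circle} {δ : ℝ} (hδ : 0 < δ)
    (h : δ ≤ ‖((γ⁻¹ • (0 : 𝔻) : 𝔻) : ℂ) - moebius γ⁻¹ ξ‖) :
    Real.sinh (hypDist (stdRay ξ (hypDist 0 (γ • (0 : 𝔻)))) (γ • (0 : 𝔻)) / 2) ≤ 1 / δ + 1 := by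
  set τ := hypDist 0 (γ • (0 : 𝔻))
  have hτ : 0 ≤ τ := hypDist_nonneg _ _
  have hξ : ‖(ξ : ℂ)‖ = 1 := Circle.norm_coe ξ
  set η := moebius γ⁻¹ ξ with hη
  have hη1 : ‖η‖ = 1 := norm_moebius_eq_one _ hξ
  have hηξ : moebius γ η = ξ := moebius_moebius_inv γ hξ.le
  set A := ‖den γ 0‖ with hA
  have hA0 : 0 < A := norm_den_pos γ (by simp)
  have hAc : Real.cosh (τ / 2) = A := by
    rw [cosh_half_orbit, hA, den]; simp
  have hw : wt (γ • (0 : 𝔻)) = 1 / A := by rw [wt_smul]; simp [hA]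
  have hB := norm_den_pos γ⁻¹ hξ.le
  have hB' : ‖den γ η‖ = 1 / ‖den γ⁻¹ ξ‖ := by
    have := congrArg norm (den_inv_mul_den γ⁻¹ hξ.le)
    rw [inv_inv, norm_mul, norm_one] at this
    field_simp
    exact this
  -- The separation hypothesis becomes δ · A · ‖den γ⁻¹ ξ‖ ≤ 1. Hence γ(0) is within 1/(δA²) of ξ,
  -- and the point of the ray at time τ is within 1/A² of ξ, while both points have weight 1/A.
  rw [coe_smul, UnitDisc.coe_zero, hη, norm_moebius_sub _ (by simp) hξ.le, zero_sub, norm_neg, hξ,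
    norm_den_inv_zero, ← hA, le_div_iff₀ (by positivity)] at h
  have h1 : ‖((γ • (0 : 𝔻) : 𝔻) : ℂ) - ξ‖ ≤ 1 / (δ * A ^ 2) := by
    rw [← hηξ, coe_smul, UnitDisc.coe_zero, norm_moebius_sub _ (by simp) hη1.le, zero_sub, norm_neg,
      hη1, ← hA, hB']
    have : 1 / (A * (1 / ‖den γ⁻¹ ξ‖)) = ‖den γ⁻¹ ξ‖ / A := by field_simp
    rw [this, div_le_div_iff₀ hA0 (by positivity)]
    nlinarith
  have h2 : ‖(stdRay ξ τ : ℂ) - (γ • (0 : 𝔻) : 𝔻)‖ ≤ 1 / (δ * A ^ 2) + (1 / A) ^ 2 := by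
    have e1 : ‖(ξ : ℂ) - stdRay ξ τ‖ ≤ (1 / A) ^ 2 := by
      rw [norm_circle_sub_stdRay, ← hAc]
      exact one_sub_tanh_le (by linarith)
    have := norm_sub_le_norm_sub_add_norm_sub (stdRay ξ τ : ℂ) ξ (γ • (0 : 𝔻) : 𝔻)
    rw [norm_sub_rev (stdRay ξ τ : ℂ) ξ, norm_sub_rev (ξ : ℂ) (γ • (0 : 𝔻) : 𝔻)] at this
    linarith
  rw [sinh_half_hypDist, wt_stdRay, hAc, hw, div_le_iff₀ (by positivity)]
  refine h2.trans (le_of_eq ?_)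
  field_simp

theorem hypDist_orbit_stdRay_le {γ : SU11} {ξ : Circle} {δ : ℝ} (hδ : 0 < δ)
    (h : δ ≤ ‖((γ⁻¹ • (0 : 𝔻) : 𝔻) : ℂ) - moebius γ⁻¹ ξ‖) :
    hypDist (stdRay ξ (hypDist 0 (γ • (0 : 𝔻)))) (γ • (0 : 𝔻)) ≤
      2 * Real.arsinh (1 / δ + 1) := by
  have := sinh_half_hypDist_orbit_stdRay_le hδ h
  rw [← Real.arsinh_le_arsinh, Real.arsinh_sinh] at this
  linarith

/-- Euclidean separation bounds the Gromov product at the centre, since sinh(d(z,w)/2) is |z - w|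
times the product of the two values cosh(d(0,·)/2). -/
theorem add_le_hypDist_of_le_norm_sub {z w : 𝔻} {δ : ℝ} (hδ : 0 < δ) (h : δ ≤ ‖(z : ℂ) - w‖) :
    hypDist 0 z + hypDist 0 w + 2 * Real.log (δ / 2) ≤ hypDist z w := by
  have h1 := exp_le_two_mul_cosh (hypDist 0 z / 2)
  have h2 := exp_le_two_mul_cosh (hypDist 0 w / 2)
  have h3 := two_mul_sinh_le_exp (hypDist z w / 2)
  rw [cosh_half_hypDist_zero] at h1 h2
  rw [sinh_half_hypDist] at h3
  have hz := wt_pos z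
  have hw := wt_pos w
  have h4 : δ / 2 * (Real.exp (hypDist 0 z / 2) * Real.exp (hypDist 0 w / 2)) ≤
      Real.exp (hypDist z w / 2) := by
    calc _ ≤ δ / 2 * ((2 * (1 / wt z)) * (2 * (1 / wt w))) := by gcongr
      _ = 2 * (δ / (wt z * wt w)) := by field_simp
      _ ≤ 2 * (‖(z : ℂ) - w‖ / (wt z * wt w)) := by gcongr
      _ ≤ _ := h3
  rw [← Real.exp_add] at h4
  have h5 := Real.log_le_log (by positivity) h4
  rw [Real.log_mul (by positivity) (by positivity), Real.log_exp, Real.log_exp] at h5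
  linarith

/-- Both points at time s are at Euclidean distance O(exp(-s)) from ξ, and both have weight
comparable to exp(-s/2). -/
theorem exists_hypDist_stdRay_le {σ : ℝ → 𝔻} {ξ : Circle} (hσ : IsGeodesicRay σ)
    (hξ : EndsAt σ ξ) : ∃ C, ∀ t, 0 ≤ t → hypDist (σ t) (stdRay ξ t) ≤ C := by
  set c := hypDist 0 (σ 0)
  have hc : 0 ≤ c := hypDist_nonneg _ _
  have hd : ∀ t, 0 ≤ t → |hypDist 0 (σ t) - t| ≤ c := by
    intro t ht
    have h1 := hypDist_triangle 0 (σ 0) (σ t)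
    have h2 := hypDist_triangle (σ 0) 0 (σ t)
    rw [hσ 0 t le_rfl ht, zero_sub, abs_neg, abs_of_nonneg ht] at h1 h2
    rw [hypDist_comm (σ 0)] at h2
    rw [abs_le]; constructor <;> linarith
  -- Obtained by letting t tend to infinity in the sinh formula for d(σ s, σ t) = t - s.
  have key : ∀ s, 0 ≤ s → ‖(σ s : ℂ) - ξ‖ ≤ Real.exp ((c - s) / 2) * wt (σ s) := by
    intro s hs
    have hlim : Tendsto (fun t => ‖(σ s : ℂ) - σ t‖) atTop (𝓝 ‖(σ s : ℂ) - ξ‖) :=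
      (tendsto_const_nhds.sub hξ).norm
    refine le_of_tendsto hlim ?_
    filter_upwards [eventually_ge_atTop s] with t hst
    have ht := hs.trans hst
    have h1 := sinh_half_mul (σ s) (σ t)
    rw [hσ s t hs ht, abs_sub_comm, abs_of_nonneg (by linarith)] at h1
    have h2 : wt (σ t) ≤ 2 * Real.exp (-((t - c) / 2)) := by
      have h3 := exp_le_two_mul_cosh (hypDist 0 (σ t) / 2)
      rw [cosh_half_hypDist_zero] at h3
      have h4 : Real.exp ((t - c) / 2) ≤ Real.exp (hypDist 0 (σ t) / 2) :=
        Real.exp_le_exp.2 (by linarith [(abs_le.1 (hd t ht)).1])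
      have h5 := wt_pos (σ t)
      have h6 := Real.exp_pos ((t - c) / 2)
      have h7 := h4.trans h3
      rw [Real.exp_neg]
      field_simp at h7 ⊢
      linarith
    have h3 : Real.sinh ((t - s) / 2) ≤ Real.exp ((t - s) / 2) / 2 := by
      linarith [two_mul_sinh_le_exp ((t - s) / 2)]
    have h4 := wt_pos (σ s)
    have h5 := wt_pos (σ t)
    rw [← h1]
    calc Real.sinh ((t - s) / 2) * (wt (σ s) * wt (σ t))
        ≤ (Real.exp ((t - s) / 2) / 2) * (wt (σ s) * (2 * Real.exp (-((t - c) / 2)))) := by gcongr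
      _ = (Real.exp ((t - s) / 2) * Real.exp (-((t - c) / 2))) * wt (σ s) := by ring
      _ = _ := by rw [← Real.exp_add]; ring_nf
  refine ⟨2 * Real.arsinh (3 * Real.exp (c / 2)), fun s hs => ?_⟩
  have h : Real.sinh (hypDist (σ s) (stdRay ξ s) / 2) ≤ 3 * Real.exp (c / 2) := by
    have hw := wt_pos (σ s)
    have hch := Real.cosh_pos (s / 2)
    rw [sinh_half_hypDist, wt_stdRay, div_le_iff₀ (by positivity)]
    have h1 := norm_sub_le_norm_sub_add_norm_sub (σ s : ℂ) ξ (stdRay ξ s)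
    have h2 : ‖(ξ : ℂ) - stdRay ξ s‖ ≤ (1 / Real.cosh (s / 2)) ^ 2 := by
      rw [norm_circle_sub_stdRay]
      exact one_sub_tanh_le (by linarith)
    have h3 : Real.exp ((c - s) / 2) ≤ Real.exp (c / 2) * (1 / Real.cosh (s / 2)) := by
      rw [sub_div, Real.exp_sub, ← mul_one_div]
      gcongr
      exact cosh_le_exp_of_nonneg (by linarith)
    have h4 : 1 / Real.cosh (s / 2) ≤ 2 * Real.exp (c / 2) * wt (σ s) := by
      have e1 := one_div_cosh_le (s / 2)
      have e2 : 1 / wt (σ s) ≤ Real.exp ((s + c) / 2) := by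
        rw [← cosh_half_hypDist_zero]
        refine (cosh_le_exp_of_nonneg (by linarith [hypDist_nonneg 0 (σ s)])).trans ?_
        exact Real.exp_le_exp.2 (by linarith [(abs_le.1 (hd s hs)).2])
      have e3 : Real.exp (-(s / 2)) ≤ Real.exp (c / 2) * wt (σ s) := by
        rw [div_le_iff₀ hw] at e2
        calc Real.exp (-(s / 2)) = Real.exp (-(s / 2)) * 1 := by ring
          _ ≤ Real.exp (-(s / 2)) * (Real.exp ((s + c) / 2) * wt (σ s)) := by gcongr
          _ = (Real.exp (-(s / 2)) * Real.exp ((s + c) / 2)) * wt (σ s) := by ring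
          _ = _ := by rw [← Real.exp_add]; ring_nf
      linarith
    have h5 := key s hs
    have h6 : 0 < 1 / Real.cosh (s / 2) := by positivity
    have h7 : Real.exp ((c - s) / 2) * wt (σ s) ≤
        Real.exp (c / 2) * (1 / Real.cosh (s / 2)) * wt (σ s) := by gcongr
    nlinarith
  rw [← Real.arsinh_le_arsinh, Real.arsinh_sinh] at h
  linarith

/-! ### Occupation times -/

theorem _root_.Continuous.hypDist {X : Type*} [TopologicalSpace X] {f g : X → 𝔻}
    (hf : Continuous f) (hg : Continuous g) : Continuous fun x => hypDist (f x) (g x) :=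
  continuous_hypDist.comp (hf.prodMk hg)

/-- The closed `R`-neighbourhood of the orbit of the centre. -/
def orbitNhd (Γ : Subgroup SU11) (R : ℝ) : Set 𝔻 := {z | ∃ γ ∈ Γ, hypDist z (γ • (0 : 𝔻)) ≤ R}

/-- The time spent, up to time `T`, in the `R`-neighbourhood of the orbit of the centre by the
ray from the centre to `ξ`. -/
noncomputable def occupation (Γ : Subgroup SU11) (ξ : Circle) (R T : ℝ) : ℝ :=
  ∫ t in (0 : ℝ)..T, (orbitNhd Γ R).indicator (fun _ => (1 : ℝ)) (stdRay ξ t)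

theorem continuous_stdRay (ξ : Circle) : Continuous (stdRay ξ) := by
  rw [UnitDisc.isEmbedding_coe.continuous_iff]
  have : (fun z : 𝔻 => (z : ℂ)) ∘ stdRay ξ =
      fun t => ((Real.sinh (t / 2) / Real.cosh (t / 2) : ℝ) : ℂ) * ξ := by
    ext t
    simp [coe_stdRay, Real.tanh_eq_sinh_div_cosh]
  rw [this]
  have : ∀ t : ℝ, Real.cosh (t / 2) ≠ 0 := fun t => (Real.cosh_pos _).ne'
  fun_prop (disch := exact this _)

theorem measurableSet_stdRay_preimage (Γ : Subgroup SU11) [Countable Γ] (ξ : Circle) (R : ℝ) :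
    MeasurableSet (stdRay ξ ⁻¹' orbitNhd Γ R) := by
  have : stdRay ξ ⁻¹' orbitNhd Γ R =
      ⋃ γ : Γ, {t | hypDist (stdRay ξ t) ((γ : SU11) • (0 : 𝔻)) ≤ R} := by
    ext t
    simp [orbitNhd]
  rw [this]
  refine MeasurableSet.iUnion fun γ => IsClosed.measurableSet ?_
  exact isClosed_le ((continuous_stdRay ξ).hypDist continuous_const) continuous_const

theorem intervalIntegrable_indicator_stdRay (Γ : Subgroup SU11) [Countable Γ] (ξ : Circle)
    (R a b : ℝ) : IntervalIntegrable
      (fun t => (orbitNhd Γ R).indicator (fun _ => (1 : ℝ)) (stdRay ξ t)) MeasureTheory.volume a b := by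
  have h : (fun t => (orbitNhd Γ R).indicator (fun _ => (1 : ℝ)) (stdRay ξ t)) =
      (stdRay ξ ⁻¹' orbitNhd Γ R).indicator (fun _ => (1 : ℝ)) := by
    ext t
    by_cases ht : stdRay ξ t ∈ orbitNhd Γ R
    · rw [Set.indicator_of_mem ht, Set.indicator_of_mem (Set.mem_preimage.2 ht)]
    · rw [Set.indicator_of_notMem ht, Set.indicator_of_notMem (fun h => ht (Set.mem_preimage.1 h))]
  rw [h, intervalIntegrable_iff]
  exact (intervalIntegrable_iff.1 (intervalIntegrable_const (c := (1 : ℝ)))).indicator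
    (measurableSet_stdRay_preimage Γ ξ R)

theorem exists_norm_le_of_hypDist_le (R : ℝ) :
    ∃ ρ < 1, ∀ z : 𝔻, hypDist 0 z ≤ R → ‖(z : ℂ)‖ ≤ ρ := by
  refine ⟨√(1 - (1 / Real.cosh (R / 2)) ^ 2), ?_, fun z hz => ?_⟩
  · rw [Real.sqrt_lt' one_pos]
    have := Real.cosh_pos (R / 2)
    have : 0 < (1 / Real.cosh (R / 2)) ^ 2 := by positivity
    linarith
  · apply Real.le_sqrt_of_sq_le
    have h0 := hypDist_nonneg 0 z
    have h : Real.cosh (hypDist 0 z / 2) ≤ Real.cosh (R / 2) := by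
      rw [Real.cosh_le_cosh, abs_of_nonneg (by linarith), abs_of_nonneg (by linarith)]
      linarith
    rw [cosh_half_hypDist_zero] at h
    have h1 := wt_pos z
    have h2 := Real.cosh_pos (R / 2)
    have h3 : 1 / Real.cosh (R / 2) ≤ wt z := by
      rw [div_le_iff₀ h1] at h
      rw [div_le_iff₀ h2]; linarith
    have h4 : (1 / Real.cosh (R / 2)) ^ 2 ≤ wt z ^ 2 := by gcongr
    rw [wt_sq] at h4
    linarith

theorem isCompact_hypDist_closedBall (R : ℝ) : IsCompact {z : 𝔻 | hypDist 0 z ≤ R} := by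
  obtain ⟨ρ, hρ, H⟩ := exists_norm_le_of_hypDist_le R
  have h1 : IsCompact {z : 𝔻 | ‖(z : ℂ)‖ ≤ ρ} := by
    rw [UnitDisc.isEmbedding_coe.isInducing.isCompact_iff]
    have : (fun z : 𝔻 => (z : ℂ)) '' {z : 𝔻 | ‖(z : ℂ)‖ ≤ ρ} = Metric.closedBall 0 ρ := by
      ext w
      simp only [Set.mem_image, Set.mem_ofPred_eq, mem_closedBall_zero_iff]
      constructor
      · rintro ⟨z, hz, rfl⟩; exact hz
      · intro hw
        exact ⟨UnitDisc.mk w (hw.trans_lt hρ), hw, rfl⟩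
    rw [this]
    exact isCompact_closedBall 0 ρ
  refine h1.of_isClosed_subset ?_ H
  exact isClosed_le (continuous_const.hypDist continuous_id) continuous_const

theorem continuous_proj (Γ : Subgroup SU11) : Continuous (proj Γ) := continuous_quotient_mk'

theorem proj_eq_proj_iff (Γ : Subgroup SU11) (z w : 𝔻) :
    proj Γ z = proj Γ w ↔ ∃ γ ∈ Γ, γ • w = z := by
  rw [proj, proj]
  refine Quotient.eq.trans ?_
  change z ∈ MulAction.orbit Γ w ↔ _
  rw [MulAction.mem_orbit_iff]
  constructor
  · rintro ⟨γ, h⟩; exact ⟨γ, γ.2, h⟩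
  · rintro ⟨γ, h1, h2⟩; exact ⟨⟨γ, h1⟩, h2⟩

theorem proj_mem_image_closedBall_iff (Γ : Subgroup SU11) (R : ℝ) (z : 𝔻) :
    proj Γ z ∈ proj Γ '' {z : 𝔻 | hypDist 0 z ≤ R} ↔ z ∈ orbitNhd Γ R := by
  constructor
  · rintro ⟨w, hw, h⟩
    obtain ⟨γ, hγ, rfl⟩ := (proj_eq_proj_iff Γ w z).1 h
    refine ⟨γ⁻¹, Γ.inv_mem hγ, ?_⟩
    rw [hypDist_comm, hypDist_smul_left, inv_inv]
    exact hw
  · rintro ⟨γ, hγ, h⟩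
    refine ⟨γ⁻¹ • z, ?_, (proj_eq_proj_iff Γ _ _).2 ⟨γ⁻¹, Γ.inv_mem hγ, rfl⟩⟩
    rw [hypDist_comm, hypDist_smul_left] at h
    exact h

/-- The open balls about the centre project to an increasing open cover of the surface. -/
theorem exists_orbitNhd_of_isCompact (Γ : Subgroup SU11) {W : Set (Surface Γ)} (hW : IsCompact W) :
    ∃ R, ∀ z, proj Γ z ∈ W → z ∈ orbitNhd Γ R := by
  let B : ℕ → Set (Surface Γ) := fun n => proj Γ '' {z : 𝔻 | hypDist 0 z < n}
  have hopen : ∀ n, IsOpen (B n) := by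
    intro n
    refine isOpen_coinduced.2 ?_
    have : proj Γ ⁻¹' B n = ⋃ γ : Γ, {z | hypDist 0 ((γ : SU11) • z) < n} := by
      ext z
      simp only [Set.mem_preimage, B, Set.mem_image, Set.mem_ofPred_eq, Set.mem_iUnion]
      constructor
      · rintro ⟨w, hw, h⟩
        obtain ⟨γ, hγ, rfl⟩ := (proj_eq_proj_iff Γ w z).1 h
        exact ⟨⟨γ, hγ⟩, hw⟩
      · rintro ⟨γ, h⟩
        exact ⟨_, h, (proj_eq_proj_iff Γ _ _).2 ⟨γ, γ.2, rfl⟩⟩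
    change IsOpen (proj Γ ⁻¹' B n)
    rw [this]
    exact isOpen_iUnion fun γ =>
      isOpen_lt (continuous_const.hypDist (continuous_smul γ)) continuous_const
  obtain ⟨n, hn⟩ := hW.elim_directed_cover B hopen (by
      intro x _
      obtain ⟨z, rfl⟩ := Quotient.exists_rep x
      obtain ⟨n, hn⟩ := exists_nat_gt (hypDist 0 z)
      exact Set.mem_iUnion.2 ⟨n, z, hn, rfl⟩)
    (directed_of_isDirected_le fun m n hmn => Set.image_mono fun z hz =>
      show hypDist 0 z < n from
        lt_of_lt_of_le (show hypDist 0 z < m from hz) (Nat.cast_le.2 hmn))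
  refine ⟨n, fun z hz => (proj_mem_image_closedBall_iff Γ n z).1 ?_⟩
  obtain ⟨w, hw, e⟩ := hn hz
  exact ⟨w, le_of_lt (show hypDist 0 w < n from hw), e⟩

/-- Rays with the same endpoint stay at bounded distance at equal times, so changing the ray only
enlarges R. Projected closed balls are compact and exhaust the compact sets. -/
theorem divergesOnAverage_iff (Γ : Subgroup SU11) [Countable Γ] (ξ : Circle) :
    DivergesOnAverage Γ ξ ↔ IsLimitPoint Γ ξ ∧
      ∀ R, Tendsto (fun T => 1 / T * occupation Γ ξ R T) atTop (𝓝 0) := by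
  refine and_congr_right fun _ => ⟨fun h R => ?_, fun h σ hσ hξ W hW => ?_⟩
  · have := h (stdRay ξ) (isGeodesicRay_stdRay ξ) (endsAt_stdRay ξ) _
      ((isCompact_hypDist_closedBall R).image (continuous_proj Γ))
    refine this.congr fun T => ?_
    rw [occupation]
    congr 2
    ext t
    by_cases ht : stdRay ξ t ∈ orbitNhd Γ R
    · rw [Set.indicator_of_mem ht,
        Set.indicator_of_mem ((proj_mem_image_closedBall_iff Γ R _).2 ht)]
    · rw [Set.indicator_of_notMem ht,
        Set.indicator_of_notMem (fun h => ht ((proj_mem_image_closedBall_iff Γ R _).1 h))]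
  · obtain ⟨R, hR⟩ := exists_orbitNhd_of_isCompact Γ hW
    obtain ⟨C, hC⟩ := exists_hypDist_stdRay_le hσ hξ
    refine squeeze_zero_norm' ?_ (h (R + C))
    filter_upwards [eventually_gt_atTop 0] with T hT
    rw [norm_mul, Real.norm_of_nonneg (by positivity : 0 ≤ 1 / T)]
    refine mul_le_mul_of_nonneg_left ?_ (by positivity)
    -- Only the dominating function has to be integrable. If the indicator of W along σ is not, its
    -- integral is 0 by convention and the bound still holds.
    refine intervalIntegral.norm_integral_le_of_norm_le hT.le (Eventually.of_forall fun t ht => ?_)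
      (intervalIntegrable_indicator_stdRay Γ ξ (R + C) 0 T)
    by_cases hW' : proj Γ (σ t) ∈ W
    · obtain ⟨γ, hγ, hd⟩ := hR _ hW'
      have : stdRay ξ t ∈ orbitNhd Γ (R + C) := by
        refine ⟨γ, hγ, ?_⟩
        have h1 := hypDist_triangle (stdRay ξ t) (σ t) (γ • 0)
        have h2 := hC t ht.1.le
        rw [hypDist_comm] at h2
        linarith
      rw [Set.indicator_of_mem hW', Set.indicator_of_mem this]
      simp
    · rw [Set.indicator_of_notMem hW', norm_zero]
      exact Set.indicator_nonneg (fun _ _ => zero_le_one) _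

/-! ### Normal forms and ping-pong on the orbit of the centre -/

/-- Words alternating nonzero powers of `g` and `k`, beginning with a power of `g`. -/
inductive AltWord : SU11 → SU11 → SU11 → Prop
  | single (g k : SU11) (j : ℤ) : j ≠ 0 → AltWord g k (g ^ j)
  | cons (g k : SU11) (j : ℤ) (γ : SU11) : j ≠ 0 → AltWord k g γ → AltWord g k (g ^ j * γ)

theorem AltWord.zpow_mul {g k γ : SU11} (h : γ = 1 ∨ AltWord g k γ ∨ AltWord k g γ) (j : ℤ) :
    g ^ j * γ = 1 ∨ AltWord g k (g ^ j * γ) ∨ AltWord k g (g ^ j * γ) := by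
  by_cases hj : j = 0
  · simpa [hj] using h
  rcases h with rfl | h | h
  · rw [mul_one]; exact Or.inr (Or.inl (.single g k j hj))
  · cases h with
    | single _ _ i hi =>
      rw [← zpow_add]
      by_cases hij : j + i = 0
      · left; rw [hij, zpow_zero]
      · exact Or.inr (Or.inl (.single g k _ hij))
    | cons _ _ i γ' hi h' =>
      rw [← mul_assoc, ← zpow_add]
      by_cases hij : j + i = 0
      · rw [hij, zpow_zero, one_mul]; exact Or.inr (Or.inr h')
      · exact Or.inr (Or.inl (.cons g k _ _ hij h'))
  · exact Or.inr (Or.inl (.cons g k j γ hj h))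

theorem eq_one_or_altWord_of_mem_closure {g k γ : SU11} (h : γ ∈ Subgroup.closure {g, k}) :
    γ = 1 ∨ AltWord g k γ ∨ AltWord k g γ := by
  have hstep : ∀ x ∈ ({g, k} : Set SU11), ∀ (j : ℤ) (y : SU11),
      (y = 1 ∨ AltWord g k y ∨ AltWord k g y) →
      x ^ j * y = 1 ∨ AltWord g k (x ^ j * y) ∨ AltWord k g (x ^ j * y) := by
    rintro x hx j y hy
    simp only [Set.mem_insert_iff, Set.mem_singleton_iff] at hx
    rcases hx with rfl | rfl
    · exact AltWord.zpow_mul hy j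
    · have := AltWord.zpow_mul (g := x) (k := g) (hy.imp_right Or.symm) j
      exact this.imp_right Or.symm
  induction h using Subgroup.closure_induction_left with
  | one => exact Or.inl rfl
  | mul_left x hx y _ hy => simpa using hstep x hx 1 y hy
  | inv_mul_cancel x hx y _ hy => simpa using hstep x hx (-1) y hy

/-- Two elements in ping-pong position. -/
structure Transverse (g k : SU11) : Prop where
  trace_left : 2 ≤ |g.1.1.trace.re|
  trace_right : 2 ≤ |k.1.1.trace.re|
  disjoint : Disjoint (region g) (region k)
  zero_left : (0 : ℂ) ∉ region g
  zero_right : (0 : ℂ) ∉ region k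

theorem Transverse.symm {g k : SU11} (h : Transverse g k) : Transverse k g :=
  ⟨h.trace_right, h.trace_left, h.disjoint.symm, h.zero_right, h.zero_left⟩

theorem AltWord.smul_mem_region {g k γ : SU11} (h : AltWord g k γ) (ht : Transverse g k) :
    ((γ • (0 : 𝔻) : 𝔻) : ℂ) ∈ region g := by
  induction h with
  | single g k j hj => exact zpow_smul_mem_region ht.trace_left (by simpa using ht.zero_left) hj
  | cons g k j γ hj _ ih =>
    rw [mul_smul]
    exact zpow_smul_mem_region ht.trace_left
      (fun h => Set.disjoint_left.1 ht.disjoint h (ih ht.symm)) hj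

theorem PingPong.transverse {h p : SU11} {δ κ : ℝ} (P : PingPong h p δ κ) : Transverse h p where
  trace_left := P.trace_left
  trace_right := P.parabolic.1.ge
  disjoint := Set.disjoint_left.2 fun z hz hw => by
    have := P.separated z hz z hw
    rw [sub_self, norm_zero] at this
    linarith [P.pos]
  zero_left hz := by
    have := P.le_norm_left 0 hz
    rw [norm_zero] at this
    linarith [P.pos]
  zero_right hz := by
    have := P.le_norm_right 0 hz
    rw [norm_zero] at this
    linarith [P.pos]

/-- The orbit of the centre under the words beginning with a power of `g`. -/
def wordOrbit (g k : SU11) : Set ℂ := {z | ∃ γ, AltWord g k γ ∧ ((γ • (0 : 𝔻) : 𝔻) : ℂ) = z}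

theorem wordOrbit_subset {g k : SU11} (ht : Transverse g k) : wordOrbit g k ⊆ region g := by
  rintro z ⟨γ, h, rfl⟩
  exact h.smul_mem_region ht

theorem mem_closure_wordOrbit_of_isLimitPoint {g k : SU11} {ξ : Circle}
    (h : IsLimitPoint (Subgroup.closure {g, k}) ξ) :
    (ξ : ℂ) ∈ closure (wordOrbit g k) ∨ (ξ : ℂ) ∈ closure (wordOrbit k g) := by
  have hsub : {z : ℂ | ∃ γ ∈ Subgroup.closure {g, k}, ((γ • (0 : 𝔻) : 𝔻) : ℂ) = z} ⊆
      {0} ∪ (wordOrbit g k ∪ wordOrbit k g) := by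
    rintro z ⟨γ, hγ, rfl⟩
    rcases eq_one_or_altWord_of_mem_closure hγ with rfl | h | h
    · left; simp
    · right; left; exact ⟨γ, h, rfl⟩
    · right; right; exact ⟨γ, h, rfl⟩
  have := closure_mono hsub h
  rw [closure_union, closure_union, closure_singleton] at this
  rcases this with h0 | h | h
  · have h1 := Circle.norm_coe ξ
    rw [Set.mem_singleton_iff] at h0
    rw [h0, norm_zero] at h1
    norm_num at h1
  · exact Or.inl h
  · exact Or.inr h

theorem moebius_mem_closure_image {g : SU11} {η : ℂ} {s t : Set ℂ} (hη : ‖η‖ ≤ 1)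
    (h : η ∈ closure s) (hst : ∀ z ∈ s, moebius g z ∈ t) : moebius g η ∈ closure t :=
  closure_mono (Set.image_subset_iff.2 hst)
    ((continuousAt_moebius g hη).continuousWithinAt.mem_closure_image h)

/-- This reads off the first syllable of a boundary point. Either one exponent j of g can be
stripped, or the words approaching η have first exponents tending to +∞ or to -∞, and then η stays
in the same closed half-plane under all backward iterates. -/
theorem exists_zpow_inv_mem_closure_or {g k : SU11} (ht : Transverse g k) {η : ℂ} (hη : ‖η‖ = 1)
    (h : η ∈ closure (wordOrbit g k)) :
    (∃ j : ℤ, j ≠ 0 ∧ moebius (g ^ j)⁻¹ η ∈ closure (wordOrbit k g)) ∨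
    (∀ n : ℕ, moebius (g ^ n)⁻¹ η ∈ closure (halfPlane g)) ∨
    (∀ n : ℕ, moebius (g⁻¹ ^ n)⁻¹ η ∈ closure (halfPlane g⁻¹)) := by
  let E : ℤ → Set ℂ := fun j =>
    {z | ∃ γ, (γ = 1 ∨ AltWord k g γ) ∧ ((g ^ j • γ • (0 : 𝔻) : 𝔻) : ℂ) = z}
  have hnot : ∀ γ, (γ = 1 ∨ AltWord k g γ) → ((γ • (0 : 𝔻) : 𝔻) : ℂ) ∉ region g := by
    rintro γ (rfl | hγ)
    · simpa using ht.zero_left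
    · exact fun h' => Set.disjoint_left.1 ht.disjoint h' (hγ.smul_mem_region ht.symm)
  by_cases hj : ∃ j : ℤ, j ≠ 0 ∧ moebius (g ^ j)⁻¹ η ∈ closure (wordOrbit k g)
  · exact Or.inl hj
  right
  push Not at hj
  have hE : ∀ j : ℤ, j ≠ 0 → η ∉ closure (E j) := by
    intro j hj0 hmem
    have h1 : moebius (g ^ j)⁻¹ η ∈ closure ({0} ∪ wordOrbit k g) := by
      refine moebius_mem_closure_image hη.le hmem ?_
      rintro z ⟨γ, hγ, rfl⟩
      rw [← coe_smul, inv_smul_smul]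
      rcases hγ with rfl | hγ
      · left; simp
      · right; exact ⟨γ, hγ, rfl⟩
    rw [closure_union, closure_singleton] at h1
    rcases h1 with h0 | h1
    · have h2 := norm_moebius_eq_one (g ^ j)⁻¹ hη
      rw [Set.mem_singleton_iff] at h0
      rw [h0, norm_zero] at h2
      norm_num at h2
    · exact hj j hj0 h1
  let Pp : ℕ → Set ℂ := fun n => ⋃ j : {j : ℤ // (n : ℤ) < j}, E j
  let Pm : ℕ → Set ℂ := fun n => ⋃ j : {j : ℤ // j < -(n : ℤ)}, E j
  have hPp : ∀ n, η ∈ closure (Pp n) → moebius (g ^ n)⁻¹ η ∈ closure (halfPlane g) := by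
    intro n hn
    refine moebius_mem_closure_image hη.le hn ?_
    intro z hz
    obtain ⟨⟨j, hj⟩, γ, hγ, rfl⟩ := Set.mem_iUnion.1 hz
    obtain ⟨m, rfl⟩ : ∃ m : ℕ, j = n + ((m + 1 : ℕ) : ℤ) := ⟨(j - n - 1).toNat, by omega⟩
    rw [← coe_smul, zpow_add, zpow_natCast, zpow_natCast, mul_smul, inv_smul_smul]
    exact pow_smul_mem_halfPlane ht.trace_left ((notMem_region_iff _ _).1 (hnot γ hγ)).1.le m
  have hPm : ∀ n, η ∈ closure (Pm n) → moebius (g⁻¹ ^ n)⁻¹ η ∈ closure (halfPlane g⁻¹) := by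
    intro n hn
    refine moebius_mem_closure_image hη.le hn ?_
    intro z hz
    obtain ⟨⟨j, hj⟩, γ, hγ, rfl⟩ := Set.mem_iUnion.1 hz
    obtain ⟨m, rfl⟩ : ∃ m : ℕ, j = -(n + ((m + 1 : ℕ) : ℤ)) := ⟨(-j - n - 1).toNat, by omega⟩
    rw [← coe_smul, zpow_neg, ← inv_zpow, zpow_add, zpow_natCast, zpow_natCast, mul_smul,
      inv_smul_smul]
    exact pow_smul_mem_halfPlane (by rw [trace_inv]; exact ht.trace_left)
      ((notMem_region_iff _ _).1 (hnot γ hγ)).2.le m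
  -- The finitely many exponents with |j| ≤ n are discarded: closure commutes with finite unions,
  -- and no single `E j` with j ≠ 0 has η in its closure.
  have hcov : ∀ n : ℕ, η ∈ closure (Pp n) ∨ η ∈ closure (Pm n) := by
    intro n
    have hsub : wordOrbit g k ⊆
        (⋃ j ∈ (Finset.Icc (-(n : ℤ)) n).erase 0, E j) ∪ (Pp n ∪ Pm n) := by
      rintro z ⟨γ, hγ, rfl⟩
      obtain ⟨j, hj0, hjz⟩ : ∃ j : ℤ, j ≠ 0 ∧ ((γ • (0 : 𝔻) : 𝔻) : ℂ) ∈ E j := by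
        cases hγ with
        | single _ _ j hj0 => exact ⟨j, hj0, 1, Or.inl rfl, by rw [one_smul]⟩
        | cons _ _ j γ' hj0 h' => exact ⟨j, hj0, γ', Or.inr h', by rw [mul_smul]⟩
      by_cases h1 : (n : ℤ) < j
      · exact Or.inr (Or.inl (Set.mem_iUnion.2 ⟨⟨j, h1⟩, hjz⟩))
      by_cases h2 : j < -(n : ℤ)
      · exact Or.inr (Or.inr (Set.mem_iUnion.2 ⟨⟨j, h2⟩, hjz⟩))
      · left
        refine Set.mem_biUnion (x := j) ?_ hjz
        simp only [Finset.coe_erase, Finset.coe_Icc, Set.mem_sdiff, Set.mem_Icc,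
          Set.mem_singleton_iff]
        omega
    have h1 := closure_mono hsub h
    rw [closure_union, closure_union, Finset.closure_biUnion] at h1
    rcases h1 with h1 | h1
    · exfalso
      obtain ⟨j, hj, hjz⟩ := Set.mem_iUnion₂.1 h1
      exact hE j (Finset.ne_of_mem_erase hj) hjz
    · exact h1
  -- Both families decrease with n. If the positive one fails at some n₀, the negative one holds
  -- from n₀ on, hence for every n.
  by_cases hall : ∀ n, η ∈ closure (Pp n)
  · exact Or.inl fun n => hPp n (hall n)
  · right
    push Not at hall
    obtain ⟨n₀, hn₀⟩ := hall
    intro n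
    apply hPm
    have hmono : ∀ m, n₀ ≤ m → η ∈ closure (Pm m) := by
      intro m hm
      refine (hcov m).resolve_left fun h' => hn₀ (closure_mono ?_ h')
      intro z hz
      obtain ⟨⟨j, hj⟩, hjz⟩ := Set.mem_iUnion.1 hz
      exact Set.mem_iUnion.2 ⟨⟨j, by omega⟩, hjz⟩
    refine closure_mono ?_ (hmono (max n n₀) (le_max_right _ _))
    intro z hz
    obtain ⟨⟨j, hj⟩, hjz⟩ := Set.mem_iUnion.1 hz
    exact Set.mem_iUnion.2 ⟨⟨j, by have := le_max_left n n₀; omega⟩, hjz⟩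

/-! ### Displacement of parabolic elements -/

theorem IsParabolic.inv {k : SU11} (hk : IsParabolic k) : IsParabolic k⁻¹ := by
  refine ⟨by rw [trace_inv]; exact hk.1, fun h => hk.2.1 ?_, fun h => hk.2.2 ?_⟩
  · have : k⁻¹ = 1 := Subtype.ext h
    rw [inv_eq_one] at this
    rw [this]; rfl
  · have e : (k⁻¹).1 = (k.1)⁻¹ := rfl
    rw [e] at h
    have := congrArg (·⁻¹) h
    simpa using this

theorem IsParabolic.conj {k : SU11} (hk : IsParabolic k) (γ : SU11) :
    IsParabolic (γ⁻¹ * k * γ) := by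
  have e : (γ⁻¹ * k * γ).1 = γ.1⁻¹ * k.1 * γ.1 := rfl
  refine ⟨?_, fun h => hk.2.1 ?_, fun h => hk.2.2 ?_⟩
  · have : (γ⁻¹ * k * γ).1.1.trace = k.1.1.trace := by
      rw [e, mul_assoc]
      change ((γ.1⁻¹ * (k.1 * γ.1) : Matrix.SpecialLinearGroup (Fin 2) ℂ) :
        Matrix (Fin 2) (Fin 2) ℂ).trace = _
      rw [Matrix.SpecialLinearGroup.coe_mul, Matrix.trace_mul_comm,
        ← Matrix.SpecialLinearGroup.coe_mul, mul_assoc, mul_inv_cancel, mul_one]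
    rw [this]; exact hk.1
  · rw [e] at h
    have : k.1 = γ.1 * (γ.1⁻¹ * k.1 * γ.1) * γ.1⁻¹ := by group
    rw [this, h]; simp
  · rw [e] at h
    have : k.1 = γ.1 * (γ.1⁻¹ * k.1 * γ.1) * γ.1⁻¹ := by group
    rw [this, h]; simp

/-- Writing k = ε(1 + nilpotent) with ε = ±1, the factor of k^n is affine in n up to the sign ε^n.
-/
theorem den_pow_of_abs_trace_eq_two {k : SU11} (hk : |k.1.1.trace.re| = 2) :
    ∃ ε : ℂ, ε * ε = 1 ∧ k.1 0 0 + k.1 1 1 = 2 * ε ∧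
      ∀ (z : ℂ) (n : ℕ), den (k ^ n) z = ε ^ n * (1 + n * (ε * den k z - 1)) := by
  obtain ⟨ε, hε, htr⟩ : ∃ ε : ℂ, ε * ε = 1 ∧ ((k.1.1.trace.re : ℝ) : ℂ) = 2 * ε := by
    rcases (abs_eq (by norm_num : (0 : ℝ) ≤ 2)).1 hk with h | h
    · exact ⟨1, by norm_num, by rw [h]; norm_num⟩
    · exact ⟨-1, by norm_num, by rw [h]; norm_num⟩
  refine ⟨ε, hε, by rw [trace_eq, htr], fun z n => ?_⟩
  have hrec : ∀ m : ℕ, den (k ^ (m + 2)) z = 2 * ε * den (k ^ (m + 1)) z - den (k ^ m) z := by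
    intro m
    have h := den_mul_add_den_inv_mul k (k ^ (m + 1)) z
    rw [htr, ← pow_succ', pow_succ' k m, inv_mul_cancel_left, ← pow_succ'] at h
    linear_combination h
  have hboth : ∀ m : ℕ, den (k ^ m) z = ε ^ m * (1 + m * (ε * den k z - 1)) ∧
      den (k ^ (m + 1)) z = ε ^ (m + 1) * (1 + (m + 1 : ℕ) * (ε * den k z - 1)) := by
    intro m
    induction m with
    | zero =>
      refine ⟨by simp, ?_⟩
      rw [zero_add, pow_one, pow_one, Nat.cast_one]
      linear_combination (-den k z) * hε
    | succ m ih =>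
      refine ⟨ih.2, ?_⟩
      rw [hrec m, ih.1, ih.2]
      simp only [Nat.cast_add, Nat.cast_one]
      linear_combination (-(ε ^ m * (1 + m * (ε * den k z - 1)))) * hε * (-1)
  exact (hboth n).1

/-- A bounded affine sequence is constant, so den k z = ε. Together with trace 2ε and determinant 1
this is the fixed point equation. -/
theorem IsParabolic.moebius_eq_of_norm_den_pow_le {k : SU11} (hk : IsParabolic k) {z : ℂ}
    (hz : ‖z‖ ≤ 1) (h : ∀ n : ℕ, ‖den (k ^ n) z‖ ≤ 1) : moebius k z = z := by
  obtain ⟨ε, hε, htr, hden⟩ := den_pow_of_abs_trace_eq_two hk.1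
  have hεn : ‖ε‖ = 1 := by
    have := congrArg norm hε
    rw [norm_mul, norm_one] at this
    nlinarith [norm_nonneg ε]
  have h1 : ε * den k z - 1 = 0 := by
    rw [← norm_eq_zero]
    by_contra hne
    have hpos : 0 < ‖ε * den k z - 1‖ := lt_of_le_of_ne (norm_nonneg _) (Ne.symm hne)
    obtain ⟨n, hn⟩ := exists_nat_gt (2 / ‖ε * den k z - 1‖)
    rw [div_lt_iff₀ hpos] at hn
    have h2 := h n
    rw [hden, norm_mul, norm_pow, hεn, one_pow, one_mul] at h2
    have h3 := norm_sub_le (1 + n * (ε * den k z - 1)) 1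
    rw [add_sub_cancel_left, norm_mul, norm_one, Complex.norm_natCast] at h3
    linarith
  have h2 : den k z = ε := by linear_combination ε * h1 - den k z * hε
  have hc := hk.entry_ne_zero
  have hdet := det_eq k
  rw [moebius_eq, div_eq_iff (den_ne_zero k hz), h2]
  rw [den] at h2
  apply mul_left_cancel₀ hc
  linear_combination (k.1 0 0 - ε) * h2 - hdet + ε * htr + hε

theorem moebius_zpow_fixed {k : SU11} {ζ : ℂ} (hζ : ‖ζ‖ = 1) (h1 : moebius k ζ = ζ)
    (h2 : ‖den k ζ‖ = 1) (n : ℤ) : moebius (k ^ n) ζ = ζ ∧ ‖den (k ^ n) ζ‖ = 1 := by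
  let S : Subgroup SU11 :=
    { carrier := {g | moebius g ζ = ζ ∧ ‖den g ζ‖ = 1}
      one_mem' := by constructor <;> simp
      mul_mem' := by
        rintro a b ⟨ha, ha'⟩ ⟨hb, hb'⟩
        exact ⟨by rw [moebius_mul _ _ hζ.le, hb, ha],
          by rw [den_mul _ _ hζ.le, norm_mul, hb, ha', hb', one_mul]⟩
      inv_mem' := by
        rintro a ⟨ha, ha'⟩
        refine ⟨?_, ?_⟩
        · have := moebius_inv_moebius a hζ.le
          rwa [ha] at this
        · have := congrArg norm (den_inv_mul_den a hζ.le)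
          rwa [ha, norm_mul, ha', mul_one, norm_one] at this }
  exact S.zpow_mem (x := k) ⟨h1, h2⟩ n

/-- The displacement at z depends only on the horocycle at ζ through z: |z - ζ|²/(1 - |z|²) is the
inverse of the Poisson kernel. -/
theorem IsParabolic.exists_fixedPoint_displacement {k : SU11} (hk : IsParabolic k) :
    ∃ ζ : ℂ, ‖ζ‖ = 1 ∧ (∀ z : ℂ, ‖z‖ = 1 → moebius k z = z → z = ζ) ∧
      (∀ n : ℤ, moebius (k ^ n) ζ = ζ ∧ ‖den (k ^ n) ζ‖ = 1) ∧
      ∀ z : 𝔻, Real.sinh (hypDist z (k • z) / 2) = ‖k.1 1 0‖ * (‖(z : ℂ) - ζ‖ / wt z) ^ 2 := by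
  obtain ⟨ζ, hζ, hden, hform⟩ := hk.exists_fixedPoint
  have hc := norm_pos_iff.2 hk.entry_ne_zero
  have hfix : moebius k ζ = ζ := by
    have := hform ζ hζ.le
    rw [sub_self, norm_zero, hden, mul_one] at this
    simpa [sub_eq_zero] using this
  refine ⟨ζ, hζ, fun z hz h => ?_, moebius_zpow_fixed hζ hfix hden, fun z => ?_⟩
  · have := hform z hz.le
    rw [h, sub_self, norm_zero, zero_mul] at this
    have h2 := (mul_eq_zero.1 this.symm).resolve_left hc.ne'
    rw [sq_eq_zero_iff, norm_eq_zero, sub_eq_zero] at h2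
    exact h2
  · have := hform z z.norm_lt_one.le
    have h1 := norm_den_pos k z.norm_lt_one.le
    have h2 := wt_pos z
    rw [sinh_half_hypDist, wt_smul, coe_smul, norm_sub_rev]
    calc _ = (‖moebius k z - z‖ * ‖den k z‖) / wt z ^ 2 := by field_simp
      _ = _ := by rw [this]; ring

theorem IsParabolic.le_sinh_displacement {k : SU11} (hk : IsParabolic k) (z : 𝔻) :
    ‖k.1 1 0‖ * (wt z ^ 2 / 4) ≤ Real.sinh (hypDist z (k • z) / 2) := by
  obtain ⟨ζ, hζ, -, -, H⟩ := hk.exists_fixedPoint_displacement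
  rw [H]
  have h1 := wt_pos z
  have h2 := wt_sq z
  have h3 : 1 - ‖(z : ℂ)‖ ≤ ‖(z : ℂ) - ζ‖ := by
    have := norm_sub_norm_le ζ (z : ℂ)
    rwa [hζ, norm_sub_rev] at this
  have h4 := z.norm_lt_one
  have h5 := norm_nonneg (z : ℂ)
  have h6 : wt z / 2 ≤ ‖(z : ℂ) - ζ‖ / wt z := by
    rw [div_le_div_iff₀ two_pos h1]
    nlinarith
  have h7 : wt z ^ 2 / 4 ≤ (‖(z : ℂ) - ζ‖ / wt z) ^ 2 := by
    calc wt z ^ 2 / 4 = (wt z / 2) ^ 2 := by ring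
      _ ≤ _ := by gcongr
  gcongr

/-- Uniform discreteness: ping-pong sends the centre into the region of the first generator of the
word, which is at distance at least δ from the centre. -/
theorem PingPong.le_norm_orbit {h p : SU11} {δ κ : ℝ} (P : PingPong h p δ κ) {γ : SU11}
    (hγ : γ ∈ Subgroup.closure {h, p}) (hne : γ ≠ 1) : δ ≤ ‖γ.1 1 0‖ := by
  have h1 : δ ≤ ‖((γ • (0 : 𝔻) : 𝔻) : ℂ)‖ := by
    rcases eq_one_or_altWord_of_mem_closure hγ with h | h | h
    · exact absurd h hne
    · exact P.le_norm_left _ (h.smul_mem_region P.transverse)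
    · exact P.le_norm_right _ (h.smul_mem_region P.transverse.symm)
  rw [← sinh_half_orbit, sinh_half_hypDist, UnitDisc.coe_zero, zero_sub, norm_neg, wt_zero, one_mul,
    le_div_iff₀ (wt_pos _)]
  have := wt_le_one (γ • (0 : 𝔻))
  nlinarith [P.pos]

/-- Parabolic elements displace thick points by a definite amount. Translating the point to within R
of the centre conjugates k into another nontrivial element of the group, to which the uniform
discreteness applies. -/
theorem PingPong.le_sinh_displacement {h p : SU11} {δ κ : ℝ} (P : PingPong h p δ κ) {k : SU11}
    (hk : k ∈ Subgroup.closure {h, p}) (hpar : IsParabolic k) {R : ℝ} {z : 𝔻}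
    (hz : z ∈ orbitNhd (Subgroup.closure {h, p}) R) :
    δ * ((1 / Real.cosh (R / 2)) ^ 2 / 4) ≤ Real.sinh (hypDist z (k • z) / 2) := by
  obtain ⟨γ, hγ, hd⟩ := hz
  have h1 := (hpar.conj γ).le_sinh_displacement (γ⁻¹ • z)
  have h2 : hypDist (γ⁻¹ • z) ((γ⁻¹ * k * γ) • γ⁻¹ • z) = hypDist z (k • z) := by
    rw [mul_smul, smul_inv_smul, mul_smul, hypDist_smul]
  rw [h2] at h1
  refine le_trans ?_ h1
  have h3 : δ ≤ ‖(γ⁻¹ * k * γ).1 1 0‖ := by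
    refine P.le_norm_orbit (mul_mem (mul_mem (inv_mem hγ) hk) hγ) fun h => ?_
    apply (hpar.conj γ).2.1
    rw [h]; rfl
  have h4 : 1 / Real.cosh (R / 2) ≤ wt (γ⁻¹ • z) := by
    rw [hypDist_comm, hypDist_smul_left] at hd
    have h0 := hypDist_nonneg 0 (γ⁻¹ • z)
    have h5 : Real.cosh (hypDist 0 (γ⁻¹ • z) / 2) ≤ Real.cosh (R / 2) := by
      rw [Real.cosh_le_cosh, abs_of_nonneg (by linarith), abs_of_nonneg (by linarith)]
      linarith
    rw [cosh_half_hypDist_zero] at h5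
    have h6 := wt_pos (γ⁻¹ • z)
    rw [div_le_iff₀ (Real.cosh_pos _)]
    rw [div_le_iff₀ h6] at h5
    linarith
  have := P.pos
  have := Real.cosh_pos (R / 2)
  gcongr

/-- A point of the thick part cannot be deep inside an excursion into the cusp. -/
theorem PingPong.exists_excursion_bound {h p : SU11} {δ κ : ℝ} (P : PingPong h p δ κ) (R : ℝ) :
    ∃ C, ∀ y ∈ orbitNhd (Subgroup.closure {h, p}) R, ∀ r : ℤ, r ≠ 0 →
      2 * Real.log |(r : ℝ)| - C ≤ hypDist 0 y ∨
      2 * Real.log |(r : ℝ)| - C ≤ hypDist y (p ^ r • (0 : 𝔻)) := by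
  obtain ⟨ζ, hζ, -, hfix, H⟩ := P.parabolic.exists_fixedPoint_displacement
  have hc := norm_pos_iff.2 P.parabolic.entry_ne_zero
  set c := ‖p.1 1 0‖
  set ε := δ * ((1 / Real.cosh (R / 2)) ^ 2 / 4)
  have hε : 0 < ε := by
    have := P.pos
    have := Real.cosh_pos (R / 2)
    positivity
  refine ⟨-(2 * Real.log (c * √(ε / c))), fun y hy r hr => ?_⟩
  have hr' : 0 < |(r : ℝ)| := by positivity
  have h1 := P.le_sinh_displacement (Subgroup.subset_closure (by simp)) P.parabolic hy
  rw [H] at h1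
  have hw := wt_pos y
  have h2 : √(ε / c) ≤ ‖(y : ℂ) - ζ‖ / wt y := by
    apply Real.sqrt_le_iff.2
    refine ⟨by positivity, ?_⟩
    rw [div_le_iff₀ hc, mul_comm]
    exact h1
  have hA := norm_den_pos (p ^ r) (z := 0) (by simp)
  set A := ‖den (p ^ r) 0‖ with hAdef
  have hwA : wt (p ^ r • (0 : 𝔻)) = 1 / A := by rw [wt_smul]; simp [hAdef]
  -- Ptolemy's inequality for 0, y, p^r(0) and ζ. After division by the weights, the left side is of
  -- order |r| because y, being thick, is not deep in a horoball at ζ; the right side is the sum of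
  -- the two sinh of half distances.
  have h3 := EuclideanGeometry.mul_dist_le_mul_dist_add_mul_dist (0 : ℂ) (y : ℂ)
    ((p ^ r • (0 : 𝔻) : 𝔻) : ℂ) ζ
  simp only [dist_eq_norm] at h3
  have e1 : ‖(0 : ℂ) - (p ^ r • (0 : 𝔻) : 𝔻)‖ = |(r : ℝ)| * c / A := by
    have := sinh_half_mul 0 (p ^ r • (0 : 𝔻))
    rw [sinh_half_orbit, P.parabolic.norm_zpow_entry, hwA, UnitDisc.coe_zero, wt_zero] at this
    rw [← this]; ring
  have e2 : ‖(0 : ℂ) - y‖ = Real.sinh (hypDist 0 y / 2) * wt y := by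
    rw [← UnitDisc.coe_zero, ← sinh_half_mul 0 y, wt_zero, one_mul]
  have e3 : ‖((p ^ r • (0 : 𝔻) : 𝔻) : ℂ) - ζ‖ = 1 / A := by
    conv_lhs => rw [← (hfix r).1]
    rw [coe_smul, UnitDisc.coe_zero, norm_moebius_sub _ (by simp) hζ.le, (hfix r).2, zero_sub,
      norm_neg, hζ, mul_one]
  have e4 : ‖(y : ℂ) - (p ^ r • (0 : 𝔻) : 𝔻)‖ =
      Real.sinh (hypDist y (p ^ r • (0 : 𝔻)) / 2) * (wt y * (1 / A)) := by
    rw [← hwA, sinh_half_mul]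
  have e5 : ‖(0 : ℂ) - ζ‖ = 1 := by rw [zero_sub, norm_neg, hζ]
  rw [e1, e2, e3, e4, e5] at h3
  have h4 : |(r : ℝ)| * c * (‖(y : ℂ) - ζ‖ / wt y) ≤
      Real.sinh (hypDist 0 y / 2) + Real.sinh (hypDist y (p ^ r • (0 : 𝔻)) / 2) := by
    have h5 : |(r : ℝ)| * c * (‖(y : ℂ) - ζ‖ / wt y) =
        (|(r : ℝ)| * c / A * ‖(y : ℂ) - ζ‖) * (A / wt y) := by field_simp
    rw [h5]
    calc _ ≤ (Real.sinh (hypDist 0 y / 2) * wt y * (1 / A) +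
          Real.sinh (hypDist y (p ^ r • (0 : 𝔻)) / 2) * (wt y * (1 / A)) * 1) * (A / wt y) := by
          gcongr
      _ = _ := by field_simp
  have h6 : |(r : ℝ)| * (c * √(ε / c)) ≤
      Real.exp (max (hypDist 0 y) (hypDist y (p ^ r • (0 : 𝔻))) / 2) := by
    have a1 := two_mul_sinh_le_exp (hypDist 0 y / 2)
    have a2 := two_mul_sinh_le_exp (hypDist y (p ^ r • (0 : 𝔻)) / 2)
    have a3 : Real.exp (hypDist 0 y / 2) ≤
        Real.exp (max (hypDist 0 y) (hypDist y (p ^ r • (0 : 𝔻))) / 2) :=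
      Real.exp_le_exp.2 (by linarith [le_max_left (hypDist 0 y) (hypDist y (p ^ r • (0 : 𝔻)))])
    have a4 : Real.exp (hypDist y (p ^ r • (0 : 𝔻)) / 2) ≤
        Real.exp (max (hypDist 0 y) (hypDist y (p ^ r • (0 : 𝔻))) / 2) :=
      Real.exp_le_exp.2 (by linarith [le_max_right (hypDist 0 y) (hypDist y (p ^ r • (0 : 𝔻)))])
    have a5 : |(r : ℝ)| * (c * √(ε / c)) ≤ |(r : ℝ)| * c * (‖(y : ℂ) - ζ‖ / wt y) := by
      rw [mul_assoc]; gcongr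
    linarith
  have hcε : 0 < c * √(ε / c) := by positivity
  have h7 := Real.log_le_log (by positivity) h6
  rw [Real.log_mul hr'.ne' hcε.ne', Real.log_exp] at h7
  rcases le_total (hypDist 0 y) (hypDist y (p ^ r • (0 : 𝔻))) with hle | hle
  · right
    rw [max_eq_right hle] at h7
    linarith
  · left
    rw [max_eq_left hle] at h7
    linarith

/-- Here sinh(d/2) = |r| c exactly, with c the norm of the lower left entry of k. -/
theorem IsParabolic.exists_abs_hypDist_zpow_sub_le {k : SU11} (hk : IsParabolic k) :
    ∃ C, ∀ r : ℤ, r ≠ 0 → |hypDist 0 (k ^ r • (0 : 𝔻)) - 2 * Real.log (|(r : ℝ)|)| ≤ C := by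
  have hc := norm_pos_iff.2 hk.entry_ne_zero
  set c := ‖k.1 1 0‖
  refine ⟨max (2 * Real.log (2 * c + 1)) (-(2 * Real.log c)), fun r hr => ?_⟩
  have hr1 : 1 ≤ |(r : ℝ)| := by exact_mod_cast Int.one_le_abs hr
  have h1 := sinh_half_orbit (k ^ r)
  rw [hk.norm_zpow_entry] at h1
  have h0 := hypDist_nonneg 0 (k ^ r • (0 : 𝔻))
  set d := hypDist 0 (k ^ r • (0 : 𝔻))
  have h2 := two_mul_sinh_le_exp (d / 2)
  have h3 := exp_le_two_mul_sinh_add_one (t := d / 2) (by linarith)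
  rw [h1] at h2 h3
  have hrc : 0 < |(r : ℝ)| * c := by positivity
  have h4 := Real.log_le_log hrc (show |(r : ℝ)| * c ≤ Real.exp (d / 2) by
    linarith [show 2 * (|(r : ℝ)| * c) ≤ Real.exp (d / 2) from h2])
  have h5 := Real.log_le_log (Real.exp_pos _) (show Real.exp (d / 2) ≤ |(r : ℝ)| * (2 * c + 1) by
    nlinarith [show Real.exp (d / 2) ≤ 2 * (|(r : ℝ)| * c) + 1 from h3])
  rw [Real.log_exp, Real.log_mul (by positivity) (by positivity)] at h5
  rw [Real.log_exp, Real.log_mul (by positivity) (by positivity)] at h4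
  rw [abs_le]
  constructor
  · linarith [le_max_right (2 * Real.log (2 * c + 1)) (-(2 * Real.log c))]
  · linarith [le_max_left (2 * Real.log (2 * c + 1)) (-(2 * Real.log c))]

/-! ### Parabolic limit points -/

theorem occupation_nonneg (Γ : Subgroup SU11) (ξ : Circle) (R : ℝ) {T : ℝ} (hT : 0 ≤ T) :
    0 ≤ occupation Γ ξ R T :=
  intervalIntegral.integral_nonneg hT fun _ _ => Set.indicator_nonneg (fun _ _ => zero_le_one) _

theorem tendsto_occupation_of_eventually_notMem (Γ : Subgroup SU11) [Countable Γ] (ξ : Circle)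
    (R : ℝ) (h : ∀ᶠ t in atTop, stdRay ξ t ∉ orbitNhd Γ R) :
    Tendsto (fun T => 1 / T * occupation Γ ξ R T) atTop (𝓝 0) := by
  obtain ⟨T₀, h⟩ := eventually_atTop.1 h
  have hlim : Tendsto (fun T : ℝ => 1 / T * occupation Γ ξ R T₀) atTop (𝓝 0) := by
    simpa using (tendsto_inv_atTop_zero (𝕜 := ℝ)).mul_const (occupation Γ ξ R T₀)
  refine hlim.congr' ?_
  filter_upwards [eventually_ge_atTop T₀] with T hT
  congr 1
  have h1 := intervalIntegral.integral_add_adjacent_intervals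
    (intervalIntegrable_indicator_stdRay Γ ξ R 0 T₀) (intervalIntegrable_indicator_stdRay Γ ξ R T₀ T)
  rw [occupation, occupation, ← h1]
  have h2 : ∫ t in T₀..T, (orbitNhd Γ R).indicator (fun _ => (1 : ℝ)) (stdRay ξ t) = 0 := by
    apply intervalIntegral.integral_zero_ae
    refine Eventually.of_forall fun t ht => ?_
    rw [Set.uIoc_of_le hT] at ht
    exact Set.indicator_of_notMem (h t ht.1.le) _
  rw [h2, add_zero]

/-- Along the ray the displacement of the parabolic element fixing ξ tends to 0, whereas it is
bounded below on each thick part. -/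
theorem PingPong.divergesOnAverage_of_isParabolicPoint {h p : SU11} {δ κ : ℝ}
    (P : PingPong h p δ κ) [Countable (Subgroup.closure {h, p})] {ξ : Circle}
    (hξ : IsParabolicPoint (Subgroup.closure {h, p}) ξ) :
    DivergesOnAverage (Subgroup.closure {h, p}) ξ := by
  obtain ⟨k, hk, hpar, hfix⟩ := hξ
  obtain ⟨ζ, hζ, huniq, hpow, H⟩ := hpar.exists_fixedPoint_displacement
  have hξn := Circle.norm_coe ξ
  obtain rfl := huniq ξ hξn hfix
  have hc := norm_pos_iff.2 hpar.entry_ne_zero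
  rw [divergesOnAverage_iff]
  constructor
  · have hlim : Tendsto (fun n : ℕ => ((k ^ n • (0 : 𝔻) : 𝔻) : ℂ)) atTop (𝓝 (ξ : ℂ)) := by
      rw [tendsto_iff_norm_sub_tendsto_zero]
      have h1 : Tendsto (fun n : ℕ => 1 / ((n : ℝ) * ‖k.1 1 0‖)) atTop (𝓝 0) :=
        (tendsto_natCast_atTop_atTop.atTop_mul_const hc).const_div_atTop 1
      refine squeeze_zero' (Eventually.of_forall fun n => norm_nonneg _) ?_ h1
      filter_upwards [eventually_gt_atTop 0] with n hn
      have h2 := hpow n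
      rw [zpow_natCast] at h2
      conv_lhs => rw [← h2.1]
      rw [coe_smul, UnitDisc.coe_zero, norm_moebius_sub _ (by simp) hζ.le, h2.2, zero_sub,
        norm_neg, hζ, mul_one, ← norm_pow_entry_of_abs_trace_eq_two hpar.1]
      have h3 := norm_entry_lt (k ^ n)
      have h4 : 0 < ‖(k ^ n).1 1 0‖ := by
        rw [norm_pow_entry_of_abs_trace_eq_two hpar.1]
        have : (0 : ℝ) < n := by exact_mod_cast hn
        positivity
      apply one_div_le_one_div_of_le h4
      simpa [den] using h3.le
    refine mem_closure_of_tendsto hlim (Eventually.of_forall fun n => ?_)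
    exact ⟨k ^ n, Subgroup.pow_mem _ hk n, rfl⟩
  · intro R
    apply tendsto_occupation_of_eventually_notMem
    set ε := δ * ((1 / Real.cosh (R / 2)) ^ 2 / 4)
    have hε : 0 < ε := by
      have := P.pos
      have := Real.cosh_pos (R / 2)
      positivity
    have hlim : Tendsto (fun t : ℝ => ‖k.1 1 0‖ * (2 * Real.exp (-(t / 2))) ^ 2) atTop (𝓝 0) := by
      have h1 : Tendsto (fun t : ℝ => Real.exp (-(t / 2))) atTop (𝓝 0) :=
        Real.tendsto_exp_neg_atTop_nhds_zero.comp (tendsto_id.atTop_div_const two_pos)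
      simpa using ((h1.const_mul 2).pow 2).const_mul ‖k.1 1 0‖
    filter_upwards [hlim.eventually (gt_mem_nhds hε), eventually_ge_atTop 0] with t ht ht0 hmem
    have h1 := P.le_sinh_displacement hk hpar hmem
    rw [H] at h1
    refine absurd (h1.trans ?_) (not_le.2 ht)
    have h2 : ‖(stdRay ξ t : ℂ) - ξ‖ / wt (stdRay ξ t) ≤ 2 * Real.exp (-(t / 2)) := by
      refine le_trans ?_ (one_div_cosh_le _)
      have hch := Real.cosh_pos (t / 2)
      rw [norm_sub_rev, norm_circle_sub_stdRay, wt_stdRay, div_le_iff₀ (by positivity), ← sq]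
      exact one_sub_tanh_le (by linarith)
    have := wt_pos (stdRay ξ t)
    gcongr

/-! ### Geometry of a coding at level one -/

theorem le_norm_sub_of_mem_closure {s t : Set ℂ} {δ : ℝ} (h : ∀ z ∈ s, ∀ w ∈ t, δ ≤ ‖z - w‖)
    {z w : ℂ} (hz : z ∈ s) (hw : w ∈ closure t) : δ ≤ ‖z - w‖ := by
  have hc : IsClosed {w : ℂ | δ ≤ ‖z - w‖} := isClosed_le continuous_const (by fun_prop)
  exact closure_minimal (fun w hw => h z hz w hw) hc hw

theorem exists_mem_Icc_succ (s : ℕ → ℝ) {t : ℝ} {m n : ℕ} (hm : s m ≤ t) (hn : t < s n)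
    (hmn : m ≤ n) : ∃ i, m ≤ i ∧ i < n ∧ s i ≤ t ∧ t < s (i + 1) := by
  induction n, hmn using Nat.le_induction with
  | base => linarith
  | succ n hmn ih =>
    rcases lt_or_ge t (s n) with h | h
    · obtain ⟨i, h1, h2, h3⟩ := ih h
      exact ⟨i, h1, by omega, h3⟩
    · exact ⟨n, hmn, by omega, h, hn⟩

/-- The ray passes near each A g^i(0) at time d(0, A g^i(0)), and consecutive times advance by at
most d(0, g(0)). Every intermediate time is thus close to one of them. -/
theorem mem_orbitNhd_of_forall_le_norm_sub {Γ : Subgroup SU11} {g A : SU11} (hg : g ∈ Γ) (hA : A ∈ Γ)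
    {ξ : Circle} {δ : ℝ} (hδ : 0 < δ) {n : ℕ}
    (h : ∀ i ≤ n, δ ≤ ‖(((A * g ^ i)⁻¹ • (0 : 𝔻) : 𝔻) : ℂ) - moebius (A * g ^ i)⁻¹ ξ‖) {t : ℝ}
    (ht : hypDist 0 (A • (0 : 𝔻)) ≤ t) (htn : t ≤ hypDist 0 ((A * g ^ n) • (0 : 𝔻))) :
    stdRay ξ t ∈ orbitNhd Γ (hypDist 0 (g • (0 : 𝔻)) + 2 * Real.arsinh (1 / δ + 1)) := by
  set s : ℕ → ℝ := fun i => hypDist 0 ((A * g ^ i) • (0 : 𝔻)) with hs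
  obtain ⟨i, hi, h1, h2⟩ : ∃ i ≤ n, s i ≤ t ∧ t ≤ s i + hypDist 0 (g • (0 : 𝔻)) := by
    rcases htn.eq_or_lt with h' | h'
    · exact ⟨n, le_rfl, h'.ge, by linarith [hypDist_nonneg 0 (g • (0 : 𝔻))]⟩
    · obtain ⟨i, -, h1, h2, h3⟩ := exists_mem_Icc_succ s (m := 0) (by simpa [hs] using ht) h'
        (Nat.zero_le _)
      refine ⟨i, h1.le, h2, h3.le.trans ?_⟩
      have := hypDist_triangle 0 ((A * g ^ i) • (0 : 𝔻)) ((A * g ^ (i + 1)) • (0 : 𝔻))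
      rwa [pow_succ, ← mul_assoc, mul_smul _ g, hypDist_smul, ← mul_smul, mul_assoc, ← pow_succ]
        at this
  refine ⟨A * g ^ i, mul_mem hA (pow_mem hg i), ?_⟩
  have h3 := hypDist_orbit_stdRay_le hδ (h i hi)
  have h4 := hypDist_triangle (stdRay ξ t) (stdRay ξ (s i)) ((A * g ^ i) • 0)
  rw [hypDist_stdRay, abs_of_nonneg (by linarith)] at h4
  linarith

theorem smul_mem_orbitNhd {Γ : Subgroup SU11} {γ : SU11} (hγ : γ ∈ Γ) {R : ℝ} {z : 𝔻}
    (hz : z ∈ orbitNhd Γ R) : γ • z ∈ orbitNhd Γ R := by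
  obtain ⟨k, hk, h⟩ := hz
  exact ⟨γ * k, mul_mem hγ hk, by rwa [mul_smul, hypDist_smul]⟩

/-- It rests on cosh(x + ln(1 + κ)) ≤ (1 + κ) cosh x. -/
theorem add_log_le_hypDist_smul {g : SU11} {z : 𝔻} {κ : ℝ} (hκ : 0 ≤ κ) (h : 1 + κ ≤ ‖den g z‖) :
    hypDist 0 z + 2 * Real.log (1 + κ) ≤ hypDist 0 (g • z) := by
  have h0 := hypDist_nonneg 0 z
  have h0' := hypDist_nonneg 0 (g • z)
  have hl : 0 ≤ Real.log (1 + κ) := Real.log_nonneg (by linarith)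
  have h1 : Real.cosh (hypDist 0 z / 2 + Real.log (1 + κ)) ≤ Real.cosh (hypDist 0 (g • z) / 2) := by
    rw [cosh_half_hypDist_zero_smul]
    have hle : Real.cosh (hypDist 0 z / 2 + Real.log (1 + κ)) ≤
        Real.exp (Real.log (1 + κ)) * Real.cosh (hypDist 0 z / 2) := by
      rw [Real.cosh_add, ← Real.cosh_add_sinh, add_mul]
      have e1 : Real.sinh (hypDist 0 z / 2) ≤ Real.cosh (hypDist 0 z / 2) := Real.sinh_lt_cosh _ |>.le
      have e2 : 0 ≤ Real.sinh (Real.log (1 + κ)) := Real.sinh_nonneg_iff.2 hl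
      nlinarith
    rw [Real.exp_log (by linarith)] at hle
    have := Real.cosh_pos (hypDist 0 z / 2)
    nlinarith
  rw [Real.cosh_le_cosh, abs_of_nonneg (by linarith), abs_of_nonneg (by linarith)] at h1
  linarith

variable {h p : SU11} {δ κ : ℝ} {ω : ℕ → SU11} {r : ℕ → ℤ} {ξ : Circle}

theorem PingPong.le_norm_sub (P : PingPong h p δ κ) {z w : ℂ} (hz : z ∈ region h ∪ {0})
    (hw : w ∈ region p ∪ {0}) : z = 0 ∨ w = 0 ∨ δ ≤ ‖z - w‖ := by
  rcases hz with hz | hz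
  · rcases hw with hw | hw
    · exact Or.inr (Or.inr (P.separated z hz w hw))
    · exact Or.inr (Or.inl hw)
  · exact Or.inl hz

theorem PingPong.le_norm_sub_closure_right (P : PingPong h p δ κ) {z w : ℂ}
    (hz : z ∈ region h ∪ {0}) (hw : w ∈ closure (region p)) : δ ≤ ‖z - w‖ := by
  refine le_norm_sub_of_mem_closure (s := region h ∪ {0}) (t := region p) ?_ hz hw
  rintro z (hz | rfl) w hw
  · exact P.separated z hz w hw
  · rw [zero_sub, norm_neg]; exact P.le_norm_right w hw

theorem PingPong.le_norm_sub_closure_left (P : PingPong h p δ κ) {z w : ℂ}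
    (hz : z ∈ region p ∪ {0}) (hw : w ∈ closure (region h)) : δ ≤ ‖z - w‖ := by
  refine le_norm_sub_of_mem_closure (s := region p ∪ {0}) (t := region h) ?_ hz hw
  rintro z (hz | rfl) w hw
  · rw [norm_sub_rev]; exact P.separated w hw z hz
  · rw [zero_sub, norm_neg]; exact P.le_norm_left w hw

theorem PingPong.notMem_left (P : PingPong h p δ κ) {z : ℂ} (hz : z ∈ region p ∪ {0}) :
    z ∉ region h := by
  rcases hz with hz | rfl
  · exact fun h' => Set.disjoint_left.1 P.transverse.disjoint h' hz
  · exact P.transverse.zero_left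

theorem PingPong.notMem_right (P : PingPong h p δ κ) {z : ℂ} (hz : z ∈ region h ∪ {0}) :
    z ∉ region p := by
  rcases hz with hz | rfl
  · exact fun h' => Set.disjoint_left.1 P.transverse.disjoint hz h'
  · exact P.transverse.zero_right

theorem PingPong.pow_smul_mem (P : PingPong h p δ κ) {z : 𝔻} (hz : (z : ℂ) ∈ region p ∪ {0})
    (n : ℕ) : ((h ^ (n + 1) • z : 𝔻) : ℂ) ∈ halfPlane h :=
  pow_smul_mem_halfPlane P.trace_left
    (((notMem_region_iff h z).1 (P.notMem_left hz)).1.le) n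

theorem PingPong.moebius_pow_mem_closure (P : PingPong h p δ κ) {η : ℂ}
    (hη : η ∈ closure (region p)) (n : ℕ) : moebius (h ^ (n + 1)) η ∈ closure (halfPlane h) := by
  have h1 : ‖η‖ ≤ 1 := by
    rw [region, closure_union] at hη
    rcases hη with hη | hη
    · exact (closure_halfPlane_subset _ hη).1
    · exact (closure_halfPlane_subset _ hη).1
  refine moebius_mem_closure_image h1 hη fun z hz => ?_
  have hz1 : ‖z‖ < 1 := by
    rcases hz with hz | hz <;> exact norm_lt_one_of_mem_halfPlane hz
  lift z to 𝔻 using hz1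
  exact P.pow_smul_mem (Or.inl hz) n

/-- The ray follows the orbit along a positive power of `h`. -/
theorem PingPong.mem_orbitNhd_of_pow (P : PingPong h p δ κ) {Γ : Subgroup SU11} (hh : h ∈ Γ)
    {A : SU11} (hA : A ∈ Γ) (hA0 : ((A⁻¹ • (0 : 𝔻) : 𝔻) : ℂ) ∈ region p ∪ {0}) {n : ℕ}
    (htail : (n ≠ 0 ∧ moebius (A * h ^ n)⁻¹ ξ ∈ closure (region p)) ∨
      ∀ i ≤ n, moebius (A * h ^ i)⁻¹ ξ ∈ closure (halfPlane h)) {t : ℝ}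
    (ht : hypDist 0 (A • (0 : 𝔻)) ≤ t) (htn : t ≤ hypDist 0 ((A * h ^ n) • (0 : 𝔻))) :
    stdRay ξ t ∈ orbitNhd Γ (hypDist 0 (h • (0 : 𝔻)) + 2 * Real.arsinh (1 / δ + 1)) := by
  refine mem_orbitNhd_of_forall_le_norm_sub hh hA P.pos (fun i hi => ?_) ht htn
  have hsub : ∀ {w}, w ∈ closure (halfPlane h) → w ∈ closure (region h) :=
    fun hw => closure_mono Set.subset_union_left hw
  have hξ := (Circle.norm_coe ξ).le
  have hin : i < n → moebius (A * h ^ i)⁻¹ ξ ∈ closure (halfPlane h) := by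
    intro hlt
    rcases htail with h' | h'
    · obtain ⟨m, rfl⟩ : ∃ m, n = i + (m + 1) := ⟨n - i - 1, by omega⟩
      have := P.moebius_pow_mem_closure h'.2 m
      rw [← moebius_mul _ _ hξ] at this
      convert this using 2
      rw [pow_add]; group
    · exact h' i hi
  -- The past lies in the region of p or at the centre for i = 0, and in the half-plane of h⁻¹
  -- afterwards. The future lies in the closed half-plane of h while powers of h remain, and in the
  -- closed region of p at i = n if the power stops there. In each case the two are δ apart.
  rcases Nat.eq_zero_or_pos i with rfl | hi0
  · rcases Nat.eq_zero_or_pos n with rfl | hn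
    · rcases htail with h' | h'
      · exact absurd rfl h'.1
      · have := h' 0 le_rfl
        rw [pow_zero, mul_one] at this ⊢
        exact P.le_norm_sub_closure_left hA0 (hsub this)
    · have := hin hn
      rw [pow_zero, mul_one] at this ⊢
      exact P.le_norm_sub_closure_left hA0 (hsub this)
  · obtain ⟨m, rfl⟩ : ∃ m, i = m + 1 := ⟨i - 1, by omega⟩
    have hmem : (((A * h ^ (m + 1))⁻¹ • (0 : 𝔻) : 𝔻) : ℂ) ∈ halfPlane h⁻¹ := by
      rw [mul_inv_rev, mul_smul, ← inv_pow]
      exact P.inv.pow_smul_mem hA0 m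
    by_cases hlt : m + 1 < n
    · refine le_norm_sub_of_mem_closure (s := halfPlane h⁻¹) (t := halfPlane h) ?_ hmem (hin hlt)
      intro z hz w hw
      rw [norm_sub_rev]
      exact P.separated_self w hw z hz
    · obtain rfl : m + 1 = n := by omega
      rcases htail with h' | h'
      · exact P.le_norm_sub_closure_right (Or.inl (Or.inr hmem)) h'.2
      · refine le_norm_sub_of_mem_closure (s := halfPlane h⁻¹) (t := halfPlane h) ?_ hmem
          (h' _ le_rfl)
        intro z hz w hw
        rw [norm_sub_rev]
        exact P.separated_self w hw z hz

/-- An infinite reduced word in `h` and `p` converging to `ξ`, cut into its syllables. -/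
structure Itinerary (h p : SU11) (ω : ℕ → SU11) (r : ℕ → ℤ) (ξ : Circle) : Prop where
  block_zero : ω 0 = 1 ∨ ∃ j : ℤ, j ≠ 0 ∧ ω 0 = h ^ j
  block : ∀ i, 1 ≤ i → ∃ j : ℤ, j ≠ 0 ∧ ω i = h ^ j
  power : ∀ i, 1 ≤ i → r i ≠ 0
  -- Convergence is encoded by the direction of the remaining word, the form used by all estimates.
  -- The limit itself is recovered in `Itinerary.tendsto_prefix`.
  tail : ∀ q, moebius (codePrefix p ω r q * ω q)⁻¹ ξ ∈ closure (region p)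

theorem codePrefix_succ (p : SU11) (ω : ℕ → SU11) (r : ℕ → ℤ) (q : ℕ) :
    codePrefix p ω r (q + 1) = codePrefix p ω r q * ω q * p ^ r (q + 1) := by
  rw [codePrefix, mul_assoc]

namespace Itinerary

theorem block_cases (I : Itinerary h p ω r ξ) (q : ℕ) :
    (q = 0 ∧ ω q = 1) ∨ ∃ j : ℤ, j ≠ 0 ∧ ω q = h ^ j := by
  rcases Nat.eq_zero_or_pos q with rfl | hq
  · exact I.block_zero.imp_left fun h => ⟨rfl, h⟩
  · exact Or.inr (I.block q hq)

/-- The position of the centre seen from the end of a prefix: the inverse word begins with the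
inverse of the last syllable. The value 0 accounts for the empty word. -/
theorem inv_prefix_mem_and (I : Itinerary h p ω r ξ) (P : PingPong h p δ κ) (q : ℕ) :
    (((codePrefix p ω r q)⁻¹ • (0 : 𝔻) : 𝔻) : ℂ) ∈ region p ∪ {0} ∧
    (((codePrefix p ω r q * ω q)⁻¹ • (0 : 𝔻) : 𝔻) : ℂ) ∈ region h ∪ {0} := by
  have step : ∀ q, (((codePrefix p ω r q)⁻¹ • (0 : 𝔻) : 𝔻) : ℂ) ∈ region p ∪ {0} →
      (q = 0 → codePrefix p ω r q = 1) →
      (((codePrefix p ω r q * ω q)⁻¹ • (0 : 𝔻) : 𝔻) : ℂ) ∈ region h ∪ {0} := by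
    intro q hq hq0
    rcases I.block_cases q with ⟨h0, h1⟩ | ⟨j, hj, h1⟩
    · right
      rw [hq0 h0, h1]; simp
    · left
      rw [mul_inv_rev, mul_smul, h1, ← zpow_neg]
      exact zpow_smul_mem_region P.trace_left (P.notMem_left hq) (neg_ne_zero.2 hj)
  induction q with
  | zero =>
    have : (((codePrefix p ω r 0)⁻¹ • (0 : 𝔻) : 𝔻) : ℂ) ∈ region p ∪ {0} := by
      right; simp [codePrefix]
    exact ⟨this, step 0 this fun _ => rfl⟩
  | succ q ih =>
    have : (((codePrefix p ω r (q + 1))⁻¹ • (0 : 𝔻) : 𝔻) : ℂ) ∈ region p ∪ {0} := by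
      left
      rw [codePrefix_succ, mul_inv_rev, mul_smul, ← zpow_neg]
      exact zpow_smul_mem_region P.parabolic.1.ge (P.notMem_right ih.2)
        (neg_ne_zero.2 (I.power _ (by omega)))
    exact ⟨this, step _ this fun h => absurd h (by omega)⟩

theorem block_mem (I : Itinerary h p ω r ξ) (q : ℕ) : ω q ∈ Subgroup.closure {h, p} := by
  rcases I.block_cases q with ⟨-, h1⟩ | ⟨j, -, h1⟩
  · rw [h1]; exact one_mem _
  · rw [h1]; exact Subgroup.zpow_mem _ (Subgroup.subset_closure (by simp)) _

theorem prefix_mem (I : Itinerary h p ω r ξ) (q : ℕ) :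
    codePrefix p ω r q ∈ Subgroup.closure {h, p} := by
  induction q with
  | zero => exact one_mem _
  | succ q ih =>
    rw [codePrefix_succ]
    exact mul_mem (mul_mem ih (I.block_mem q))
      (Subgroup.zpow_mem _ (Subgroup.subset_closure (by simp)) _)

theorem tail_prefix (I : Itinerary h p ω r ξ) (P : PingPong h p δ κ) (q : ℕ) :
    moebius (codePrefix p ω r (q + 1))⁻¹ ξ ∈ closure (region h) := by
  have hξ := (Circle.norm_coe ξ).le
  obtain ⟨j, hj, h1⟩ := I.block (q + 1) (by omega)
  have h2 := I.tail (q + 1)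
  have h3 : moebius (codePrefix p ω r (q + 1))⁻¹ ξ =
      moebius (h ^ j) (moebius (codePrefix p ω r (q + 1) * ω (q + 1))⁻¹ ξ) := by
    rw [← moebius_mul _ _ hξ, h1]
    congr 1
    group
  rw [h3]
  refine moebius_mem_closure_image (norm_moebius_le_one _ hξ) h2 fun z hz => ?_
  have hz1 : ‖z‖ < 1 := by
    rcases hz with hz | hz <;> exact norm_lt_one_of_mem_halfPlane hz
  lift z to 𝔻 using hz1
  exact zpow_smul_mem_region P.trace_left (P.notMem_left (Or.inl hz)) hj

/-- The time at which the ray passes near the `q`-th prefix. -/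
noncomputable def prefixTime (p : SU11) (ω : ℕ → SU11) (r : ℕ → ℤ) (q : ℕ) : ℝ :=
  hypDist 0 (codePrefix p ω r q • (0 : 𝔻))

/-- The time at which the ray passes near the end of the `q`-th block. -/
noncomputable def blockTime (p : SU11) (ω : ℕ → SU11) (r : ℕ → ℤ) (q : ℕ) : ℝ :=
  hypDist 0 ((codePrefix p ω r q * ω q) • (0 : 𝔻))

@[simp] theorem prefixTime_zero : prefixTime p ω r 0 = 0 := by simp [prefixTime, codePrefix]

theorem near_block (I : Itinerary h p ω r ξ) (P : PingPong h p δ κ) (q : ℕ) :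
    hypDist (stdRay ξ (blockTime p ω r q)) ((codePrefix p ω r q * ω q) • (0 : 𝔻)) ≤
      2 * Real.arsinh (1 / δ + 1) :=
  hypDist_orbit_stdRay_le P.pos
    (P.le_norm_sub_closure_right (I.inv_prefix_mem_and P q).2 (I.tail q))

theorem near_prefix (I : Itinerary h p ω r ξ) (P : PingPong h p δ κ) (q : ℕ) :
    hypDist (stdRay ξ (prefixTime p ω r (q + 1))) (codePrefix p ω r (q + 1) • (0 : 𝔻)) ≤
      2 * Real.arsinh (1 / δ + 1) :=
  hypDist_orbit_stdRay_le P.pos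
    (P.le_norm_sub_closure_left (I.inv_prefix_mem_and P (q + 1)).1 (I.tail_prefix P q))

theorem blockTime_le (p : SU11) (ω : ℕ → SU11) (r : ℕ → ℤ) (q : ℕ) :
    blockTime p ω r q ≤ prefixTime p ω r q + hypDist 0 (ω q • (0 : 𝔻)) := by
  have := hypDist_triangle 0 (codePrefix p ω r q • (0 : 𝔻))
    ((codePrefix p ω r q * ω q) • (0 : 𝔻))
  rwa [mul_smul, hypDist_smul, ← mul_smul] at this

theorem prefixTime_succ_le (p : SU11) (ω : ℕ → SU11) (r : ℕ → ℤ) (q : ℕ) :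
    prefixTime p ω r (q + 1) ≤ blockTime p ω r q + hypDist 0 (p ^ r (q + 1) • (0 : 𝔻)) := by
  have := hypDist_triangle 0 ((codePrefix p ω r q * ω q) • (0 : 𝔻))
    (codePrefix p ω r (q + 1) • (0 : 𝔻))
  rwa [codePrefix_succ, mul_smul _ (p ^ _), hypDist_smul, ← mul_smul _ (p ^ _),
    ← codePrefix_succ] at this

/-- The defect in the additivity of the lengths of words. -/
noncomputable def defect (δ : ℝ) : ℝ := max 0 (-(2 * Real.log (δ / 2)))

theorem defect_nonneg (δ : ℝ) : 0 ≤ defect δ := le_max_left _ _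

theorem add_sub_defect_le {δ : ℝ} (hδ : 0 < δ) {x y : 𝔻}
    (h : (x : ℂ) = 0 ∨ (y : ℂ) = 0 ∨ δ ≤ ‖(x : ℂ) - y‖) :
    hypDist 0 x + hypDist 0 y - defect δ ≤ hypDist x y := by
  have h0 := defect_nonneg δ
  rcases h with h | h | h
  · rw [UnitDisc.coe_eq_zero] at h
    subst h
    simp; exact h0
  · rw [UnitDisc.coe_eq_zero] at h
    subst h
    rw [hypDist_comm x]
    simp; exact h0
  · have := add_le_hypDist_of_le_norm_sub hδ h
    have := le_max_right 0 (-(2 * Real.log (δ / 2)))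
    rw [defect]; linarith

/-- Seen from the end of the prefix, the centre and the end of the block lie in separated regions,
so lengths add up to the defect. -/
theorem le_blockTime (I : Itinerary h p ω r ξ) (P : PingPong h p δ κ) (q : ℕ) :
    prefixTime p ω r q + hypDist 0 (ω q • (0 : 𝔻)) - defect δ ≤ blockTime p ω r q := by
  have hsep : ((ω q • (0 : 𝔻) : 𝔻) : ℂ) ∈ region h ∪ {0} := by
    rcases I.block_cases q with ⟨-, h1⟩ | ⟨j, hj, h1⟩
    · right; rw [h1]; simp
    · left; rw [h1]
      exact zpow_smul_mem_region P.trace_left (by simpa using P.transverse.zero_left) hj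
  have h1 := add_sub_defect_le P.pos (P.le_norm_sub hsep (I.inv_prefix_mem_and P q).1)
  rw [hypDist_comm (ω q • 0) ((codePrefix p ω r q)⁻¹ • 0),
    ← hypDist_smul (codePrefix p ω r q) ((codePrefix p ω r q)⁻¹ • 0), smul_inv_smul,
    ← mul_smul, hypDist_zero_inv_smul] at h1
  rw [prefixTime, blockTime]
  linarith

theorem le_prefixTime_succ (I : Itinerary h p ω r ξ) (P : PingPong h p δ κ) (q : ℕ) :
    blockTime p ω r q + hypDist 0 (p ^ r (q + 1) • (0 : 𝔻)) - defect δ ≤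
      prefixTime p ω r (q + 1) := by
  have hsep : ((p ^ r (q + 1) • (0 : 𝔻) : 𝔻) : ℂ) ∈ region p ∪ {0} :=
    Or.inl (zpow_smul_mem_region P.parabolic.1.ge (by simpa using P.transverse.zero_right)
      (I.power _ (by omega)))
  have h1 := add_sub_defect_le P.pos (P.le_norm_sub (I.inv_prefix_mem_and P q).2 hsep)
  rw [← hypDist_smul (codePrefix p ω r q * ω q) ((codePrefix p ω r q * ω q)⁻¹ • 0), smul_inv_smul,
    ← mul_smul, ← codePrefix_succ, hypDist_zero_inv_smul] at h1
  rw [prefixTime, blockTime]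
  linarith

/-- Every nontrivial block lengthens the word by a fixed amount. This is what later lets bounded
errors per syllable be absorbed into the block sum. -/
theorem growth_le_blockTime (P : PingPong h p δ κ) (I : Itinerary h p ω r ξ) {q : ℕ}
    (hq : ω q ≠ 1) : prefixTime p ω r q + 2 * Real.log (1 + κ) ≤ blockTime p ω r q := by
  obtain ⟨j, hj, h1⟩ := (I.block_cases q).resolve_left fun h => hq h.2
  have hx := (I.inv_prefix_mem_and P q).1
  have hg := P.growth _ hx
  have hκ := P.growth_pos
  have h2 : 1 + κ ≤ ‖den (h ^ (-j)) ((codePrefix p ω r q)⁻¹ • (0 : 𝔻) : 𝔻)‖ := by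
    obtain ⟨n, rfl | rfl⟩ := j.eq_nat_or_neg
    · have hn : (1 : ℝ) ≤ n := by
        exact_mod_cast Nat.one_le_iff_ne_zero.2 fun h0 => hj (by simp [h0])
      have := le_norm_den_pow (g := h⁻¹) (by rw [trace_inv]; exact P.trace_left) hg.2 n
      rw [zpow_neg, zpow_natCast, ← inv_pow]
      nlinarith
    · have hn : (1 : ℝ) ≤ n := by
        exact_mod_cast Nat.one_le_iff_ne_zero.2 fun h0 => hj (by simp [h0])
      have := le_norm_den_pow (g := h) P.trace_left hg.1 n
      rw [neg_neg, zpow_natCast]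
      nlinarith
  have h3 := add_log_le_hypDist_smul hκ.le h2
  rw [← mul_smul, zpow_neg, ← h1, ← mul_inv_rev, hypDist_zero_inv_smul, hypDist_zero_inv_smul] at h3
  exact h3

theorem prefixTime_le_blockTime (P : PingPong h p δ κ) (I : Itinerary h p ω r ξ) (q : ℕ) :
    prefixTime p ω r q ≤ blockTime p ω r q := by
  by_cases hq : ω q = 1
  · rw [prefixTime, blockTime, hq, mul_one]
  · have := growth_le_blockTime P I hq
    have := Real.log_nonneg (by linarith [P.growth_pos] : 1 ≤ 1 + κ)
    linarith

theorem blockTime_le_prefixTime_succ (P : PingPong h p δ κ) (I : Itinerary h p ω r ξ) (q : ℕ) :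
    blockTime p ω r q ≤ prefixTime p ω r (q + 1) := by
  have hx := (notMem_region_iff p _).1 (P.notMem_right (I.inv_prefix_mem_and P q).2)
  have hr := I.power (q + 1) (by omega)
  have h2 : 1 + 0 ≤ ‖den (p ^ (-r (q + 1))) ((codePrefix p ω r q * ω q)⁻¹ • (0 : 𝔻) : 𝔻)‖ := by
    obtain ⟨n, hn | hn⟩ := (r (q + 1)).eq_nat_or_neg
    · have := le_norm_den_pow (g := p⁻¹) (κ := 0) (by rw [trace_inv]; exact P.parabolic.1.ge)
        (by simpa using hx.2.le) n
      rw [hn, zpow_neg, zpow_natCast, ← inv_pow]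
      simpa using this
    · have := le_norm_den_pow (g := p) (κ := 0) P.parabolic.1.ge (by simpa using hx.1.le) n
      rw [hn, neg_neg, zpow_natCast]
      simpa using this
  have h3 := add_log_le_hypDist_smul le_rfl h2
  rw [← mul_smul, zpow_neg, ← mul_inv_rev, ← codePrefix_succ, hypDist_zero_inv_smul,
    hypDist_zero_inv_smul] at h3
  simpa [prefixTime, blockTime] using h3

theorem ne_one (P : PingPong h p δ κ) (I : Itinerary h p ω r ξ) {q : ℕ} (hq : 1 ≤ q) :
    ω q ≠ 1 := by
  obtain ⟨j, hj, h1⟩ := I.block q hq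
  rw [h1]
  intro h2
  have := zpow_smul_mem_region P.trace_left (z := 0) (by simpa using P.transverse.zero_left) hj
  rw [h2, one_smul] at this
  exact P.transverse.zero_left (by simpa using this)

theorem tendsto_prefixTime (P : PingPong h p δ κ) (I : Itinerary h p ω r ξ) :
    Tendsto (prefixTime p ω r) atTop atTop := by
  have hl := Real.log_pos (by linarith [P.growth_pos] : 1 < 1 + κ)
  have h1 : ∀ q : ℕ, (q : ℝ) * (2 * Real.log (1 + κ)) ≤ prefixTime p ω r (q + 1) := by
    intro q
    induction q with
    | zero => simpa [prefixTime] using hypDist_nonneg _ _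
    | succ q ih =>
      have e1 := growth_le_blockTime P I (I.ne_one P (q := q + 1) (by omega))
      have e2 := blockTime_le_prefixTime_succ P I (q + 1)
      push_cast
      linarith
  rw [← tendsto_add_atTop_iff_nat 1]
  exact tendsto_atTop_mono h1 (tendsto_natCast_atTop_atTop.atTop_mul_const (by linarith))

theorem mem_orbitNhd_of_mem_block (P : PingPong h p δ κ) (I : Itinerary h p ω r ξ) (q : ℕ) {t : ℝ}
    (ht : prefixTime p ω r q ≤ t) (ht' : t ≤ blockTime p ω r q) :
    stdRay ξ t ∈ orbitNhd (Subgroup.closure {h, p})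
      (hypDist 0 (h • (0 : 𝔻)) + 2 * Real.arsinh (1 / δ + 1)) := by
  have hh : h ∈ Subgroup.closure {h, p} := Subgroup.subset_closure (by simp)
  have hx := (I.inv_prefix_mem_and P q).1
  have htail := I.tail q
  rw [prefixTime] at ht
  rw [blockTime] at ht'
  rcases I.block_cases q with ⟨h0, h1⟩ | ⟨j, hj, h1⟩
  · subst h0
    have ht0 : t = 0 := by
      rw [h1, mul_one] at ht'
      simp only [codePrefix, one_smul, hypDist_self] at ht ht'
      linarith
    rw [ht0, stdRay_zero]
    refine ⟨1, one_mem _, ?_⟩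
    rw [one_smul, hypDist_self]
    have : 0 ≤ Real.arsinh (1 / δ + 1) := by
      rw [Real.arsinh_nonneg_iff]
      have := P.pos
      positivity
    have := hypDist_nonneg 0 (h • (0 : 𝔻))
    linarith
  · rw [h1] at ht' htail
    obtain ⟨n, rfl | rfl⟩ := j.eq_nat_or_neg
    · rw [zpow_natCast] at ht' htail
      exact P.mem_orbitNhd_of_pow hh (I.prefix_mem q) hx
        (Or.inl ⟨fun h0 => hj (by simp [h0]), htail⟩) ht ht'
    · rw [zpow_neg, zpow_natCast, ← inv_pow] at ht' htail
      have := P.inv.mem_orbitNhd_of_pow (inv_mem hh) (I.prefix_mem q) hx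
        (Or.inl ⟨fun h0 => hj (by simp [h0]), htail⟩) ht ht'
      rwa [hypDist_zero_inv_smul] at this

/-- The excursion into the cusp meets the thick part only near its ends. -/
theorem exists_excursion_bound (P : PingPong h p δ κ) (R : ℝ) : ∃ C, 0 ≤ C ∧
    ∀ {ω : ℕ → SU11} {r : ℕ → ℤ} {ξ : Circle}, Itinerary h p ω r ξ → ∀ q t,
      blockTime p ω r q ≤ t → t ≤ prefixTime p ω r (q + 1) →
      stdRay ξ t ∈ orbitNhd (Subgroup.closure {h, p}) R →
      t ≤ blockTime p ω r q + C ∨ prefixTime p ω r (q + 1) - C ≤ t := by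
  obtain ⟨C, hC⟩ := P.exists_excursion_bound R
  obtain ⟨C', hC'⟩ := P.parabolic.exists_abs_hypDist_zpow_sub_le
  set c := 2 * Real.arsinh (1 / δ + 1)
  refine ⟨max 0 (C + C' + c), le_max_left _ _, fun {ω r ξ} I q t ht ht' hmem => ?_⟩
  have hr := I.power (q + 1) (by omega)
  set B := codePrefix p ω r q * ω q with hB
  have hBmem : B ∈ Subgroup.closure {h, p} := mul_mem (I.prefix_mem q) (I.block_mem q)
  have h1 := hC _ (smul_mem_orbitNhd (inv_mem hBmem) hmem) _ hr
  have h2 := (abs_le.1 (hC' _ hr)).2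
  have h3 := prefixTime_succ_le p ω r q
  have h4 := le_max_right 0 (C + C' + c)
  -- A thick point is almost the whole excursion length away from one endpoint. As the ray has unit
  -- speed and the excursion lasts at most 2 ln|r| + C', it is then near the other endpoint.
  rcases h1 with h1 | h1
  · right
    rw [hypDist_comm, hypDist_smul_left, inv_inv] at h1
    have h5 := hypDist_triangle (stdRay ξ t) (stdRay ξ (blockTime p ω r q)) (B • 0)
    rw [hypDist_stdRay, abs_of_nonneg (by linarith)] at h5
    have h6 := I.near_block P q
    linarith
  · left
    rw [hypDist_smul_left, inv_inv, ← mul_smul, hB, ← codePrefix_succ] at h1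
    have h5 := hypDist_triangle (stdRay ξ t) (stdRay ξ (prefixTime p ω r (q + 1)))
      (codePrefix p ω r (q + 1) • 0)
    rw [hypDist_stdRay, abs_sub_comm, abs_of_nonneg (by linarith)] at h5
    have h6 := I.near_prefix P q
    linarith

end Itinerary

/-! ### Codings at level one -/

theorem countable_closure_pair (h p : SU11) : Countable (Subgroup.closure {h, p}) := by
  have : Countable (FreeGroup ({h, p} : Set SU11)) := by unfold FreeGroup; infer_instance
  rw [FreeGroup.closure_eq_range]
  exact (FreeGroup.lift ((↑) : ({h, p} : Set SU11) → SU11)).rangeRestrict_surjective.countable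

theorem IsBlock.eq_zpow {γ : SU11} (hγ : IsBlock h p 1 γ) : ∃ j : ℤ, j ≠ 0 ∧ γ = h ^ j := by
  cases hγ with
  | single j hj => exact ⟨j, hj, rfl⟩
  | cons j l γ hj hl hl1 _ =>
    exfalso
    have := Int.one_le_abs hl
    push_cast at hl1
    omega

theorem inv_codePrefix_mul_smul_mem (P : PingPong h p δ κ)
    (hblock : ∀ i, 1 ≤ i → ∃ j : ℤ, j ≠ 0 ∧ ω i = h ^ j) (hpow : ∀ i, 1 ≤ i → r i ≠ 0) (m : ℕ) :
    ∀ q, 1 ≤ q → ((((codePrefix p ω r q)⁻¹ * codePrefix p ω r (q + m)) • (0 : 𝔻) : 𝔻) : ℂ) ∈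
      region h ∪ {0} := by
  induction m with
  | zero => intro q _; right; simp
  | succ m ih =>
    intro q hq
    obtain ⟨j, hj, h1⟩ := hblock q hq
    have h2 := ih (q + 1) (by omega)
    have e : (codePrefix p ω r q)⁻¹ * codePrefix p ω r (q + (m + 1)) =
        h ^ j * (p ^ r (q + 1) *
          ((codePrefix p ω r (q + 1))⁻¹ * codePrefix p ω r (q + 1 + m))) := by
      rw [codePrefix_succ, h1, show q + (m + 1) = q + 1 + m by ring]; group
    left
    rw [e, mul_smul]
    refine zpow_smul_mem_region P.trace_left (P.notMem_left (Or.inl ?_)) hj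
    rw [mul_smul]
    exact zpow_smul_mem_region P.parabolic.1.ge (P.notMem_right h2) (hpow _ (by omega))

/-- At level one no nonzero exponent of p is short, so blocks are powers of h. The tails are limits
of finite words beginning with a power of p, which ping-pong places in the region of p. -/
theorem IsCoding.itinerary (P : PingPong h p δ κ) (hc : IsCoding h p 1 ω r ξ) :
    Itinerary h p ω r ξ := by
  have hblock : ∀ i, 1 ≤ i → ∃ j : ℤ, j ≠ 0 ∧ ω i = h ^ j := fun i hi => (hc.block i hi).eq_zpow
  have hpow : ∀ i, 1 ≤ i → r i ≠ 0 := by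
    intro i hi h0
    have := hc.le_power i hi
    rw [h0] at this
    norm_num at this
  refine ⟨?_, hblock, hpow, fun q => ?_⟩
  · rcases hc.initial with h0 | ⟨l, γ, hl, hγ, h0⟩
    · exact Or.inl h0
    · right
      obtain ⟨j, hj, rfl⟩ := hγ.eq_zpow
      have hl0 : l = 0 := by
        by_contra hne
        have := Int.one_le_abs hne
        push_cast at hl
        omega
      exact ⟨j, hj, by rw [h0, hl0, zpow_zero, one_mul]⟩
  · have hlim : Tendsto (fun m : ℕ => moebius (codePrefix p ω r q * ω q)⁻¹
        ((codePrefix p ω r (q + 1 + m) • (0 : 𝔻) : 𝔻) : ℂ)) atTop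
        (𝓝 (moebius (codePrefix p ω r q * ω q)⁻¹ ξ)) := by
      refine (continuousAt_moebius _ (Circle.norm_coe ξ).le).tendsto.comp ?_
      have := hc.tendsto.comp (tendsto_add_atTop_nat (q + 1))
      refine this.congr fun m => ?_
      simp only [Function.comp]
      rw [add_comm]
    refine mem_closure_of_tendsto hlim (Eventually.of_forall fun m => ?_)
    rw [← coe_smul, ← mul_smul]
    have e : (codePrefix p ω r q * ω q)⁻¹ * codePrefix p ω r (q + 1 + m) =
        p ^ r (q + 1) * ((codePrefix p ω r (q + 1))⁻¹ * codePrefix p ω r (q + 1 + m)) := by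
      rw [codePrefix_succ]; group
    rw [e, mul_smul]
    exact zpow_smul_mem_region P.parabolic.1.ge
      (P.notMem_right (inv_codePrefix_mul_smul_mem P hblock hpow m _ (by omega))) (hpow _ (by omega))

/-- Points at bounded hyperbolic distance from the ray become Euclidean close to it as they approach
the circle. -/
theorem Itinerary.tendsto_prefix (P : PingPong h p δ κ) (I : Itinerary h p ω r ξ) :
    Tendsto (fun q : ℕ => ((codePrefix p ω r q • (0 : 𝔻) : 𝔻) : ℂ)) atTop (𝓝 (ξ : ℂ)) := by
  have h1 : Tendsto (fun q => (stdRay ξ (prefixTime p ω r q) : ℂ)) atTop (𝓝 (ξ : ℂ)) :=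
    (endsAt_stdRay ξ).comp (I.tendsto_prefixTime P)
  set c := Real.sinh (2 * Real.arsinh (1 / δ + 1) / 2)
  have h2 : Tendsto (fun q => c * (2 * Real.exp (-(prefixTime p ω r q / 2)))) atTop (𝓝 0) := by
    have := Real.tendsto_exp_neg_atTop_nhds_zero.comp
      ((I.tendsto_prefixTime P).atTop_div_const two_pos)
    simpa using (this.const_mul 2).const_mul c
  have h3 : Tendsto (fun q => (stdRay ξ (prefixTime p ω r q) : ℂ) -
      (codePrefix p ω r q • (0 : 𝔻) : 𝔻)) atTop (𝓝 0) := by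
    refine squeeze_zero_norm' ?_ h2
    filter_upwards [eventually_ge_atTop 1] with q hq
    obtain ⟨m, rfl⟩ : ∃ m, q = m + 1 := ⟨q - 1, by omega⟩
    have h4 := I.near_prefix P m
    set x := stdRay ξ (prefixTime p ω r (m + 1))
    set y := codePrefix p ω r (m + 1) • (0 : 𝔻) with hy
    have h5 : Real.sinh (hypDist x y / 2) ≤ c := Real.sinh_le_sinh.2 (by linarith)
    have h6 : wt y ≤ 2 * Real.exp (-(prefixTime p ω r (m + 1) / 2)) := by
      refine le_trans (le_of_eq ?_) (one_div_cosh_le _)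
      rw [Itinerary.prefixTime, ← hy, cosh_half_hypDist_zero, one_div_one_div]
    rw [← sinh_half_mul]
    have hx := wt_le_one x
    have hx0 := wt_pos x
    have hy0 := wt_pos y
    have hs : 0 ≤ Real.sinh (hypDist x y / 2) :=
      Real.sinh_nonneg_iff.2 (by linarith [hypDist_nonneg x y])
    have h7 : wt x * wt y ≤ 2 * Real.exp (-(prefixTime p ω r (m + 1) / 2)) := by nlinarith
    exact mul_le_mul h5 h7 (by positivity) (hs.trans h5)
  have := h1.sub h3
  simpa using this

/-! ### Existence of itineraries -/

section Occupation

variable (Γ : Subgroup SU11) [Countable Γ] (ξ : Circle) (R : ℝ)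

theorem occupation_eq_add (a b : ℝ) : occupation Γ ξ R b = occupation Γ ξ R a +
    ∫ t in a..b, (orbitNhd Γ R).indicator (fun _ => (1 : ℝ)) (stdRay ξ t) :=
  (intervalIntegral.integral_add_adjacent_intervals
    (intervalIntegrable_indicator_stdRay Γ ξ R 0 a)
    (intervalIntegrable_indicator_stdRay Γ ξ R a b)).symm

theorem occupation_mono {a b : ℝ} (hab : a ≤ b) : occupation Γ ξ R a ≤ occupation Γ ξ R b := by
  rw [occupation_eq_add Γ ξ R a b]
  have : 0 ≤ ∫ t in a..b, (orbitNhd Γ R).indicator (fun _ => (1 : ℝ)) (stdRay ξ t) :=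
    intervalIntegral.integral_nonneg hab fun _ _ => Set.indicator_nonneg (fun _ _ => zero_le_one) _
  linarith

theorem occupation_le_add {a b : ℝ} (hab : a ≤ b) :
    occupation Γ ξ R b ≤ occupation Γ ξ R a + (b - a) := by
  rw [occupation_eq_add Γ ξ R a b]
  have : ∫ t in a..b, (orbitNhd Γ R).indicator (fun _ => (1 : ℝ)) (stdRay ξ t) ≤
      ∫ _ in a..b, (1 : ℝ) := by
    refine intervalIntegral.integral_mono_on hab (intervalIntegrable_indicator_stdRay Γ ξ R a b)
      intervalIntegrable_const fun t _ => ?_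
    exact Set.indicator_le_self' (fun _ _ => zero_le_one) _
  rw [intervalIntegral.integral_const, smul_eq_mul, mul_one] at this
  linarith

theorem occupation_eq_add_of_forall_mem {a b : ℝ} (hab : a ≤ b)
    (h : ∀ t, a ≤ t → t ≤ b → stdRay ξ t ∈ orbitNhd Γ R) :
    occupation Γ ξ R b = occupation Γ ξ R a + (b - a) := by
  rw [occupation_eq_add Γ ξ R a b]
  have : ∫ t in a..b, (orbitNhd Γ R).indicator (fun _ => (1 : ℝ)) (stdRay ξ t) =
      ∫ _ in a..b, (1 : ℝ) := by
    refine intervalIntegral.integral_congr fun t ht => ?_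
    rw [Set.uIcc_of_le hab] at ht
    exact Set.indicator_of_mem (h t ht.1 ht.2) _
  rw [this, intervalIntegral.integral_const, smul_eq_mul, mul_one]

theorem occupation_eq_of_forall_notMem {a b : ℝ} (hab : a ≤ b)
    (h : ∀ t, a < t → t < b → stdRay ξ t ∉ orbitNhd Γ R) :
    occupation Γ ξ R b = occupation Γ ξ R a := by
  rw [occupation_eq_add Γ ξ R a b]
  have : ∫ t in a..b, (orbitNhd Γ R).indicator (fun _ => (1 : ℝ)) (stdRay ξ t) = 0 := by
    apply intervalIntegral.integral_zero_ae
    have hb : ∀ᵐ t : ℝ, t ≠ b := by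
      simp [MeasureTheory.ae_iff, MeasureTheory.measure_singleton]
    filter_upwards [hb] with t htb ht
    rw [Set.uIoc_of_le hab] at ht
    exact Set.indicator_of_notMem (h t ht.1 (lt_of_le_of_ne ht.2 htb)) _
  rw [this, add_zero]

theorem not_tendsto_occupation_of_eventually_mem
    (h : ∀ᶠ t in atTop, stdRay ξ t ∈ orbitNhd Γ R) :
    ¬ Tendsto (fun T => 1 / T * occupation Γ ξ R T) atTop (𝓝 0) := by
  intro hlim
  obtain ⟨T₀, h⟩ := eventually_atTop.1 h
  have h1 := hlim.eventually (gt_mem_nhds (show (0 : ℝ) < 1 / 2 by norm_num))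
  obtain ⟨T, hT1, hT2, hT3⟩ := (h1.and ((eventually_ge_atTop (2 * max T₀ 0)).and
    (eventually_gt_atTop 0))).exists
  have hle : max T₀ 0 ≤ T := by linarith [le_max_right T₀ 0]
  have h2 := occupation_eq_add_of_forall_mem Γ ξ R hle
    fun t ht _ => h t ((le_max_left _ _).trans ht)
  have h3 := occupation_nonneg Γ ξ R (le_max_right T₀ 0)
  rw [one_div, inv_mul_lt_iff₀ hT3] at hT1
  linarith

end Occupation

/-- This rules out readings that end with an infinite power of h: such a ray ultimately follows the
orbit. -/
theorem PingPong.eventually_mem_orbitNhd (P : PingPong h p δ κ) {Γ : Subgroup SU11} (hh : h ∈ Γ)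
    {A : SU11} (hA : A ∈ Γ) (hA0 : ((A⁻¹ • (0 : 𝔻) : 𝔻) : ℂ) ∈ region p ∪ {0})
    (htail : ∀ i : ℕ, moebius (h ^ i)⁻¹ (moebius A⁻¹ ξ) ∈ closure (halfPlane h)) :
    ∀ᶠ t in atTop, stdRay ξ t ∈
      orbitNhd Γ (hypDist 0 (h • (0 : 𝔻)) + 2 * Real.arsinh (1 / δ + 1)) := by
  filter_upwards [eventually_ge_atTop (hypDist 0 (A • (0 : 𝔻)))] with t ht
  have hκ := P.growth_pos
  -- With this n, the growth 2 ln(1 + nκ) ≥ t puts A h^n(0) at distance at least t from the centre.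
  obtain ⟨n, hn⟩ := exists_nat_ge (Real.exp (t / 2) / κ)
  rw [div_le_iff₀ hκ] at hn
  refine P.mem_orbitNhd_of_pow hh hA hA0 (n := n) (Or.inr fun i _ => ?_) ht ?_
  · rw [mul_inv_rev, moebius_mul _ _ (Circle.norm_coe ξ).le]
    exact htail i
  · have h1 := le_norm_den_pow (g := h⁻¹) (by rw [trace_inv]; exact P.trace_left)
      (P.growth _ hA0).2 n
    have h2 := add_log_le_hypDist_smul (by positivity) h1
    rw [← mul_smul, inv_pow, ← mul_inv_rev, hypDist_zero_inv_smul, hypDist_zero_inv_smul] at h2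
    have h3 := Real.log_le_log (Real.exp_pos _) (show Real.exp (t / 2) ≤ 1 + n * κ by linarith)
    rw [Real.log_exp] at h3
    linarith [hypDist_nonneg 0 (A • (0 : 𝔻))]

/-- By the cocycle relation the factor of k⁻ⁿ at η is a product of n factors of norm at most 1, one
per visit to the closed half-plane, hence bounded. -/
theorem moebius_eq_of_forall_mem_closure {k : SU11} (hk : IsParabolic k) {η : ℂ} (hη : ‖η‖ ≤ 1)
    (h : ∀ n : ℕ, moebius (k ^ n)⁻¹ η ∈ closure (halfPlane k)) : moebius k⁻¹ η = η := by
  refine hk.inv.moebius_eq_of_norm_den_pow_le hη fun n => ?_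
  induction n with
  | zero => simp
  | succ n ih =>
    rw [pow_succ', den_mul _ _ hη, norm_mul]
    have := (closure_halfPlane_subset k (h n)).2
    rw [← inv_pow] at this
    exact mul_le_one₀ this (norm_nonneg _) ih

theorem isParabolicPoint_of_moebius_inv {k b : SU11} {Γ : Subgroup SU11} (hk : IsParabolic k)
    (hkΓ : k ∈ Γ) (hb : b ∈ Γ) (h : moebius k (moebius b⁻¹ ξ) = moebius b⁻¹ ξ) :
    IsParabolicPoint Γ ξ := by
  have hξ := (Circle.norm_coe ξ).le
  refine ⟨b * k * b⁻¹, mul_mem (mul_mem hb hkΓ) (inv_mem hb), by simpa using hk.conj b⁻¹, ?_⟩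
  rw [moebius_mul _ _ hξ, moebius_mul _ _ (norm_moebius_le_one _ hξ), h, moebius_moebius_inv _ hξ]

theorem PingPong.exists_itinerary (P : PingPong h p δ κ) [Countable (Subgroup.closure {h, p})]
    (hξ : DivergesOnAverage (Subgroup.closure {h, p}) ξ)
    (hnp : ¬ IsParabolicPoint (Subgroup.closure {h, p}) ξ) :
    ∃ (ω : ℕ → SU11) (r : ℕ → ℤ), Itinerary h p ω r ξ := by
  have hh : h ∈ Subgroup.closure {h, p} := Subgroup.subset_closure (by simp)
  have hp : p ∈ Subgroup.closure {h, p} := Subgroup.subset_closure (by simp)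
  have hξn := Circle.norm_coe ξ
  rw [divergesOnAverage_iff] at hξ
  obtain ⟨hlim, hocc⟩ := hξ
  have hstep : ∀ A ∈ Subgroup.closure {h, p}, ((A⁻¹ • (0 : 𝔻) : 𝔻) : ℂ) ∈ region p ∪ {0} →
      moebius A⁻¹ ξ ∈ closure (wordOrbit h p) →
      ∃ j : ℤ, j ≠ 0 ∧ moebius (A * h ^ j)⁻¹ ξ ∈ closure (wordOrbit p h) := by
    intro A hA hA0 hmem
    rcases exists_zpow_inv_mem_closure_or P.transverse (norm_moebius_eq_one _ hξn) hmem with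
      ⟨j, hj, hmem'⟩ | hall | hall
    · refine ⟨j, hj, ?_⟩
      rwa [mul_inv_rev, moebius_mul _ _ hξn.le]
    · exact absurd (hocc _) (not_tendsto_occupation_of_eventually_mem _ _ _
        (P.eventually_mem_orbitNhd hh hA hA0 hall))
    · exact absurd (hocc _) (not_tendsto_occupation_of_eventually_mem _ _ _
        (P.inv.eventually_mem_orbitNhd (inv_mem hh) hA hA0 hall))
  have hstep' : ∀ b ∈ Subgroup.closure {h, p}, moebius b⁻¹ ξ ∈ closure (wordOrbit p h) →
      ∃ j : ℤ, j ≠ 0 ∧ moebius (b * p ^ j)⁻¹ ξ ∈ closure (wordOrbit h p) := by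
    intro b hb hmem
    rcases exists_zpow_inv_mem_closure_or P.transverse.symm (norm_moebius_eq_one _ hξn) hmem with
      ⟨j, hj, hmem'⟩ | hall | hall
    · refine ⟨j, hj, ?_⟩
      rwa [mul_inv_rev, moebius_mul _ _ hξn.le]
    · exact absurd (isParabolicPoint_of_moebius_inv P.parabolic.inv (inv_mem hp) hb
        (moebius_eq_of_forall_mem_closure P.parabolic (norm_moebius_le_one _ hξn.le) hall)) hnp
    · have := moebius_eq_of_forall_mem_closure P.parabolic.inv (norm_moebius_le_one _ hξn.le) hall
      rw [inv_inv] at this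
      exact absurd (isParabolicPoint_of_moebius_inv P.parabolic hp hb this) hnp
  -- A prefix after which a power of p has to be read; one transition reads p^l and then h^j.
  let State : SU11 → Prop := fun b => b ∈ Subgroup.closure {h, p} ∧
    ((b⁻¹ • (0 : 𝔻) : 𝔻) : ℂ) ∈ region h ∪ {0} ∧ moebius b⁻¹ ξ ∈ closure (wordOrbit p h)
  have hinit : ∃ b, (b = 1 ∨ ∃ j : ℤ, j ≠ 0 ∧ b = h ^ j) ∧ State b := by
    rcases mem_closure_wordOrbit_of_isLimitPoint hlim with hm | hm
    · obtain ⟨j, hj, hmem⟩ := hstep 1 (one_mem _) (Or.inr (by simp)) (by simpa using hm)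
      rw [one_mul] at hmem
      refine ⟨h ^ j, Or.inr ⟨j, hj, rfl⟩, Subgroup.zpow_mem _ hh j, Or.inl ?_, hmem⟩
      rw [← zpow_neg]
      exact zpow_smul_mem_region P.trace_left (by simpa using P.transverse.zero_left)
        (neg_ne_zero.2 hj)
    · exact ⟨1, Or.inl rfl, one_mem _, Or.inr (by simp), by simpa using hm⟩
  have hnext : ∀ b : {b // State b}, ∃ rj : ℤ × ℤ, rj.1 ≠ 0 ∧ rj.2 ≠ 0 ∧
      State (b.1 * p ^ rj.1 * h ^ rj.2) := by
    rintro ⟨b, hb, hb0, hmem⟩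
    obtain ⟨l, hl, hmem'⟩ := hstep' b hb hmem
    have hA : b * p ^ l ∈ Subgroup.closure {h, p} := mul_mem hb (Subgroup.zpow_mem _ hp l)
    have hA0 : (((b * p ^ l)⁻¹ • (0 : 𝔻) : 𝔻) : ℂ) ∈ region p ∪ {0} := by
      left
      rw [mul_inv_rev, mul_smul, ← zpow_neg]
      exact zpow_smul_mem_region P.parabolic.1.ge (P.notMem_right hb0) (neg_ne_zero.2 hl)
    obtain ⟨j, hj, hmem''⟩ := hstep _ hA hA0 hmem'
    refine ⟨(l, j), hl, hj, mul_mem hA (Subgroup.zpow_mem _ hh j), Or.inl ?_, hmem''⟩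
    rw [mul_inv_rev, mul_smul, ← zpow_neg]
    exact zpow_smul_mem_region P.trace_left (P.notMem_left hA0) (neg_ne_zero.2 hj)
  choose f hf1 hf2 hf3 using hnext
  obtain ⟨b₀, hb₀, hS₀⟩ := hinit
  let seq : ℕ → {b // State b} := fun n => Nat.rec ⟨b₀, hS₀⟩
    (fun _ b => ⟨b.1 * p ^ (f b).1 * h ^ (f b).2, hf3 b⟩) n
  let ω : ℕ → SU11 := fun n => Nat.casesOn n b₀ fun m => h ^ (f (seq m)).2
  let r : ℕ → ℤ := fun n => Nat.casesOn n 0 fun m => (f (seq m)).1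
  have hseq : ∀ q, codePrefix p ω r q * ω q = (seq q).1 := by
    intro q
    induction q with
    | zero =>
      rw [codePrefix, one_mul]
      rfl
    | succ q ih => rw [codePrefix_succ, ih]
  refine ⟨ω, r, hb₀, fun i hi => ?_, fun i hi => ?_, fun q => ?_⟩
  · obtain ⟨m, rfl⟩ : ∃ m, i = m + 1 := ⟨i - 1, by omega⟩
    exact ⟨_, hf2 (seq m), rfl⟩
  · obtain ⟨m, rfl⟩ : ∃ m, i = m + 1 := ⟨i - 1, by omega⟩
    exact hf1 (seq m)
  · rw [hseq]
    exact closure_mono (wordOrbit_subset P.transverse.symm) (seq q).2.2.2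

/-! ### Comparison of block lengths and excursion lengths -/

/-- The total length of the blocks up to the `q`-th one. -/
noncomputable def blockSum (ω : ℕ → SU11) (q : ℕ) : ℝ :=
  ∑ i ∈ Finset.range (q + 1), hypDist 0 (ω i • (0 : 𝔻))

/-- The total length of the first `q` excursions. -/
noncomputable def excursionSum (r : ℕ → ℤ) (q : ℕ) : ℝ :=
  ∑ i ∈ Finset.Icc 1 q, 2 * Real.log |(r i : ℝ)|

theorem blockSum_succ (ω : ℕ → SU11) (q : ℕ) :
    blockSum ω (q + 1) = blockSum ω q + hypDist 0 (ω (q + 1) • (0 : 𝔻)) :=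
  Finset.sum_range_succ _ _

@[simp] theorem blockSum_zero (ω : ℕ → SU11) : blockSum ω 0 = hypDist 0 (ω 0 • (0 : 𝔻)) := by
  simp [blockSum]

@[simp] theorem excursionSum_zero (r : ℕ → ℤ) : excursionSum r 0 = 0 := by simp [excursionSum]

theorem excursionSum_succ (r : ℕ → ℤ) (q : ℕ) :
    excursionSum r (q + 1) = excursionSum r q + 2 * Real.log |(r (q + 1) : ℝ)| :=
  Finset.sum_Icc_succ_top (by omega) _

theorem blockSum_nonneg (ω : ℕ → SU11) (q : ℕ) : 0 ≤ blockSum ω q :=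
  Finset.sum_nonneg fun _ _ => hypDist_nonneg _ _

/-- The bookkeeping device for all comparisons: negligibility of D against S survives errors bounded
by multiples of D. The first bound on η gives ηE ≤ 1/2, hence D ≤ 2ηS'; the second gives 2ηK ≤ η'.
-/
theorem exists_le_mul_transfer (K E : ℝ) (hK : 0 ≤ K) (hE : 0 ≤ E) {η' : ℝ} (hη' : 0 < η') :
    ∃ η > 0, ∀ D S D' S' : ℝ, 0 < D → D ≤ η * S → D' ≤ K * D → S - E * D ≤ S' →
      D' ≤ η' * S' ∧ 0 < S' := by
  refine ⟨min (1 / (2 * (E + 1))) (η' / (2 * (K + 1))), by positivity,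
    fun D S D' S' hD h1 h2 h3 => ?_⟩
  set η := min (1 / (2 * (E + 1))) (η' / (2 * (K + 1)))
  have hη : 0 < η := by positivity
  have e1 : η * (2 * (E + 1)) ≤ 1 := by
    have := min_le_left (1 / (2 * (E + 1))) (η' / (2 * (K + 1)))
    rwa [← le_div_iff₀ (by positivity)]
  have e2 : η * (2 * (K + 1)) ≤ η' := by
    have := min_le_right (1 / (2 * (E + 1))) (η' / (2 * (K + 1)))
    rwa [← le_div_iff₀ (by positivity)]
  have e3 : D ≤ 2 * η * S' := by
    have : η * (S - E * D) ≤ η * S' := by gcongr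
    nlinarith
  have hS' : 0 < S' := by
    by_contra! hle
    nlinarith
  refine ⟨?_, hS'⟩
  calc D' ≤ K * D := h2
    _ ≤ K * (2 * η * S') := by gcongr
    _ ≤ η * (2 * (K + 1)) * S' := by nlinarith [mul_pos hη hS']
    _ ≤ η' * S' := by gcongr

theorem tendsto_div_zero_of_forall_le {α : Type*} {l : Filter α} {D S : α → ℝ} (hD : ∀ q, 0 ≤ D q)
    (h : ∀ η > 0, ∀ᶠ q in l, D q ≤ η * S q ∧ 0 < S q) : Tendsto (fun q => D q / S q) l (𝓝 0) := by
  rw [Metric.tendsto_nhds]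
  intro ε hε
  filter_upwards [h (ε / 2) (by linarith)] with q ⟨h1, h2⟩
  rw [Real.dist_eq, sub_zero, abs_of_nonneg (div_nonneg (hD q) h2.le), div_lt_iff₀ h2]
  nlinarith

theorem eventually_le_mul_of_tendsto_div {α : Type*} {l : Filter α} {D S : α → ℝ}
    (h : Tendsto (fun q => D q / S q) l (𝓝 0)) (hS : ∀ᶠ q in l, 0 < S q) {η : ℝ} (hη : 0 < η) :
    ∀ᶠ q in l, D q ≤ η * S q := by
  filter_upwards [h.eventually (gt_mem_nhds hη), hS] with q h1 h2
  rw [div_lt_iff₀ h2] at h1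
  exact h1.le

namespace Itinerary

theorem growth_le_hypDist (P : PingPong h p δ κ) (I : Itinerary h p ω r ξ) {q : ℕ} (hq : 1 ≤ q) :
    2 * Real.log (1 + κ) ≤ hypDist 0 (ω q • (0 : 𝔻)) := by
  have h1 := growth_le_blockTime P I (I.ne_one P hq)
  have h2 := blockTime_le p ω r q
  linarith

/-- It turns errors linear in the number q of excursions into multiples of the block sum. -/
theorem mul_growth_le_blockSum (P : PingPong h p δ κ) (I : Itinerary h p ω r ξ) (q : ℕ) :
    q * (2 * Real.log (1 + κ)) ≤ blockSum ω q := by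
  induction q with
  | zero => simpa using blockSum_nonneg ω 0
  | succ q ih =>
    have := I.growth_le_hypDist P (q := q + 1) (by omega)
    rw [blockSum_succ]
    push_cast
    linarith

theorem occupation_prefixTime_le (P : PingPong h p δ κ) [Countable (Subgroup.closure {h, p})]
    (R : ℝ) : ∃ C, 0 ≤ C ∧ ∀ {ω : ℕ → SU11} {r : ℕ → ℤ} {ξ : Circle}, Itinerary h p ω r ξ → ∀ q,
      occupation (Subgroup.closure {h, p}) ξ R (prefixTime p ω r (q + 1)) ≤
        blockSum ω q + (q + 1) * C := by
  obtain ⟨C, hC0, hC⟩ := exists_excursion_bound P R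
  refine ⟨2 * C, by linarith, fun {ω r ξ} I q => ?_⟩
  set occ := occupation (Subgroup.closure {h, p}) ξ R
  have hblock : ∀ q, occ (blockTime p ω r q) ≤ occ (prefixTime p ω r q) +
      hypDist 0 (ω q • (0 : 𝔻)) := by
    intro q
    have h1 := occupation_le_add (Subgroup.closure {h, p}) ξ R (prefixTime_le_blockTime P I q)
    have h2 := blockTime_le p ω r q
    linarith
  have hexc : ∀ q, occ (prefixTime p ω r (q + 1)) ≤ occ (blockTime p ω r q) + 2 * C := by
    intro q
    -- A short excursion is counted entirely; a long one contributes at most C at each end.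
    rcases le_total (prefixTime p ω r (q + 1)) (blockTime p ω r q + 2 * C) with hle | hle
    · have h1 := occupation_le_add (Subgroup.closure {h, p}) ξ R (blockTime_le_prefixTime_succ P I q)
      linarith
    · have h1 := occupation_le_add (Subgroup.closure {h, p}) ξ R
        (show blockTime p ω r q ≤ blockTime p ω r q + C by linarith)
      have h2 := occupation_eq_of_forall_notMem (Subgroup.closure {h, p}) ξ R
        (show blockTime p ω r q + C ≤ prefixTime p ω r (q + 1) - C by linarith)
        (fun t ht ht' hmem => by
          rcases hC I q t (by linarith) (by linarith) hmem with h' | h' <;> linarith)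
      have h3 := occupation_le_add (Subgroup.closure {h, p}) ξ R
        (show prefixTime p ω r (q + 1) - C ≤ prefixTime p ω r (q + 1) by linarith)
      linarith
  induction q with
  | zero =>
    have h1 := hblock 0
    have h2 := hexc 0
    have h3 : occ (prefixTime p ω r 0) = 0 := by
      rw [prefixTime_zero]
      exact intervalIntegral.integral_same
    rw [h3] at h1
    simp only [blockSum_zero, Nat.cast_zero]
    linarith
  | succ q ih =>
    have h1 := hblock (q + 1)
    have h2 := hexc (q + 1)
    rw [blockSum_succ]
    push_cast at ih ⊢
    linarith

theorem exists_time_bounds (P : PingPong h p δ κ) : ∃ C, 0 ≤ C ∧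
    ∀ {ω : ℕ → SU11} {r : ℕ → ℤ} {ξ : Circle}, Itinerary h p ω r ξ → ∀ q : ℕ,
      excursionSum r q - q * C ≤ prefixTime p ω r q ∧
      blockTime p ω r q ≤ blockSum ω q + excursionSum r q + q * C := by
  obtain ⟨C, hC⟩ := P.parabolic.exists_abs_hypDist_zpow_sub_le
  have hC0 : 0 ≤ C := (abs_nonneg _).trans (hC 1 one_ne_zero)
  have hd := defect_nonneg δ
  refine ⟨C + defect δ, by positivity, fun {ω r ξ} I q => ?_⟩
  induction q with
  | zero =>
    have := blockTime_le p ω r 0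
    simp only [prefixTime_zero] at this
    simp only [excursionSum_zero, prefixTime_zero, blockSum_zero, Nat.cast_zero]
    constructor <;> linarith
  | succ q ih =>
    have h1 := abs_le.1 (hC _ (I.power (q + 1) (by omega)))
    have h2 := I.le_prefixTime_succ P q
    have h3 := prefixTime_succ_le p ω r q
    have h4 := blockTime_le p ω r (q + 1)
    have h5 := prefixTime_le_blockTime P I q
    rw [excursionSum_succ, blockSum_succ]
    push_cast
    constructor <;> linarith [h1.1, h1.2, ih.1, ih.2]

theorem tendsto_occupation (P : PingPong h p δ κ) [Countable (Subgroup.closure {h, p})]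
    (I : Itinerary h p ω r ξ)
    (hneg : ∀ η > 0, ∀ᶠ q in atTop, blockSum ω q ≤ η * excursionSum r q) (R : ℝ) :
    Tendsto (fun T => 1 / T * occupation (Subgroup.closure {h, p}) ξ R T) atTop (𝓝 0) := by
  have hl := Real.log_pos (by linarith [P.growth_pos] : 1 < 1 + κ)
  set L := 2 * Real.log (1 + κ)
  have hL : 0 < L := by positivity
  obtain ⟨C, hC0, hC⟩ := occupation_prefixTime_le P R
  obtain ⟨C', hC0', hC'⟩ := exists_time_bounds P
  have key : ∀ η > 0, ∀ᶠ T in atTop,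
      -- Truncation at 0 makes the numerator nonnegative for every T, as
      -- `tendsto_div_zero_of_forall_le` requires.
      occupation (Subgroup.closure {h, p}) ξ R (max T 0) ≤ η * T ∧ 0 < T := by
    intro η hη
    obtain ⟨η₀, hη₀, H⟩ := exists_le_mul_transfer (1 + 2 * C / L) (C' / L) (by positivity)
      (by positivity) hη
    obtain ⟨Q, hQ⟩ := eventually_atTop.1 (hneg η₀ hη₀)
    filter_upwards [eventually_ge_atTop (prefixTime p ω r (max Q 1)), eventually_ge_atTop 0]
      with T hT hT0
    obtain ⟨n, hn1, hn2⟩ := ((I.tendsto_prefixTime P).eventually (eventually_gt_atTop T) |>.and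
      (eventually_ge_atTop (max Q 1))).exists
    obtain ⟨q, hq1, -, hq2, hq3⟩ := exists_mem_Icc_succ _ hT hn1 hn2
    have hqQ : Q ≤ q := (le_max_left _ _).trans hq1
    have hq0 : (1 : ℝ) ≤ q := by exact_mod_cast (le_max_right _ _).trans hq1
    have h1 := hC I q
    have h2 := (hC' I q).1
    have h3 := I.mul_growth_le_blockSum P q
    have h4 : (q : ℝ) ≤ blockSum ω q / L := (le_div_iff₀ hL).2 h3
    rw [max_eq_left hT0]
    refine H (blockSum ω q) (excursionSum r q) _ T ?_ (hQ q hqQ) ?_ ?_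
    · have : 0 < (q : ℝ) * L := by positivity
      exact this.trans_le h3
    · refine (occupation_mono _ ξ R hq3.le).trans (h1.trans ?_)
      have : ((q : ℝ) + 1) * C ≤ 2 * (blockSum ω q / L) * C := by gcongr; linarith
      calc blockSum ω q + (q + 1) * C ≤ blockSum ω q + 2 * (blockSum ω q / L) * C := by linarith
        _ = _ := by ring
    · have : (q : ℝ) * C' ≤ blockSum ω q / L * C' := by gcongr
      have e : C' / L * blockSum ω q = blockSum ω q / L * C' := by ring
      rw [e]
      linarith
  have := tendsto_div_zero_of_forall_le (fun T => occupation_nonneg _ ξ R (le_max_right T 0)) key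
  refine this.congr' ?_
  filter_upwards [eventually_ge_atTop 0] with T hT
  rw [max_eq_left hT]; ring

theorem blockSum_negligible (P : PingPong h p δ κ) [Countable (Subgroup.closure {h, p})]
    (I : Itinerary h p ω r ξ)
    (hocc : ∀ R, Tendsto (fun T => 1 / T * occupation (Subgroup.closure {h, p}) ξ R T) atTop (𝓝 0))
    {η : ℝ} (hη : 0 < η) : ∀ᶠ q in atTop, blockSum ω q ≤ η * excursionSum r q := by
  have hl := Real.log_pos (by linarith [P.growth_pos] : 1 < 1 + κ)
  set L := 2 * Real.log (1 + κ) with hLdef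
  have hL : 0 < L := by positivity
  obtain ⟨C, hC0, hC⟩ := exists_time_bounds P
  have hd0 := defect_nonneg δ
  set R := hypDist 0 (h • (0 : 𝔻)) + 2 * Real.arsinh (1 / δ + 1)
  set occ := occupation (Subgroup.closure {h, p}) ξ R with hoccdef
  -- A nontrivial block lasts at least L, so the additivity defect is at most defect/L times its
  -- duration.
  set M := 1 + defect δ / L
  have hM : 0 ≤ M := by positivity
  have hlen : ∀ q, hypDist 0 (ω q • (0 : 𝔻)) ≤ M * (blockTime p ω r q - prefixTime p ω r q) := by
    intro q
    by_cases hq : ω q = 1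
    · have := prefixTime_le_blockTime P I q
      rw [hq, one_smul, hypDist_self]
      exact mul_nonneg hM (by linarith)
    · have h1 := growth_le_blockTime P I hq
      have h2 := I.le_blockTime P q
      have h3 : defect δ ≤ defect δ / L * (blockTime p ω r q - prefixTime p ω r q) := by
        rw [div_mul_eq_mul_div, le_div_iff₀ hL]
        gcongr
        linarith
      have e : M * (blockTime p ω r q - prefixTime p ω r q) =
        (blockTime p ω r q - prefixTime p ω r q) +
        defect δ / L * (blockTime p ω r q - prefixTime p ω r q) := by ring
      linarith
  -- The ray is thick during every block, so block durations are counted in full by the occupation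
  -- time.
  have hsum : ∀ q, blockSum ω q ≤ M * occ (blockTime p ω r q) := by
    have hstep : ∀ q, occ (blockTime p ω r q) = occ (prefixTime p ω r q) +
        (blockTime p ω r q - prefixTime p ω r q) := fun q =>
      occupation_eq_add_of_forall_mem _ ξ R (prefixTime_le_blockTime P I q)
        fun t ht ht' => mem_orbitNhd_of_mem_block P I q ht ht'
    intro q
    induction q with
    | zero =>
      rw [blockSum_zero, hstep]
      have h0 : 0 ≤ occ (prefixTime p ω r 0) := by
        rw [prefixTime_zero]
        exact occupation_nonneg _ ξ R le_rfl
      have := hlen 0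
      nlinarith
    | succ q ih =>
      have h1 : occ (blockTime p ω r q) ≤ occ (prefixTime p ω r (q + 1)) :=
        occupation_mono _ ξ R (blockTime_le_prefixTime_succ P I q)
      have := hlen (q + 1)
      rw [blockSum_succ, hstep]
      nlinarith
  have htend : Tendsto (blockTime p ω r) atTop atTop :=
    tendsto_atTop_mono (prefixTime_le_blockTime P I) (I.tendsto_prefixTime P)
  obtain ⟨η₀, hη₀, H⟩ := exists_le_mul_transfer M ((1 + C / L) * M) hM (by positivity) hη
  have h1 := ((hocc R).comp htend).eventually (gt_mem_nhds hη₀)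
  filter_upwards [h1, htend.eventually (eventually_gt_atTop 0), eventually_ge_atTop 1]
    with q hq1 hq2 hq3
  have hq0 : (1 : ℝ) ≤ q := by exact_mod_cast hq3
  have h3 := I.mul_growth_le_blockSum P q
  have hpos : 0 < blockSum ω q := by
    have : 0 < (q : ℝ) * L := by positivity
    exact this.trans_le h3
  have h4 : (q : ℝ) ≤ blockSum ω q / L := (le_div_iff₀ hL).2 h3
  have hsq := hsum q
  refine (H (occ (blockTime p ω r q)) (blockTime p ω r q) (blockSum ω q) (excursionSum r q)
    ?_ ?_ hsq ?_).1
  · by_contra! hle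
    nlinarith
  · simp only [Function.comp] at hq1
    rw [one_div, inv_mul_lt_iff₀ hq2, mul_comm] at hq1
    exact hq1.le
  · have h5 := (hC I q).2
    have h6 : (q : ℝ) * C ≤ C / L * blockSum ω q := by
      calc (q : ℝ) * C ≤ blockSum ω q / L * C := by gcongr
        _ = _ := by ring
    have h7 : (1 + C / L) * blockSum ω q ≤ (1 + C / L) * (M * occ (blockTime p ω r q)) := by
      gcongr
    rw [mul_assoc]
    linarith

end Itinerary

theorem blockSum_eq (ω : ℕ → SU11) (q : ℕ) :
    blockSum ω q = ∑ i ∈ Finset.range (q + 1), hypDist 0 (ω i • (0 : 𝔻)) := rfl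

/-! ### Regrouping the short excursions into the blocks -/

/-- The part of the word between the excursions `m` and `n + 1`. -/
noncomputable def segment (p : SU11) (ω : ℕ → SU11) (r : ℕ → ℤ) (m n : ℕ) : SU11 :=
  (codePrefix p ω r m)⁻¹ * (codePrefix p ω r n * ω n)

theorem segment_self (p : SU11) (ω : ℕ → SU11) (r : ℕ → ℤ) (m : ℕ) :
    segment p ω r m m = ω m := by
  rw [segment]; group

theorem segment_eq_mul (p : SU11) (ω : ℕ → SU11) (r : ℕ → ℤ) (m n : ℕ) :
    segment p ω r m n = ω m * p ^ r (m + 1) * segment p ω r (m + 1) n := by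
  rw [segment, segment, codePrefix_succ]; group

theorem Itinerary.isBlock_segment (I : Itinerary h p ω r ξ) {N : ℕ} (e : ℕ) :
    ∀ m, 1 ≤ m → (∀ i, m < i → i ≤ m + e → |r i| < N) →
      IsBlock h p N (segment p ω r m (m + e)) := by
  induction e with
  | zero =>
    intro m hm _
    obtain ⟨j, hj, h1⟩ := I.block m hm
    rw [add_zero, segment_self, h1]
    exact .single j hj
  | succ e ih =>
    intro m hm hsmall
    obtain ⟨j, hj, h1⟩ := I.block m hm
    rw [segment_eq_mul, h1]
    refine .cons j _ _ hj (I.power _ (by omega)) (hsmall _ (by omega) (by omega)) ?_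
    rw [show m + (e + 1) = m + 1 + e by ring]
    exact ih (m + 1) (by omega) fun i hi hi' => hsmall i (by omega) (by omega)

theorem Itinerary.isInitialBlock_segment (I : Itinerary h p ω r ξ) {N : ℕ} (hN : 1 ≤ N) (n : ℕ)
    (hsmall : ∀ i, 0 < i → i ≤ n → |r i| < N) : IsInitialBlock h p N (segment p ω r 0 n) := by
  rcases Nat.eq_zero_or_pos n with rfl | hn
  · rw [segment_self]
    rcases I.block_zero with h0 | ⟨j, hj, h0⟩
    · exact Or.inl h0
    · exact Or.inr ⟨0, h ^ j, by rw [abs_zero]; exact_mod_cast hN, .single j hj, by rw [h0, zpow_zero, one_mul]⟩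
  · right
    obtain ⟨e, rfl⟩ : ∃ e, n = 1 + e := ⟨n - 1, by omega⟩
    have hb := I.isBlock_segment (N := N) e 1 le_rfl fun i hi hi' => hsmall i (by omega) hi'
    rw [segment_eq_mul, zero_add]
    -- If the word starts with a short power of p, this is the leading p^l allowed in an initial
    -- block.
    rcases I.block_zero with h0 | ⟨j, hj, h0⟩
    · exact ⟨r 1, _, hsmall 1 one_pos (by omega), hb, by rw [h0, one_mul]⟩
    · refine ⟨0, _, by rw [abs_zero]; exact_mod_cast hN, .cons j (r 1) _ hj (I.power 1 le_rfl)
        (hsmall 1 one_pos (by omega)) hb, ?_⟩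
      rw [h0, zpow_zero, one_mul]

/-- The bound is a difference of one function of the index at both ends, so that it telescopes over
consecutive segments. -/
theorem hypDist_segment_le {c : ℝ} (hc : 0 ≤ c) (e : ℕ) :
    ∀ m, (∀ i, m < i → i ≤ m + e → hypDist 0 (p ^ r i • (0 : 𝔻)) ≤ c) →
      hypDist 0 (segment p ω r m (m + e) • (0 : 𝔻)) ≤
        (∑ i ∈ Finset.range (m + e + 1), hypDist 0 (ω i • (0 : 𝔻)) + (m + e + 1 : ℕ) * c) -
        (∑ i ∈ Finset.range m, hypDist 0 (ω i • (0 : 𝔻)) + m * c) := by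
  have htri : ∀ a b : SU11, hypDist 0 ((a * b) • (0 : 𝔻)) ≤
      hypDist 0 (a • (0 : 𝔻)) + hypDist 0 (b • (0 : 𝔻)) := by
    intro a b
    have := hypDist_triangle 0 (a • (0 : 𝔻)) ((a * b) • (0 : 𝔻))
    rwa [mul_smul, hypDist_smul, ← mul_smul] at this
  induction e with
  | zero =>
    intro m _
    rw [add_zero, segment_self, Finset.sum_range_succ]
    push_cast
    linarith
  | succ e ih =>
    intro m hsmall
    have h1 := ih (m + 1) fun i hi hi' => hsmall i (by omega) (by omega)
    have h2 := hsmall (m + 1) (by omega) (by omega)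
    have h3 := htri (ω m * p ^ r (m + 1)) (segment p ω r (m + 1) (m + (e + 1)))
    have h4 := htri (ω m) (p ^ r (m + 1))
    rw [segment_eq_mul]
    rw [Finset.sum_range_succ _ m, show m + 1 + e = m + (e + 1) by ring] at h1
    push_cast at h1 ⊢
    linarith

theorem excursionSum_sub_le {c : ℝ} {a b : ℕ} (hab : a ≤ b)
    (hsmall : ∀ i, a < i → i ≤ b → 2 * Real.log |(r i : ℝ)| ≤ c) :
    excursionSum r b - b * c ≤ excursionSum r a - a * c := by
  induction b, hab using Nat.le_induction with
  | base => exact le_rfl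
  | succ b hab ih =>
    have h1 := ih fun i hi hi' => hsmall i hi (by omega)
    have h2 := hsmall (b + 1) (by omega) le_rfl
    rw [excursionSum_succ]
    push_cast
    linarith

theorem two_mul_log_le_of_abs_lt {N : ℕ} {l : ℤ} (hl : l ≠ 0) (h : |l| < N) :
    2 * Real.log |(l : ℝ)| ≤ 2 * Real.log N := by
  have h1 : |(l : ℝ)| ≤ N := by
    have : |(l : ℝ)| < N := by exact_mod_cast h
    exact this.le
  have h2 : 0 < |(l : ℝ)| := by positivity
  linarith [Real.log_le_log h2 h1]

/-- With finitely many large powers the excursion sum would grow at most linearly, while the block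
sum grows at least linearly, so it could not be negligible. -/
theorem Itinerary.infinite_large_powers (P : PingPong h p δ κ) (I : Itinerary h p ω r ξ)
    (hneg : ∀ η > 0, ∀ᶠ q in atTop, blockSum ω q ≤ η * excursionSum r q) (N : ℕ) :
    {i : ℕ | 1 ≤ i ∧ (N : ℤ) ≤ |r i|}.Infinite := by
  intro hfin
  obtain ⟨a, ha⟩ := hfin.bddAbove
  have hl := Real.log_pos (by linarith [P.growth_pos] : 1 < 1 + κ)
  set L := 2 * Real.log (1 + κ)
  have hL : 0 < L := by positivity
  have hc : 0 ≤ 2 * Real.log N := by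
    have := Real.log_natCast_nonneg N
    positivity
  set c := 2 * Real.log N
  obtain ⟨η, hη, H⟩ := exists_le_mul_transfer 1 (c / L) (by norm_num) (by positivity) one_pos
  have hbd : ∀ q, a ≤ q → excursionSum r q - q * c ≤ excursionSum r a - a * c := by
    intro q hq
    refine excursionSum_sub_le hq fun i hi _ => two_mul_log_le_of_abs_lt (I.power i (by omega)) ?_
    by_contra! hle
    have := ha (show i ∈ {i : ℕ | 1 ≤ i ∧ (N : ℤ) ≤ |r i|} from ⟨by omega, hle⟩)
    omega
  obtain ⟨n, hn⟩ := exists_nat_gt ((excursionSum r a - a * c) / L)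
  rw [div_lt_iff₀ hL] at hn
  obtain ⟨q, hq, hqn, hqa, hq1⟩ := ((hneg η hη).and ((eventually_ge_atTop n).and
    ((eventually_ge_atTop a).and (eventually_ge_atTop 1)))).exists
  have h1 := I.mul_growth_le_blockSum P q
  have h2 := hbd q hqa
  have hq0 : (1 : ℝ) ≤ q := by exact_mod_cast hq1
  have hqn' : (n : ℝ) ≤ q := by exact_mod_cast hqn
  have hpos : 0 < blockSum ω q := by
    have : 0 < (q : ℝ) * L := by positivity
    exact this.trans_le h1
  have h3 : (q : ℝ) * c ≤ c / L * blockSum ω q := by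
    rw [div_mul_eq_mul_div, le_div_iff₀ hL]
    nlinarith
  have h4 := (H (blockSum ω q) (excursionSum r q) (blockSum ω q) (excursionSum r a - a * c) hpos hq
    (by linarith) (by linarith)).1
  nlinarith

theorem Itinerary.exists_isCoding (P : PingPong h p δ κ) (I : Itinerary h p ω r ξ)
    (hneg : ∀ η > 0, ∀ᶠ q in atTop, blockSum ω q ≤ η * excursionSum r q) {N : ℕ} (hN : 1 ≤ N) :
    ∃ (ω' : ℕ → SU11) (r' : ℕ → ℤ), IsCoding h p N ω' r' ξ ∧
      ∀ η > 0, ∀ᶠ q in atTop, blockSum ω' q ≤ η * excursionSum r' q ∧ 0 < excursionSum r' q := by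
  have hinf := I.infinite_large_powers P hneg N
  let large : ℕ → Prop := fun i => 1 ≤ i ∧ (N : ℤ) ≤ |r i|
  classical
  have hinf' : {i | large i}.Infinite := hinf
  -- The indices of the powers kept at level N. The new blocks run from one of them to just before
  -- the next, whence the ends `n (k + 1) - 1`.
  let n : ℕ → ℕ := Nat.nth large
  have hn : ∀ k, large (n k) := Nat.nth_mem_of_infinite hinf'
  have hmono : StrictMono n := Nat.nth_strictMono hinf'
  have hgap0 : ∀ i, 0 < i → i < n 0 → |r i| < N := by
    intro i hi hlt
    by_contra! hle
    have hli : large i := ⟨hi, hle⟩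
    have h1 := Nat.nth_count hli
    have h2 : n 0 ≤ n (Nat.count large i) := hmono.monotone (Nat.zero_le _)
    have h3 : n (Nat.count large i) = i := h1
    omega
  have hgap : ∀ k i, n k < i → i < n (k + 1) → |r i| < N := by
    intro k i hi hlt
    by_contra! hle
    have hli : large i := ⟨by omega, hle⟩
    have h3 : n (Nat.count large i) = i := Nat.nth_count hli
    rw [← h3] at hi hlt
    have := hmono.lt_iff_lt.1 hi
    have := hmono.lt_iff_lt.1 hlt
    omega
  have hn1 : ∀ k, 1 ≤ n k := fun k => (hn k).1
  let ω' : ℕ → SU11 := fun k => Nat.casesOn k (segment p ω r 0 (n 0 - 1))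
    fun k => segment p ω r (n k) (n (k + 1) - 1)
  let r' : ℕ → ℤ := fun k => Nat.casesOn k 0 fun k => r (n k)
  have hpre : ∀ m k, 1 ≤ k → codePrefix p ω r m * (segment p ω r m (k - 1) * p ^ r k) =
      codePrefix p ω r k := by
    intro m k hk
    obtain ⟨k, rfl⟩ : ∃ l, k = l + 1 := ⟨k - 1, by omega⟩
    rw [segment, codePrefix_succ, Nat.add_sub_cancel]; group
  have hprefix : ∀ k, codePrefix p ω' r' (k + 1) = codePrefix p ω r (n k) := by
    intro k
    induction k with
    | zero => exact hpre 0 (n 0) (hn1 0)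
    | succ k ih =>
      rw [codePrefix, ih]
      exact hpre (n k) (n (k + 1)) (hn1 _)
  have hlt : ∀ k, n k < n (k + 1) := fun k => hmono (Nat.lt_succ_self k)
  refine ⟨ω', r', ⟨?_, ?_, ?_, ?_⟩, ?_⟩
  · exact I.isInitialBlock_segment hN _ fun i hi hi' => hgap0 i hi (by have := hn1 0; omega)
  · intro i hi
    obtain ⟨k, rfl⟩ : ∃ k, i = k + 1 := ⟨i - 1, by omega⟩
    have h1 := hlt k
    have h2 := I.isBlock_segment (N := N) (n (k + 1) - 1 - n k) (n k) (hn1 k)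
      fun i hi hi' => hgap k i hi (by omega)
    rwa [show n k + (n (k + 1) - 1 - n k) = n (k + 1) - 1 by omega] at h2
  · intro i hi
    obtain ⟨k, rfl⟩ : ∃ k, i = k + 1 := ⟨i - 1, by omega⟩
    exact (hn k).2
  · rw [← tendsto_add_atTop_iff_nat 1]
    refine ((I.tendsto_prefix P).comp hmono.tendsto_atTop).congr fun k => ?_
    rw [hprefix]; rfl
  · have hl := Real.log_pos (by linarith [P.growth_pos] : 1 < 1 + κ)
    set L := 2 * Real.log (1 + κ)
    have hL : 0 < L := by positivity
    obtain ⟨C, hC⟩ := P.parabolic.exists_abs_hypDist_zpow_sub_le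
    have hC0 : 0 ≤ C := (abs_nonneg _).trans (hC 1 one_ne_zero)
    have hlogN := Real.log_natCast_nonneg N
    set c := 2 * Real.log N + C
    have hc : 0 ≤ c := by positivity
    have hshort : ∀ i, 1 ≤ i → |r i| < N → hypDist 0 (p ^ r i • (0 : 𝔻)) ≤ c := by
      intro i hi hlt
      have h1 := (abs_le.1 (hC _ (I.power i hi))).2
      have h2 := two_mul_log_le_of_abs_lt (I.power i hi) hlt
      linarith
    have hblock : ∀ k, blockSum ω' k ≤ blockSum ω (n k - 1) + n k * c := by
      intro k
      induction k with
      | zero =>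
        have h1 := hypDist_segment_le (p := p) (ω := ω) (r := r) hc (n 0 - 1) 0
          fun i hi hi' => hshort i hi (hgap0 i hi (by have := hn1 0; omega))
        rw [blockSum_zero]
        have e : 0 + (n 0 - 1) + 1 = n 0 := by have := hn1 0; omega
        rw [e] at h1
        simp only [zero_add, Finset.range_zero, Finset.sum_empty, Nat.cast_zero, zero_mul,
          sub_zero] at h1
        rw [blockSum, show n 0 - 1 + 1 = n 0 by have := hn1 0; omega]
        exact h1
      | succ k ih =>
        have hk := hlt k
        have hk1 := hn1 k
        have h1 := hypDist_segment_le (p := p) (ω := ω) (r := r) hc (n (k + 1) - 1 - n k) (n k)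
          fun i hi hi' => hshort i (by omega) (hgap k i hi (by omega))
        rw [show n k + (n (k + 1) - 1 - n k) + 1 = n (k + 1) by omega,
          show n k + (n (k + 1) - 1 - n k) = n (k + 1) - 1 by omega] at h1
        rw [blockSum_eq ω, show n k - 1 + 1 = n k by omega] at ih
        rw [blockSum_succ, blockSum_eq ω, show n (k + 1) - 1 + 1 = n (k + 1) by omega]
        have h2 : hypDist 0 (ω' (k + 1) • (0 : 𝔻)) =
          hypDist 0 (segment p ω r (n k) (n (k + 1) - 1) • (0 : 𝔻)) := rfl
        rw [h2]
        linarith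
    -- The first k kept powers all have index at most n k - 1, and each discarded one costs at most
    -- 2 ln N. Old and new sums are thus compared just before the next kept power.
    have hexc : ∀ k, excursionSum r (n k - 1) - (n k - 1 : ℕ) * (2 * Real.log N) ≤
        excursionSum r' k := by
      intro k
      induction k with
      | zero =>
        have h1 := excursionSum_sub_le (r := r) (c := 2 * Real.log N) (Nat.zero_le (n 0 - 1))
          fun i hi hi' => two_mul_log_le_of_abs_lt (I.power i hi)
            (hgap0 i hi (by have := hn1 0; omega))
        simpa using h1
      | succ k ih =>
        have hk := hlt k
        have hk1 := hn1 k
        have h1 := excursionSum_sub_le (r := r) (c := 2 * Real.log N)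
          (show n k ≤ n (k + 1) - 1 by omega)
          fun i hi hi' => two_mul_log_le_of_abs_lt (I.power i (by omega))
            (hgap k i hi (by omega))
        have h2 : excursionSum r (n k) =
            excursionSum r (n k - 1) + 2 * Real.log |(r (n k) : ℝ)| := by
          have := excursionSum_succ r (n k - 1)
          rwa [show n k - 1 + 1 = n k by omega] at this
        have h3 : ((n k : ℕ) : ℝ) = ((n k - 1 : ℕ) : ℝ) + 1 := by
          rw [Nat.cast_sub hk1]; push_cast; ring
        rw [excursionSum_succ]
        have h4 : 2 * Real.log |(r' (k + 1) : ℝ)| = 2 * Real.log |(r (n k) : ℝ)| := rfl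
        rw [h4]
        rw [h2, h3] at h1
        nlinarith
    intro η hη
    obtain ⟨η₀, hη₀, H⟩ := exists_le_mul_transfer (1 + 2 * c / L) (2 * Real.log N / L)
      (by positivity) (by positivity) hη
    have htend : Tendsto (fun k => n k - 1) atTop atTop :=
      (tendsto_sub_atTop_nat 1).comp hmono.tendsto_atTop
    filter_upwards [htend.eventually (hneg η₀ hη₀), htend.eventually (eventually_ge_atTop 1)]
      with k hk1 hk2
    have h1 := I.mul_growth_le_blockSum P (n k - 1)
    set q := n k - 1 with hq
    have hnq : ((n k : ℕ) : ℝ) = (q : ℝ) + 1 := by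
      rw [hq, Nat.cast_sub (hn1 k)]; push_cast; ring
    have hq0 : (1 : ℝ) ≤ q := by exact_mod_cast hk2
    have h4 : (q : ℝ) ≤ blockSum ω q / L := (le_div_iff₀ hL).2 h1
    refine H (blockSum ω q) (excursionSum r q) _ _ ?_ hk1 ?_ ?_
    · have : 0 < (q : ℝ) * L := by positivity
      exact this.trans_le h1
    · refine (hblock k).trans ?_
      have : (n k : ℝ) * c ≤ 2 * (blockSum ω q / L) * c := by gcongr; linarith
      calc blockSum ω q + n k * c ≤ blockSum ω q + 2 * (blockSum ω q / L) * c := by linarith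
        _ = _ := by ring
    · have h5 := hexc k
      have h6 : (q : ℝ) * (2 * Real.log N) ≤ 2 * Real.log N / L * blockSum ω q := by
        calc (q : ℝ) * (2 * Real.log N) ≤ blockSum ω q / L * (2 * Real.log N) := by gcongr
          _ = _ := by ring
      linarith

/-! ### The characterization of points diverging on average -/

theorem isLimitPoint_of_isCoding (P : PingPong h p δ κ) (hc : IsCoding h p 1 ω r ξ) :
    IsLimitPoint (Subgroup.closure {h, p}) ξ :=
  mem_closure_of_tendsto hc.tendsto (Eventually.of_forall fun q =>
    ⟨_, (hc.itinerary P).prefix_mem q, rfl⟩)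

end SchottkyDisc

theorem theorem1 (h p : SchottkyDisc.SU11) (hS : SchottkyDisc.IsSchottkyPair h p) (ξ : Circle) :
    SchottkyDisc.DivergesOnAverage (Subgroup.closure {h, p}) ξ ↔
      SchottkyDisc.IsParabolicPoint (Subgroup.closure {h, p}) ξ ∨
      ∀ N : ℕ, 1 ≤ N →
        ∃ (ω : ℕ → SchottkyDisc.SU11) (r : ℕ → ℤ),
          SchottkyDisc.IsCoding h p N ω r ξ ∧
          (∀ᶠ q : ℕ in Filter.atTop, 0 < ∑ i ∈ Finset.Icc 1 q, 2 * Real.log |(r i : ℝ)|) ∧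
          Filter.Tendsto
            (fun q : ℕ =>
              (∑ i ∈ Finset.range (q + 1), SchottkyDisc.hypDist 0 (ω i • (0 : Complex.UnitDisc))) /
                (∑ i ∈ Finset.Icc 1 q, 2 * Real.log |(r i : ℝ)|))
            Filter.atTop (nhds 0) := by
  obtain ⟨δ, κ, P⟩ := hS.exists_pingPong
  have := SchottkyDisc.countable_closure_pair h p
  constructor
  · intro hξ
    by_cases hnp : SchottkyDisc.IsParabolicPoint (Subgroup.closure {h, p}) ξ
    · exact Or.inl hnp
    right
    obtain ⟨ω, r, I⟩ := P.exists_itinerary hξ hnp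
    have hocc := ((SchottkyDisc.divergesOnAverage_iff _ ξ).1 hξ).2
    intro N hN
    obtain ⟨ω', r', hc, hneg⟩ := I.exists_isCoding P (fun η hη => I.blockSum_negligible P hocc hη) hN
    exact ⟨ω', r', hc, (hneg 1 one_pos).mono fun q hq => hq.2,
      SchottkyDisc.tendsto_div_zero_of_forall_le (SchottkyDisc.blockSum_nonneg ω') hneg⟩
  · rintro (hξ | hξ)
    · exact P.divergesOnAverage_of_isParabolicPoint hξ
    -- Level one alone gives the converse, since its blocks are single powers of h, along which the
    -- ray is known to be thick.
    · obtain ⟨ω, r, hc, hpos, hlim⟩ := hξ 1 le_rfl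
      rw [SchottkyDisc.divergesOnAverage_iff]
      refine ⟨SchottkyDisc.isLimitPoint_of_isCoding P hc, fun R => ?_⟩
      exact (hc.itinerary P).tendsto_occupation P
        (fun η hη => SchottkyDisc.eventually_le_mul_of_tendsto_div hlim hpos hη) R
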